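/- Let $\Omega=[0,2\pi]^2$ with periodic boundary conditions, let $H$ be the space of real, mean-free, divergence-free $L^2$ vector fields on $\Omega$ with norm $|\cdot|$, and let $V\subset H$ be the subspace of fields with square integrable gradient, with norm $\|u\|=\big(\sum_{j}\int_\Omega|\partial_ju|^2dx\big)^{1/2}$. Let $\mathbb P$ be the Leray projection, $A=-\mathbb P\Delta$ the Stokes operator, $B(u,w)=\mathbb P((u\cdot\nabla)w)$, and let $P_K$ be the projection onto Fourier wavenumbers $|k|\le K$. Let $\nu>0$, $K>0$, $\theta_1,\theta_2\in\mathbb R$ with $\theta_1+\theta_2=1$, and let $g=(g_1,g_2)\in L^\infty(0,\infty;H)^2$ be synchronous, i.e. $|g_1(t)-g_2(t)|\to0$ as $t\to\infty$. Put $$\mathfrak g_j=\frac{\sup_{t\ge0}|g_j(t)|}{\nu^2}\quad(j=1,2),\qquad \mathfrak g=(\mathfrak g_1^2+\mathfrak g_2^2)^{1/2}.$$ Let $v=(v_1,v_2)$ be a global solution of the symmetric direct-replacement intertwinement $$\begin{aligned}\partial_tv_1+\nu Av_1+B(v_1,v_1)&=g_1+\theta_1P_KB(v_1,v_1)-\theta_2P_KB(v_2,v_2),\\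 \partial_tv_2+\nu Av_2+B(v_2,v_2)&=g_2-\theta_2P_KB(v_1,v_1)+\theta_1P_KB(v_2,v_2),\end{aligned}$$ with $v\in\big(C([0,T];V)\cap L^2(0,T;D(A))\big)^2$ for all $T>0$ and $v(0)=v_0\in V\times V$, and write $\|v\|=(\|v_1\|^2+\|v_2\|^2)^{1/2}$. There exist absolute constants $C_1,C_2,C_3>0$ (independent of $\nu,K,\theta_1,\theta_2,g,v_0,v,\mathfrak m_0$) such that if, for some $\mathfrak m_0$, $$\|v_0\|\le\nu\mathfrak m_0,\qquad K\ge C_1\ln(e+K)^{1/2}\mathfrak g,\qquad \min\{|1-\theta_1|,|\theta_1-\theta_2|\}\le\frac{C_2}{\ln(e+K)(1+\mathfrak m_0+\mathfrak g)^4},$$ and if, in the case $\theta_1>1$ only, also $K\ge C_1\ln(e+K)^{1/2}\mathfrak m_0$, then $$\limsup_{t\to\infty}\|v(t)\|\le C_3\,\nu\,\mathfrak g.$$ -/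

import Mathlib

open MeasureTheory Filter Topology Set
open scoped ENNReal ComplexConjugate

noncomputable section

namespace NSE

instance factTwoPiPos : Fact (0 < 2 * Real.pi) := ⟨Real.two_pi_pos⟩

/-- The doubly periodic domain `[0, 2π]²`; its volume measure has total mass `(2π)²`. -/
abbrev Torus : Type := Fin 2 → AddCircle (2 * Real.pi)

/-- Square integrable real vector fields on the torus. The norm is
`‖u‖ = (∫ |u(x)|² dx)^{1/2}`. -/
abbrev L2Field : Type := Lp (EuclideanSpace ℝ (Fin 2)) 2 (volume : Measure Torus)

/-- The exponential `w_k(x) = exp(i k·x)`, for `k ∈ ℤ²`. -/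
def mode (k : Fin 2 → ℤ) (x : Torus) : ℂ := ∏ j, fourier (k j) (x j)

/-- The Fourier coefficient `(2π)⁻² ∫ f(x) exp(-i k·x) dx` of a scalar function. -/
def coeff (f : Torus → ℂ) (k : Fin 2 → ℤ) : ℂ :=
  ((2 * Real.pi : ℝ) : ℂ)⁻¹ ^ 2 * ∫ x, f x * conj (mode k x)

/-- The `l`-th component of the `k`-th Fourier coefficient of a vector field. -/
def fieldCoeff (u : L2Field) (k : Fin 2 → ℤ) (l : Fin 2) : ℂ :=
  coeff (fun x => ((u x l : ℝ) : ℂ)) k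

/-- `|k|²`. -/
def wavenumberSq (k : Fin 2 → ℤ) : ℝ := ∑ j, (k j : ℝ) ^ 2

/-- The space `H` of mean-free, divergence-free `L²` vector fields. That the divergence vanishes
in the sense of distributions is expressed by testing against the exponentials. -/
def H : Set L2Field :=
  {u | (∀ l, fieldCoeff u 0 l = 0) ∧ ∀ k, ∑ l, (k l : ℂ) * fieldCoeff u k l = 0}

/-- `f` is the weak (distributional) partial derivative `∂_j u`, tested against the
exponentials. -/
def IsWeakPartial (j : Fin 2) (u f : L2Field) : Prop :=
  ∀ k l, fieldCoeff f k l = Complex.I * (k j : ℂ) * fieldCoeff u k l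

open Classical in
/-- The weak partial derivative `∂_j u` of a field that has one in `L²` (and `0` otherwise). -/
def weakPartial (j : Fin 2) (u : L2Field) : L2Field :=
  if h : ∃ f, IsWeakPartial j u f then h.choose else 0

/-- The space `V`: fields in `H` whose first order weak derivatives are square integrable. -/
def V : Set L2Field := {u | u ∈ H ∧ ∀ j, ∃ f, IsWeakPartial j u f}

/-- The norm of `V`: `(∑_j ∫ |∂_j u|² dx)^{1/2}`. -/
def normV (u : L2Field) : ℝ := √(∑ j, ‖weakPartial j u‖ ^ 2)

/-- The norm of a pair in `V × V`. -/
def pairNormV (v : Fin 2 → L2Field) : ℝ := √(∑ i, normV (v i) ^ 2)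

/-- `|A u|²`, where `A` is the Stokes operator, that is, the Fourier multiplier `|k|²` on `H`.
The value is infinite when `u` is not in the domain `D(A)`. -/
def stokesNormSq (u : L2Field) : ℝ≥0∞ :=
  ENNReal.ofReal ((2 * Real.pi) ^ 2) *
    ∑' k : Fin 2 → ℤ, ENNReal.ofReal (∑ l, ‖(wavenumberSq k : ℂ) * fieldCoeff u k l‖ ^ 2)

/-- Fourier coefficients of `(u·∇)w = ∑_j u_j ∂_j w`. -/
def advectionCoeff (u w : L2Field) (k : Fin 2 → ℤ) (l : Fin 2) : ℂ :=
  coeff (fun x => ((∑ j, u x j * weakPartial j w x l : ℝ) : ℂ)) k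

/-- The Leray projection of a `k`-th Fourier coefficient `a`: the component of `a` that is
orthogonal to `k` if `k ≠ 0`, and zero if `k = 0` (fields are mean-free). -/
def lerayCoeff (k : Fin 2 → ℤ) (a : Fin 2 → ℂ) (l : Fin 2) : ℂ :=
  if k = 0 then 0
  else a l - (∑ m, (k m : ℂ) * a m) / (wavenumberSq k : ℂ) * (k l : ℂ)

/-- Fourier coefficients of `B(u, w) = ℙ((u·∇)w)`. -/
def bilinearCoeff (u w : L2Field) (k : Fin 2 → ℤ) (l : Fin 2) : ℂ :=
  lerayCoeff k (advectionCoeff u w k) l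

/-- The projection `P_K` onto wavenumbers `|k| ≤ K`, acting on the `k`-th Fourier coefficient. -/
def lowModeCoeff (K : ℝ) (k : Fin 2 → ℤ) (a : ℂ) : ℂ :=
  if √(wavenumberSq k) ≤ K then a else 0

/-- A force in `L^∞(0, ∞; H)`. -/
def IsForce (g : ℝ → L2Field) : Prop :=
  MemLp g ∞ (volume.restrict (Ioi (0 : ℝ))) ∧ ∀ᵐ t ∂(volume.restrict (Ioi (0 : ℝ))), g t ∈ H

/-- The number `𝔤 = (𝔤₁² + 𝔤₂²)^{1/2}` with `𝔤_j = ν⁻² sup_{t ≥ 0} |g_j(t)|` (the supremum is the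
essential one, as `g_j` is an element of `L^∞`). -/
def forceSize (ν : ℝ) (g : Fin 2 → ℝ → L2Field) : ℝ :=
  √(∑ i, ((eLpNorm (g i) ∞ (volume.restrict (Ioi (0 : ℝ)))).toReal / ν ^ 2) ^ 2)

/-- The pair `(g₁, g₂)` is synchronous: `|g₁(t) - g₂(t)| → 0` as `t → ∞` (outside a null set of
times). -/
def IsSynchronous (g : Fin 2 → ℝ → L2Field) : Prop :=
  Tendsto (fun t => ‖g 0 t - g 1 t‖) (atTop ⊓ ae (volume : Measure ℝ)) (𝓝 0)

/-- The intertwining matrices of the symmetric class (used with `θ₁ + θ₂ = 1`). -/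
def symMatrix (θ₁ θ₂ : ℝ) : Matrix (Fin 2) (Fin 2) ℝ := !![θ₁, -θ₂; -θ₂, θ₁]

/-- `v = (v₁, v₂)` is a global solution of the direct-replacement intertwinement
`dv_i/dt + ν A v_i + B(v_i, v_i) = g_i + ∑_j M_{ij} P_K B(v_j, v_j)`, in the class
`C([0, T]; V) ∩ L²(0, T; D(A))` for all `T > 0`. The equation is stated in its time integrated
form, tested against every exponential. -/
structure IsDirectReplacementSolution (ν K : ℝ) (M : Matrix (Fin 2) (Fin 2) ℝ)
    (g v : Fin 2 → ℝ → L2Field) : Prop where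
  mem_V : ∀ i t, 0 ≤ t → v i t ∈ V
  continuous_V : ∀ i t₀, 0 ≤ t₀ →
    Tendsto (fun t => normV (v i t - v i t₀)) (𝓝[Ici 0] t₀) (𝓝 0)
  integrable_domA : ∀ i T, 0 < T → ∫⁻ t in Ioc 0 T, stokesNormSq (v i t) < ∞
  equation : ∀ i t k l, 0 ≤ t →
    fieldCoeff (v i t) k l = fieldCoeff (v i 0) k l +
      ∫ s in (0 : ℝ)..t,
        (fieldCoeff (g i s) k l
          - (ν : ℂ) * (wavenumberSq k : ℂ) * fieldCoeff (v i s) k l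
          - bilinearCoeff (v i s) (v i s) k l
          + ∑ j, (M i j : ℂ) * lowModeCoeff K k (bilinearCoeff (v j s) (v j s) k l))

end NSE

end

/-! Taking the curl turns the intertwinement into a system for the two vorticities, handled as
sequences of Fourier coefficients w₀, w₁. By the Biot-Savart law `normV` is 2π times the ℓ² norm of
the vorticity, and the nonlinearity becomes a convolution with kernel (h ∧ j)/|h|², whose pairing
with a test sequence is the trilinear form `tri`. Write P for the projection onto |k| ≤ K, Q = 1 - P
and L = log(e + K).

Two properties of `tri` carry the proof. Enstrophy is conserved: Re tri(w, z, z) = 0 for real w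
(`re_tri_self`). And the kernel is bounded by |k|/|h|, so Young's inequality with the low-mode
factor in ℓ¹ costs √L when that factor is the velocity and K otherwise, the K being paid back by a
high-mode velocity. This gives `abs_re_tri_high_le`, `norm_tri_low_le` and `abs_re_tri_low_le`.

Suppose 0 ≤ θ₂ ≤ 1. Because θ₁ + θ₂ = 1, the nonlinear terms cancel in the equation for P(w₀ - w₁),
which is therefore a heat equation with a force tending to zero, and P(w₀ - w₁) → 0. In the weighted
energy 4θ₂(|Qw₀|² + |Qw₁|²) + |P(w₀ + w₁)|² the cubic terms combine, by conservation of enstrophy,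
into terms tested against P(w₀ - w₁) (`re_tri_balance`); these are eventually absorbed by the
dissipation. So the low modes are eventually of the size of the force, without any memory of the
initial data. Since K dominates √L times the force, the low modes then control the high ones: in Re
tri(w, w, Qw) the term quadratic in the gradient is absorbed, and the remaining one is a bounded
source.

Suppose θ₂ < 0, and put e = -θ₂. The total enstrophy is affected by Re tri(wᵢ, wᵢ, Pwᵢ), which gains
a factor 1/K, and by e times further cubic terms. Both are absorbed as long as the solution stays
below a radius ρ comparable to ν(m₀ + 𝔤), up to a small margin; a continuity argument keeps it there
for all time, and Grönwall's inequality then forgets the initial data.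

The rest is justification: the solution class has just enough regularity for the energy identities,
which are proved mode by mode and summed, and yield functionals with a locally integrable rate
(`HasRate`) to which a Grönwall lemma applies. -/

noncomputable section

namespace NSE

/-! ### Fourier basis of the torus and Parseval's identity. -/

/-- The exponentials as continuous functions. -/
def modeC (k : Fin 2 → ℤ) : C(Torus, ℂ) where
  toFun := mode k
  continuous_toFun := continuous_finsetProd _ fun j _ ↦
    (fourier (k j)).continuous.comp (continuous_apply j)

lemma modeC_apply (k : Fin 2 → ℤ) (x : Torus) : modeC k x = mode k x := rfl

lemma mode_neg (k : Fin 2 → ℤ) (x : Torus) : mode (-k) x = conj (mode k x) := by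
  simp [mode]

lemma mode_add (k m : Fin 2 → ℤ) (x : Torus) : mode (k + m) x = mode k x * mode m x := by
  simp only [mode, Pi.add_apply, fourier_add, Finset.prod_mul_distrib]

lemma mode_zero (x : Torus) : mode 0 x = 1 := by
  simp [mode]

lemma norm_mode (k : Fin 2 → ℤ) (x : Torus) : ‖mode k x‖ = 1 := by
  rw [mode, norm_prod]
  exact Finset.prod_eq_one fun j _ ↦ by rw [fourier_apply, Circle.norm_coe]

/-- The star subalgebra of trigonometric polynomials. -/
def trigSubalgebra : StarSubalgebra ℂ C(Torus, ℂ) where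
  toSubalgebra := Algebra.adjoin ℂ (range modeC)
  star_mem' := by
    change Algebra.adjoin ℂ (range modeC) ≤ star (Algebra.adjoin ℂ (range modeC))
    refine Algebra.adjoin_le ?_
    rintro _ ⟨n, rfl⟩
    refine Algebra.subset_adjoin ⟨-n, ?_⟩
    ext1 x
    exact mode_neg n x

lemma trigSubalgebra_coe :
    trigSubalgebra.toSubalgebra.toSubmodule = Submodule.span ℂ (range modeC) := by
  apply Algebra.adjoin_eq_span_of_subset
  refine .trans (fun x ↦ Submonoid.closure_induction (fun _ ↦ id) ⟨0, ?_⟩ ?_) Submodule.subset_span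
  · ext z
    simp [modeC_apply, mode_zero]
  · rintro _ _ _ _ ⟨m, rfl⟩ ⟨n, rfl⟩
    refine ⟨m + n, ?_⟩
    ext z
    simp [modeC_apply, mode_add]

lemma trigSubalgebra_separatesPoints : trigSubalgebra.SeparatesPoints := by
  intro x y hxy
  rw [Ne, funext_iff, not_forall] at hxy
  obtain ⟨i, hi⟩ := hxy
  -- The mode of the i-th unit vector sees only the i-th coordinate, in which the two points differ,
  -- and is injective in it.
  refine ⟨_, ⟨modeC (Pi.single i 1), Algebra.subset_adjoin ⟨Pi.single i 1, rfl⟩, rfl⟩, ?_⟩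
  have key : ∀ z : Torus, mode (Pi.single i 1) z = fourier 1 (z i) := by
    intro z
    rw [mode, Finset.prod_eq_single i]
    · simp
    · intro j _ hj
      simp [Pi.single_eq_of_ne hj]
    · simp
  dsimp only
  rw [modeC_apply, modeC_apply, key, key, fourier_one, fourier_one, Ne]
  intro h
  exact hi (AddCircle.injective_toCircle Real.two_pi_pos.ne' (Subtype.ext h))

/-- Stone-Weierstrass: trigonometric polynomials form a self-adjoint algebra that separates points.
-/
lemma span_modeC_closure_eq_top :
    (Submodule.span ℂ (range modeC)).topologicalClosure = ⊤ := by
  rw [← trigSubalgebra_coe]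
  exact congr_arg (Subalgebra.toSubmodule <| StarSubalgebra.toSubalgebra ·)
    (ContinuousMap.starSubalgebra_topologicalClosure_eq_top_of_separatesPoints _
      trigSubalgebra_separatesPoints)

lemma integral_fourier (n : ℤ) :
    ∫ x : AddCircle (2 * Real.pi), fourier n x = if n = 0 then ((2 * Real.pi : ℝ) : ℂ) else 0 := by
  rw [AddCircle.volume_eq_smul_haarAddCircle, integral_smul_measure]
  have := (orthonormal_iff_ite.mp (orthonormal_fourier (T := 2 * Real.pi))) 0 n
  simp only [ContinuousMap.inner_toLp, fourier_zero, map_one, mul_one] at this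
  rw [this, ENNReal.toReal_ofReal Real.two_pi_pos.le]
  by_cases h : n = 0
  · simp [h]
  · simp [h, Ne.symm h]

lemma integral_mode (k : Fin 2 → ℤ) :
    ∫ x : Torus, mode k x = if k = 0 then ((2 * Real.pi : ℝ) : ℂ) ^ 2 else 0 := by
  unfold mode
  rw [MeasureTheory.integral_fintype_prod_volume_eq_prod (fun j x => fourier (k j) x)]
  simp only [integral_fourier]
  by_cases h : k = 0
  · simp [h]
  · obtain ⟨i, hi⟩ := Function.ne_iff.mp h
    rw [if_neg h]
    exact Finset.prod_eq_zero (Finset.mem_univ i) (if_neg hi)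

/-- The normalised exponentials as elements of `L²`. -/
def modeLp (k : Fin 2 → ℤ) : Lp ℂ 2 (volume : Measure Torus) :=
  ContinuousMap.toLp (E := ℂ) 2 volume ℂ (((2 * Real.pi : ℝ) : ℂ)⁻¹ • modeC k)

lemma coeFn_modeLp (k : Fin 2 → ℤ) :
    modeLp k =ᵐ[volume] fun x => ((2 * Real.pi : ℝ) : ℂ)⁻¹ * mode k x :=
  ContinuousMap.coeFn_toLp volume _

lemma orthonormal_modeLp : Orthonormal ℂ modeLp := by
  have hpi : ((2 * Real.pi : ℝ) : ℂ) ≠ 0 := by exact_mod_cast Real.two_pi_pos.ne'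
  rw [orthonormal_iff_ite]
  intro m n
  rw [modeLp, modeLp, ContinuousMap.inner_toLp]
  have : ∀ x : Torus, (((2 * Real.pi : ℝ) : ℂ)⁻¹ • modeC n) x *
      conj ((((2 * Real.pi : ℝ) : ℂ)⁻¹ • modeC m) x)
      = (((2 * Real.pi : ℝ) : ℂ)⁻¹) ^ 2 * mode (n - m) x := by
    intro x
    rw [sub_eq_add_neg, mode_add, mode_neg]
    simp only [ContinuousMap.smul_apply, smul_eq_mul, modeC_apply, map_mul, map_inv₀,
      Complex.conj_ofReal]
    ring
  simp only [this]
  rw [integral_const_mul, integral_mode]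
  by_cases h : m = n
  · simp only [h, sub_self, if_true]
    field_simp
  · rw [if_neg (sub_ne_zero.mpr (Ne.symm h)), if_neg h, mul_zero]

lemma span_modeLp_closure_eq_top :
    (Submodule.span ℂ (range modeLp)).topologicalClosure = ⊤ := by
  have hpi : ((2 * Real.pi : ℝ) : ℂ)⁻¹ ≠ 0 := by
    exact inv_ne_zero (by exact_mod_cast Real.two_pi_pos.ne')
  have h1 := (ContinuousMap.toLp_denseRange ℂ (volume : Measure Torus) ℂ
      (p := 2) (by simp)).topologicalClosure_map_submodule span_modeC_closure_eq_top
  rw [Submodule.map_span] at h1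
  have h2 : Submodule.span ℂ (range modeLp) = Submodule.span ℂ
      ((ContinuousMap.toLp (E := ℂ) 2 (volume : Measure Torus) ℂ).toLinearMap '' range modeC) := by
    apply le_antisymm
    · rw [Submodule.span_le]
      rintro _ ⟨k, rfl⟩
      rw [modeLp, map_smul]
      exact Submodule.smul_mem _ _ (Submodule.subset_span ⟨_, ⟨k, rfl⟩, rfl⟩)
    · rw [Submodule.span_le]
      rintro _ ⟨_, ⟨k, rfl⟩, rfl⟩
      have : modeLp k ∈ Submodule.span ℂ (range modeLp) := Submodule.subset_span ⟨k, rfl⟩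
      rw [modeLp, map_smul] at this
      exact (Submodule.smul_mem_iff _ hpi).mp this
  rw [h2]
  exact h1

/-- The Fourier basis of `L²` of the torus. -/
def modeBasis : HilbertBasis (Fin 2 → ℤ) ℂ (Lp ℂ 2 (volume : Measure Torus)) :=
  HilbertBasis.mk orthonormal_modeLp span_modeLp_closure_eq_top.ge

/-- The basis vectors carry the factor (2π)⁻¹ and `coeff` the factor (2π)⁻², which leaves 2π. -/
lemma inner_modeLp_toLp {f : Torus → ℂ} (hf : MemLp f 2 volume) (k : Fin 2 → ℤ) :
    inner ℂ (modeLp k) (hf.toLp f) = ((2 * Real.pi : ℝ) : ℂ) * coeff f k := by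
  have hpi : ((2 * Real.pi : ℝ) : ℂ) ≠ 0 := by exact_mod_cast Real.two_pi_pos.ne'
  rw [MeasureTheory.L2.inner_def, coeff]
  have : ∀ᵐ x ∂(volume : Measure Torus), inner ℂ (modeLp k x) (hf.toLp f x)
      = ((2 * Real.pi : ℝ) : ℂ)⁻¹ * (f x * conj (mode k x)) := by
    filter_upwards [coeFn_modeLp k, hf.coeFn_toLp] with x h1 h2
    rw [h1, h2, RCLike.inner_apply, map_mul, map_inv₀, Complex.conj_ofReal]
    ring
  rw [integral_congr_ae this, integral_const_mul]
  field_simp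

/-- **Parseval's identity** on the torus. -/
theorem hasSum_conj_coeff_mul_coeff {f g : Torus → ℂ} (hf : MemLp f 2 volume)
    (hg : MemLp g 2 volume) :
    HasSum (fun k => conj (coeff f k) * coeff g k)
      ((((2 * Real.pi : ℝ) : ℂ) ^ 2)⁻¹ * ∫ x, conj (f x) * g x) := by
  have hpi : ((2 * Real.pi : ℝ) : ℂ) ≠ 0 := by exact_mod_cast Real.two_pi_pos.ne'
  have h := modeBasis.hasSum_inner_mul_inner (hf.toLp f) (hg.toLp g)
  have hcoe : ∀ k, modeBasis k = modeLp k := fun k => by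
    rw [modeBasis, HilbertBasis.coe_mk]
  have h3 : inner ℂ (hf.toLp f) (hg.toLp g) = ∫ x, conj (f x) * g x := by
    rw [MeasureTheory.L2.inner_def]
    apply integral_congr_ae
    filter_upwards [hf.coeFn_toLp, hg.coeFn_toLp] with x h1 h2
    rw [h1, h2, RCLike.inner_apply, mul_comm]
  rw [h3] at h
  have h4 := h.mul_left ((((2 * Real.pi : ℝ) : ℂ) ^ 2)⁻¹)
  refine h4.congr_fun fun k ↦ ?_
  rw [hcoe, ← inner_conj_symm, inner_modeLp_toLp, inner_modeLp_toLp, map_mul, Complex.conj_ofReal]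
  field_simp

/-! ### Wavenumbers and lattice sums. -/

/-- The length `|k|` of a wavenumber. -/
def nrm (k : Fin 2 → ℤ) : ℝ := √(wavenumberSq k)

lemma wavenumberSq_nonneg (k : Fin 2 → ℤ) : 0 ≤ wavenumberSq k :=
  Finset.sum_nonneg fun _ _ ↦ sq_nonneg _

lemma nrm_nonneg (k : Fin 2 → ℤ) : 0 ≤ nrm k := Real.sqrt_nonneg _

lemma nrm_sq (k : Fin 2 → ℤ) : nrm k ^ 2 = wavenumberSq k := Real.sq_sqrt (wavenumberSq_nonneg k)

lemma wavenumberSq_eq (k : Fin 2 → ℤ) : wavenumberSq k = (k 0 : ℝ) ^ 2 + (k 1 : ℝ) ^ 2 := by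
  simp [wavenumberSq]

@[simp] lemma nrm_zero : nrm 0 = 0 := by simp [nrm, wavenumberSq]

/-- The sup norm of a wavenumber, as a natural number. -/
def supNrm (k : Fin 2 → ℤ) : ℕ := max (k 0).natAbs (k 1).natAbs

lemma supNrm_le_nrm (k : Fin 2 → ℤ) : (supNrm k : ℝ) ≤ nrm k := by
  refine Real.le_sqrt_of_sq_le ?_
  rw [wavenumberSq_eq]
  have h0 : (((k 0).natAbs : ℕ) : ℝ) ^ 2 = (k 0 : ℝ) ^ 2 := by
    rw [Nat.cast_natAbs, Int.cast_abs, sq_abs]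
  have h1 : (((k 1).natAbs : ℕ) : ℝ) ^ 2 = (k 1 : ℝ) ^ 2 := by
    rw [Nat.cast_natAbs, Int.cast_abs, sq_abs]
  rcases max_cases (k 0).natAbs (k 1).natAbs with ⟨h, _⟩ | ⟨h, _⟩ <;> rw [supNrm, h] <;>
    nlinarith [sq_nonneg (k 0 : ℝ), sq_nonneg (k 1 : ℝ)]

lemma supNrm_pos {k : Fin 2 → ℤ} (hk : k ≠ 0) : 0 < supNrm k := by
  by_contra h
  apply hk
  have h' : supNrm k = 0 := by omega
  simp only [supNrm] at h'
  funext j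
  fin_cases j <;> simp <;> omega

lemma one_le_nrm {k : Fin 2 → ℤ} (hk : k ≠ 0) : 1 ≤ nrm k :=
  le_trans (by exact_mod_cast supNrm_pos hk) (supNrm_le_nrm k)

lemma nrm_pos {k : Fin 2 → ℤ} (hk : k ≠ 0) : 0 < nrm k := lt_of_lt_of_le one_pos (one_le_nrm hk)

lemma supNrm_eq_norm (k : Fin 2 → ℤ) : (supNrm k : ℝ) = ‖k‖ := by
  rw [EisensteinSeries.norm_eq_max_natAbs, supNrm]

lemma summable_inv_nrm_pow_four : Summable fun k : Fin 2 → ℤ ↦ (nrm k ^ 2)⁻¹ ^ 2 := by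
  refine Summable.of_nonneg_of_le (fun k ↦ by positivity) (fun k ↦ ?_)
    (EisensteinSeries.summable_one_div_norm_rpow (k := 4) (by norm_num))
  by_cases hk : k = 0
  · simp [hk]
  · have h1 : 0 < ‖k‖ := norm_pos_iff.mpr hk
    have h2 := supNrm_le_nrm k
    rw [supNrm_eq_norm] at h2
    rw [Real.rpow_neg h1.le, inv_pow, show (4 : ℝ) = ((4 : ℕ) : ℝ) by norm_num, Real.rpow_natCast,
      ← pow_mul]
    gcongr

/-- The nonzero wavenumbers of length at most `K`. -/
def lowSet (K : ℝ) : Set (Fin 2 → ℤ) := {k | k ≠ 0 ∧ nrm k ≤ K}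

lemma supNrm_mem_Icc {K : ℝ} {k : Fin 2 → ℤ} (hk : k ∈ lowSet K) :
    supNrm k ∈ Finset.Icc 1 ⌊K⌋₊ :=
  Finset.mem_Icc.mpr ⟨supNrm_pos hk.1, Nat.le_floor ((supNrm_le_nrm k).trans hk.2)⟩

lemma finite_supNrm_eq (n : ℕ) : {k : Fin 2 → ℤ | supNrm k = n}.Finite := by
  refine ((Finset.finite_toSet (Finset.box n : Finset (ℤ × ℤ))).preimage
    (finTwoArrowEquiv ℤ).injective.injOn).subset fun k hk ↦ ?_
  simpa [Int.mem_box, supNrm] using hk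

lemma lowSet_finite (K : ℝ) : (lowSet K).Finite :=
  ((Finset.Icc 1 ⌊K⌋₊).finite_toSet.biUnion fun n _ ↦ finite_supNrm_eq n).subset fun _ hk ↦
    mem_biUnion (supNrm_mem_Icc hk) rfl

/-- The nonzero wavenumbers of length at most `K`, as a finite set. -/
def lowFin (K : ℝ) : Finset (Fin 2 → ℤ) := (lowSet_finite K).toFinset

lemma mem_lowFin {K : ℝ} {k : Fin 2 → ℤ} : k ∈ lowFin K ↔ k ≠ 0 ∧ nrm k ≤ K := by
  rw [lowFin, Set.Finite.mem_toFinset]; rfl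

/-- Summation over shells of constant sup norm: for n ≥ 1 the shell in ℤ² has exactly 8n points, and
sup norms of low wavenumbers lie between 1 and ⌊K⌋. -/
lemma sum_lowFin_le (K : ℝ) (φ : ℕ → ℝ) (hφ : ∀ n, 0 ≤ φ n) :
    ∑ k ∈ lowFin K, φ (supNrm k) ≤ ∑ n ∈ Finset.Icc 1 ⌊K⌋₊, 8 * n * φ n := by
  classical
  rw [← Finset.sum_fiberwise_of_maps_to (s := lowFin K) (t := Finset.Icc 1 ⌊K⌋₊) (g := supNrm)
    (fun k hk ↦ supNrm_mem_Icc (mem_lowFin.mp hk))]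
  refine Finset.sum_le_sum fun n hn ↦ ?_
  rw [Finset.sum_congr rfl (g := fun _ ↦ φ n) (fun k hk ↦ by rw [(Finset.mem_filter.mp hk).2]),
    Finset.sum_const, nsmul_eq_mul]
  refine mul_le_mul_of_nonneg_right ?_ (hφ n)
  have hn0 : n ≠ 0 := by have := (Finset.mem_Icc.mp hn).1; omega
  have : (Finset.filter (fun k ↦ supNrm k = n) (lowFin K)).card ≤ 8 * n := by
    rw [← Int.card_box hn0]
    refine Finset.card_le_card_of_injOn (finTwoArrowEquiv ℤ) (fun k hk ↦ ?_)
      (finTwoArrowEquiv ℤ).injective.injOn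
    have := (Finset.mem_filter.mp hk).2
    simpa [Int.mem_box, supNrm] using this
  exact_mod_cast this

/-- The logarithmic factor. -/
def logK (K : ℝ) : ℝ := Real.log (Real.exp 1 + K)

lemma one_le_logK {K : ℝ} (hK : 0 < K) : 1 ≤ logK K := by
  rw [logK, Real.le_log_iff_exp_le (by positivity)]
  linarith

/-- The source of every logarithm: counting by shells leaves eight times a harmonic sum. -/
lemma sum_lowFin_inv_sq_le {K : ℝ} (hK : 0 < K) :
    ∑ k ∈ lowFin K, (nrm k)⁻¹ ^ 2 ≤ 16 * logK K := by
  have h1 : ∑ k ∈ lowFin K, (nrm k)⁻¹ ^ 2 ≤ ∑ k ∈ lowFin K, ((supNrm k : ℝ))⁻¹ ^ 2 := by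
    refine Finset.sum_le_sum fun k hk ↦ ?_
    have := supNrm_le_nrm k
    have h2 : (0 : ℝ) < supNrm k := by exact_mod_cast supNrm_pos (mem_lowFin.mp hk).1
    have h0 := inv_nonneg.mpr (nrm_nonneg k)
    gcongr
  refine h1.trans ((sum_lowFin_le K (fun n ↦ (n : ℝ)⁻¹ ^ 2) fun n ↦ by positivity).trans ?_)
  have h3 : ∑ n ∈ Finset.Icc 1 ⌊K⌋₊, 8 * (n : ℝ) * (n : ℝ)⁻¹ ^ 2
      = 8 * ∑ n ∈ Finset.Icc 1 ⌊K⌋₊, (n : ℝ)⁻¹ := by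
    rw [Finset.mul_sum]
    refine Finset.sum_congr rfl fun n hn ↦ ?_
    have hn0 : (n : ℝ) ≠ 0 := by
      have := (Finset.mem_Icc.mp hn).1
      positivity
    field_simp
  rw [h3]
  have h4 : ∑ n ∈ Finset.Icc 1 ⌊K⌋₊, (n : ℝ)⁻¹ ≤ 1 + Real.log ⌊K⌋₊ := by
    have := harmonic_le_one_add_log ⌊K⌋₊
    rw [harmonic_eq_sum_Icc] at this
    push_cast at this
    exact this
  have h5 : Real.log ⌊K⌋₊ ≤ logK K := by
    rcases Nat.eq_zero_or_pos ⌊K⌋₊ with h | h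
    · rw [h]
      simpa using zero_le_one.trans (one_le_logK hK)
    · refine Real.log_le_log (by exact_mod_cast h) ?_
      have := Nat.floor_le hK.le
      have := Real.exp_pos 1
      linarith
  have := one_le_logK hK
  linarith

lemma card_lowFin_le {K : ℝ} (hK : 0 < K) : ((lowFin K).card : ℝ) ≤ 8 * K ^ 2 := by
  have h := sum_lowFin_le K (fun _ ↦ 1) fun _ ↦ zero_le_one
  simp only [Finset.sum_const, nsmul_eq_mul, mul_one] at h
  refine h.trans ?_
  have h1 : ∑ n ∈ Finset.Icc 1 ⌊K⌋₊, 8 * (n : ℝ) ≤ ∑ n ∈ Finset.Icc 1 ⌊K⌋₊, 8 * K := by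
    refine Finset.sum_le_sum fun n hn ↦ ?_
    have : (n : ℝ) ≤ ⌊K⌋₊ := by exact_mod_cast (Finset.mem_Icc.mp hn).2
    have := Nat.floor_le hK.le
    linarith
  refine h1.trans ?_
  rw [Finset.sum_const, Nat.card_Icc, nsmul_eq_mul]
  have := Nat.floor_le hK.le
  simp only [Nat.add_sub_cancel]
  nlinarith

/-! ### Square summable sequences -/

/-- Square summability. -/
def Sq (α : (Fin 2 → ℤ) → ℂ) : Prop := Summable fun k ↦ ‖α k‖ ^ 2

/-- The `ℓ²` norm. -/
def l2 (α : (Fin 2 → ℤ) → ℂ) : ℝ := √(∑' k, ‖α k‖ ^ 2)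

/-- The multiplier `|k|`. -/
def grad (α : (Fin 2 → ℤ) → ℂ) (k : Fin 2 → ℤ) : ℂ := (nrm k : ℂ) * α k

/-- The multiplier `|k|⁻¹`. -/
def igrad (α : (Fin 2 → ℤ) → ℂ) (k : Fin 2 → ℤ) : ℂ := ((nrm k)⁻¹ : ℝ) * α k

/-- The projection onto `|k| ≤ K`. -/
def low (K : ℝ) (α : (Fin 2 → ℤ) → ℂ) (k : Fin 2 → ℤ) : ℂ := if nrm k ≤ K then α k else 0

/-- The projection onto `|k| > K`. -/
def high (K : ℝ) (α : (Fin 2 → ℤ) → ℂ) (k : Fin 2 → ℤ) : ℂ := if nrm k ≤ K then 0 else α k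

lemma low_add_high (K : ℝ) (α : (Fin 2 → ℤ) → ℂ) : low K α + high K α = α := by
  funext k; simp only [Pi.add_apply, low, high]; split_ifs <;> simp

lemma l2_nonneg (α : (Fin 2 → ℤ) → ℂ) : 0 ≤ l2 α := Real.sqrt_nonneg _

lemma l2_sq (α : (Fin 2 → ℤ) → ℂ) : l2 α ^ 2 = ∑' k, ‖α k‖ ^ 2 :=
  Real.sq_sqrt (tsum_nonneg fun _ ↦ sq_nonneg _)

lemma norm_grad (α : (Fin 2 → ℤ) → ℂ) (k : Fin 2 → ℤ) : ‖grad α k‖ = nrm k * ‖α k‖ := by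
  rw [grad, norm_mul, Complex.norm_real, Real.norm_of_nonneg (nrm_nonneg k)]

lemma norm_igrad (α : (Fin 2 → ℤ) → ℂ) (k : Fin 2 → ℤ) : ‖igrad α k‖ = (nrm k)⁻¹ * ‖α k‖ := by
  rw [igrad, norm_mul, Complex.norm_real, Real.norm_of_nonneg (inv_nonneg.mpr (nrm_nonneg k))]

lemma Sq.of_le {α β : (Fin 2 → ℤ) → ℂ} (hβ : Sq β) (h : ∀ k, ‖α k‖ ≤ ‖β k‖) : Sq α :=
  Summable.of_nonneg_of_le (fun _ ↦ sq_nonneg _)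
    (fun k ↦ pow_le_pow_left₀ (norm_nonneg _) (h k) 2) hβ

lemma l2_le_of_le {α β : (Fin 2 → ℤ) → ℂ} {c : ℝ} (hc : 0 ≤ c) (hβ : Sq β)
    (h : ∀ k, ‖α k‖ ≤ c * ‖β k‖) : l2 α ≤ c * l2 β := by
  refine Real.sqrt_le_iff.mpr ⟨mul_nonneg hc (l2_nonneg _), ?_⟩
  rw [mul_pow, l2_sq, ← tsum_mul_left]
  have h' : ∀ k, ‖α k‖ ^ 2 ≤ c ^ 2 * ‖β k‖ ^ 2 := fun k ↦ by
    rw [← mul_pow]; exact pow_le_pow_left₀ (norm_nonneg _) (h k) 2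
  have hs : Summable fun k ↦ c ^ 2 * ‖β k‖ ^ 2 := hβ.mul_left _
  exact (Summable.of_nonneg_of_le (fun _ ↦ sq_nonneg _) h' hs).tsum_le_tsum h' hs

lemma l2_mono {α β : (Fin 2 → ℤ) → ℂ} (hβ : Sq β) (h : ∀ k, ‖α k‖ ≤ ‖β k‖) : l2 α ≤ l2 β := by
  simpa using l2_le_of_le zero_le_one hβ fun k ↦ by simpa using h k

lemma Sq.add {α β : (Fin 2 → ℤ) → ℂ} (hα : Sq α) (hβ : Sq β) : Sq (α + β) := by
  refine Summable.of_nonneg_of_le (fun _ ↦ sq_nonneg _) (fun k ↦ ?_)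
    (((hα : Summable _).mul_left 2).add ((hβ : Summable _).mul_left 2))
  have := norm_add_le (α k) (β k)
  have h1 := pow_le_pow_left₀ (norm_nonneg _) this 2
  simp only [Pi.add_apply]
  nlinarith [sq_nonneg (‖α k‖ - ‖β k‖)]

lemma Sq.smul {α : (Fin 2 → ℤ) → ℂ} (hα : Sq α) (c : ℂ) : Sq (c • α) := by
  refine ((hα : Summable _).mul_left (‖c‖ ^ 2)).congr fun k ↦ ?_
  simp [mul_pow]

lemma Sq.neg {α : (Fin 2 → ℤ) → ℂ} (hα : Sq α) : Sq (-α) := hα.of_le fun k ↦ by simp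

lemma Sq.sub {α β : (Fin 2 → ℤ) → ℂ} (hα : Sq α) (hβ : Sq β) : Sq (α - β) := by
  rw [sub_eq_add_neg]; exact hα.add hβ.neg

lemma summable_mul_of_sq {a b : (Fin 2 → ℤ) → ℝ} (ha0 : ∀ k, 0 ≤ a k) (hb0 : ∀ k, 0 ≤ b k)
    (ha : Summable fun k ↦ a k ^ 2) (hb : Summable fun k ↦ b k ^ 2) :
    (Summable fun k ↦ a k * b k) ∧ ∑' k, a k * b k ≤ √(∑' k, a k ^ 2) * √(∑' k, b k ^ 2) := by
  have h := Real.summable_and_inner_le_Lp_mul_Lq_tsum_of_nonneg (p := 2) (q := 2)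
    Real.HolderConjugate.two_two ha0 hb0 (by simpa using ha) (by simpa using hb)
  simpa [Real.sqrt_eq_rpow] using h

lemma summable_norm_mul {α β : (Fin 2 → ℤ) → ℂ} (hα : Sq α) (hβ : Sq β) :
    Summable fun k ↦ ‖α k‖ * ‖β k‖ :=
  (summable_mul_of_sq (fun _ ↦ norm_nonneg _) (fun _ ↦ norm_nonneg _) hα hβ).1

lemma tsum_norm_mul_le {α β : (Fin 2 → ℤ) → ℂ} (hα : Sq α) (hβ : Sq β) :
    ∑' k, ‖α k‖ * ‖β k‖ ≤ l2 α * l2 β :=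
  (summable_mul_of_sq (fun _ ↦ norm_nonneg _) (fun _ ↦ norm_nonneg _) hα hβ).2

lemma Sq.low {α : (Fin 2 → ℤ) → ℂ} (hα : Sq α) (K : ℝ) : Sq (low K α) :=
  hα.of_le fun k ↦ by unfold NSE.low; split_ifs <;> simp

lemma Sq.high {α : (Fin 2 → ℤ) → ℂ} (hα : Sq α) (K : ℝ) : Sq (high K α) :=
  hα.of_le fun k ↦ by unfold NSE.high; split_ifs <;> simp

lemma l2_low_le {α : (Fin 2 → ℤ) → ℂ} (hα : Sq α) (K : ℝ) : l2 (low K α) ≤ l2 α :=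
  l2_mono hα fun k ↦ by unfold low; split_ifs <;> simp

lemma l2_high_le {α : (Fin 2 → ℤ) → ℂ} (hα : Sq α) (K : ℝ) : l2 (high K α) ≤ l2 α :=
  l2_mono hα fun k ↦ by unfold high; split_ifs <;> simp

lemma grad_low (K : ℝ) (α : (Fin 2 → ℤ) → ℂ) : grad (low K α) = low K (grad α) := by
  funext k; simp only [grad, low]; split_ifs <;> simp

lemma grad_high (K : ℝ) (α : (Fin 2 → ℤ) → ℂ) : grad (high K α) = high K (grad α) := by
  funext k; simp only [grad, high]; split_ifs <;> simp

/-- Mean-free sequences with square summable gradient. -/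
structure H1 (α : (Fin 2 → ℤ) → ℂ) : Prop where
  zero : α 0 = 0
  sq_grad : Sq (grad α)

lemma H1.norm_le_grad {α : (Fin 2 → ℤ) → ℂ} (h0 : α 0 = 0) (k : Fin 2 → ℤ) :
    ‖α k‖ ≤ ‖grad α k‖ := by
  by_cases hk : k = 0
  · simp [hk, h0]
  · rw [norm_grad]
    exact le_mul_of_one_le_left (norm_nonneg _) (one_le_nrm hk)

lemma H1.sq {α : (Fin 2 → ℤ) → ℂ} (h : H1 α) : Sq α := h.sq_grad.of_le (H1.norm_le_grad h.zero)

lemma H1.l2_le_grad {α : (Fin 2 → ℤ) → ℂ} (h : H1 α) : l2 α ≤ l2 (grad α) :=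
  l2_mono h.sq_grad (H1.norm_le_grad h.zero)

lemma grad_add (α β : (Fin 2 → ℤ) → ℂ) : grad (α + β) = grad α + grad β := by
  funext k; simp [grad, mul_add]

lemma grad_smul (c : ℂ) (α : (Fin 2 → ℤ) → ℂ) : grad (c • α) = c • grad α := by
  funext k; simp [grad]; ring

lemma H1.add {α β : (Fin 2 → ℤ) → ℂ} (hα : H1 α) (hβ : H1 β) : H1 (α + β) :=
  ⟨by simp [hα.zero, hβ.zero], by rw [grad_add]; exact hα.sq_grad.add hβ.sq_grad⟩

lemma H1.smul {α : (Fin 2 → ℤ) → ℂ} (hα : H1 α) (c : ℂ) : H1 (c • α) :=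
  ⟨by simp [hα.zero], by rw [grad_smul]; exact hα.sq_grad.smul c⟩

lemma H1.sub {α β : (Fin 2 → ℤ) → ℂ} (hα : H1 α) (hβ : H1 β) : H1 (α - β) := by
  have := hα.add (hβ.smul (-1))
  simpa [sub_eq_add_neg] using this

lemma H1.low {α : (Fin 2 → ℤ) → ℂ} (hα : H1 α) (K : ℝ) : H1 (low K α) :=
  ⟨by simp [NSE.low, hα.zero], by rw [grad_low]; exact hα.sq_grad.low K⟩

lemma H1.high {α : (Fin 2 → ℤ) → ℂ} (hα : H1 α) (K : ℝ) : H1 (high K α) :=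
  ⟨by simp [NSE.high, hα.zero], by rw [grad_high]; exact hα.sq_grad.high K⟩

lemma norm_igrad_le {α : (Fin 2 → ℤ) → ℂ} (k : Fin 2 → ℤ) : ‖igrad α k‖ ≤ ‖α k‖ := by
  rw [norm_igrad]
  by_cases hk : k = 0
  · simp [hk]
  · exact mul_le_of_le_one_left (norm_nonneg _) (inv_le_one_of_one_le₀ (one_le_nrm hk))

lemma Sq.igrad {α : (Fin 2 → ℤ) → ℂ} (h : Sq α) : Sq (igrad α) := h.of_le fun k ↦ norm_igrad_le k

lemma l2_igrad_high_le {α : (Fin 2 → ℤ) → ℂ} (h : Sq α) {K : ℝ} (hK : 0 < K) :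
    l2 (igrad (high K α)) ≤ K⁻¹ * l2 (high K α) := by
  refine l2_le_of_le (inv_nonneg.mpr hK.le) (h.high K) fun k ↦ ?_
  rw [norm_igrad]
  by_cases hk : nrm k ≤ K
  · simp [high, hk]
  · gcongr
    exact (not_le.mp hk).le

lemma l2_high_le_grad {α : (Fin 2 → ℤ) → ℂ} (h : H1 α) {K : ℝ} (hK : 0 < K) :
    l2 (high K α) ≤ K⁻¹ * l2 (grad (high K α)) := by
  refine l2_le_of_le (inv_nonneg.mpr hK.le) (h.high K).sq_grad fun k ↦ ?_
  rw [norm_grad]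
  by_cases hk : nrm k ≤ K
  · simp [high, hk]
  · rw [← mul_assoc]
    refine le_mul_of_one_le_left (norm_nonneg _) ?_
    rw [inv_mul_eq_div, one_le_div hK]
    exact (not_le.mp hk).le

lemma l2_grad_low_le {α : (Fin 2 → ℤ) → ℂ} (h : Sq α) {K : ℝ} (hK : 0 < K) :
    l2 (grad (low K α)) ≤ K * l2 (low K α) := by
  refine l2_le_of_le hK.le (h.low K) fun k ↦ ?_
  rw [norm_grad]
  by_cases hk : nrm k ≤ K
  · gcongr
  · simp [low, hk]

/-! ### Low modes in `ℓ¹` -/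

lemma low_eq_zero_of_notMem {α : (Fin 2 → ℤ) → ℂ} (h0 : α 0 = 0) {K : ℝ} {k : Fin 2 → ℤ}
    (hk : k ∉ lowFin K) : low K α k = 0 := by
  rw [mem_lowFin, not_and_or, not_not] at hk
  rcases hk with rfl | hk
  · simp [low, h0]
  · simp [low, hk]

/-- A Bernstein inequality: Cauchy-Schwarz on the finitely many low modes bounds a weighted ℓ¹ norm
by the ℓ² norm, at the price of the ℓ² norm of the weight over `lowFin K`. -/
lemma tsum_mul_low_le {α : (Fin 2 → ℤ) → ℂ} (h0 : α 0 = 0) (hα : Sq α) (K : ℝ)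
    (f : (Fin 2 → ℤ) → ℝ) {C : ℝ} (hf : ∑ k ∈ lowFin K, f k ^ 2 ≤ C ^ 2) (hC : 0 ≤ C) :
    (Summable fun k ↦ f k * ‖low K α k‖) ∧ ∑' k, f k * ‖low K α k‖ ≤ C * l2 (low K α) := by
  have hz : ∀ k ∉ lowFin K, f k * ‖low K α k‖ = 0 := fun k hk ↦ by
    simp [low_eq_zero_of_notMem h0 hk]
  refine ⟨summable_of_ne_finset_zero hz, ?_⟩
  rw [tsum_eq_sum hz]
  refine le_of_sq_le_sq ?_ (mul_nonneg hC (l2_nonneg _))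
  refine (Finset.sum_mul_sq_le_sq_mul_sq _ _ _).trans ?_
  rw [mul_pow, l2_sq]
  exact mul_le_mul hf ((hα.low K).sum_le_tsum _ fun _ _ ↦ sq_nonneg _)
    (Finset.sum_nonneg fun _ _ ↦ sq_nonneg _) (sq_nonneg _)

/-- The weight |k|⁻¹ only just fails to be square summable in two dimensions, so passing from the
vorticity to an absolutely summable velocity costs no more than the root of a logarithm. -/
lemma tsum_igrad_low_le {α : (Fin 2 → ℤ) → ℂ} (h0 : α 0 = 0) (hα : Sq α) {K : ℝ} (hK : 0 < K) :
    (Summable fun k ↦ ‖igrad (low K α) k‖) ∧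
      ∑' k, ‖igrad (low K α) k‖ ≤ 4 * √(logK K) * l2 (low K α) := by
  have := tsum_mul_low_le h0 hα K (fun k ↦ (nrm k)⁻¹) (C := 4 * √(logK K))
    (by
      rw [mul_pow, Real.sq_sqrt (zero_le_one.trans (one_le_logK hK))]
      linarith [sum_lowFin_inv_sq_le hK]) (by positivity)
  simpa only [norm_igrad] using this

lemma tsum_low_le {α : (Fin 2 → ℤ) → ℂ} (h0 : α 0 = 0) (hα : Sq α) {K : ℝ} (hK : 0 < K) :
    (Summable fun k ↦ ‖low K α k‖) ∧ ∑' k, ‖low K α k‖ ≤ 3 * K * l2 (low K α) := by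
  have := tsum_mul_low_le h0 hα K (fun _ ↦ 1) (C := 3 * K)
    (by
      have := card_lowFin_le hK
      simp only [one_pow, Finset.sum_const, nsmul_eq_mul, mul_one]
      nlinarith [sq_nonneg K]) (by positivity)
  simpa only [one_mul] using this

/-- The constant in the embedding of `H²` into `L^∞`. -/
def agmonConst : ℝ := √(∑' k : Fin 2 → ℤ, ((nrm k ^ 2)⁻¹) ^ 2)

/-- Since |k|⁻² is square summable in two dimensions, no truncation is needed here. The price is a
full gradient, so this serves absolute convergence and integrability in time, not the a priori
estimates. -/
lemma H1.summable_igrad {α : (Fin 2 → ℤ) → ℂ} (h : H1 α) :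
    (Summable fun k ↦ ‖igrad α k‖) ∧ ∑' k, ‖igrad α k‖ ≤ agmonConst * l2 (grad α) := by
  have := summable_mul_of_sq (a := fun k ↦ (nrm k ^ 2)⁻¹) (b := fun k ↦ ‖grad α k‖)
    (fun k ↦ by positivity) (fun _ ↦ norm_nonneg _) summable_inv_nrm_pow_four h.sq_grad
  have he : (fun k ↦ (nrm k ^ 2)⁻¹ * ‖grad α k‖) = fun k ↦ ‖igrad α k‖ := by
    funext k
    rw [norm_grad, norm_igrad]
    by_cases hk : k = 0
    · simp [hk]
    · have := (nrm_pos hk).ne'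
      field_simp
  rw [he] at this
  exact this

/-! ### Young's inequality for triple sums -/

/-- The value `l2` for real sequences. -/
def rl2 (a : (Fin 2 → ℤ) → ℝ) : ℝ := √(∑' k, a k ^ 2)

/-- With the index of the ℓ¹ factor frozen, Cauchy-Schwarz applies in the other index. The
bijections φ allow one argument to place the ℓ¹ factor in the first or in the third slot. -/
lemma young_aux {a b c : (Fin 2 → ℤ) → ℝ} (ha0 : ∀ k, 0 ≤ a k) (hb0 : ∀ k, 0 ≤ b k)
    (hc0 : ∀ k, 0 ≤ c k) (ha : Summable a) (hb : Summable fun k ↦ b k ^ 2)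
    (hc : Summable fun k ↦ c k ^ 2) (φ : (Fin 2 → ℤ) → (Fin 2 → ℤ) ≃ (Fin 2 → ℤ)) :
    (Summable fun x : (Fin 2 → ℤ) × (Fin 2 → ℤ) ↦ a x.1 * (b (φ x.1 x.2) * c x.2)) ∧
    ∑' x : (Fin 2 → ℤ) × (Fin 2 → ℤ), a x.1 * (b (φ x.1 x.2) * c x.2)
      ≤ (∑' k, a k) * (rl2 b * rl2 c) := by
  have hin : ∀ h, (Summable fun k ↦ b (φ h k) * c k) ∧
      ∑' k, b (φ h k) * c k ≤ rl2 b * rl2 c := by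
    intro h
    have h1 : Summable fun k ↦ b (φ h k) ^ 2 := (φ h).summable_iff.mpr hb
    have := summable_mul_of_sq (a := fun k ↦ b (φ h k)) (fun _ ↦ hb0 _) hc0 h1 hc
    rwa [(φ h).tsum_eq (fun k ↦ b k ^ 2)] at this
  have hbd : ∀ h, ∑' k, a h * (b (φ h k) * c k) ≤ a h * (rl2 b * rl2 c) := fun h ↦ by
    rw [tsum_mul_left]; exact mul_le_mul_of_nonneg_left (hin h).2 (ha0 h)
  have hs1 : Summable fun h ↦ ∑' k, a h * (b (φ h k) * c k) :=
    Summable.of_nonneg_of_le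
      (fun h ↦ tsum_nonneg fun k ↦ mul_nonneg (ha0 _) (mul_nonneg (hb0 _) (hc0 _))) hbd
      (ha.mul_right _)
  have hs : Summable fun x : (Fin 2 → ℤ) × (Fin 2 → ℤ) ↦ a x.1 * (b (φ x.1 x.2) * c x.2) := by
    rw [summable_prod_of_nonneg fun x ↦ mul_nonneg (ha0 _) (mul_nonneg (hb0 _) (hc0 _))]
    refine ⟨fun h ↦ ?_, hs1⟩
    have := (hin h).1.mul_left (a h)
    exact this
  refine ⟨hs, ?_⟩
  have h1 := hs.tsum_prod
  have h2 : ∑' h, a h * (rl2 b * rl2 c) = (∑' h, a h) * (rl2 b * rl2 c) := tsum_mul_right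
  have h3 : Summable fun h ↦ a h * (rl2 b * rl2 c) := ha.mul_right _
  rw [h1, ← h2]
  exact hs1.tsum_le_tsum hbd h3

lemma young_fst {a b c : (Fin 2 → ℤ) → ℝ} (ha0 : ∀ k, 0 ≤ a k) (hb0 : ∀ k, 0 ≤ b k)
    (hc0 : ∀ k, 0 ≤ c k) (ha : Summable a) (hb : Summable fun k ↦ b k ^ 2)
    (hc : Summable fun k ↦ c k ^ 2) :
    (Summable fun x : (Fin 2 → ℤ) × (Fin 2 → ℤ) ↦ a x.1 * b (x.2 - x.1) * c x.2) ∧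
    ∑' x : (Fin 2 → ℤ) × (Fin 2 → ℤ), a x.1 * b (x.2 - x.1) * c x.2
      ≤ (∑' k, a k) * rl2 b * rl2 c := by
  have := young_aux ha0 hb0 hc0 ha hb hc (fun h ↦ Equiv.subRight h)
  simpa only [Equiv.subRight_apply, mul_assoc] using this

lemma young_snd {a b c : (Fin 2 → ℤ) → ℝ} (ha0 : ∀ k, 0 ≤ a k) (hb0 : ∀ k, 0 ≤ b k)
    (hc0 : ∀ k, 0 ≤ c k) (ha : Summable fun k ↦ a k ^ 2) (hb : Summable b)
    (hc : Summable fun k ↦ c k ^ 2) :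
    (Summable fun x : (Fin 2 → ℤ) × (Fin 2 → ℤ) ↦ a x.1 * b (x.2 - x.1) * c x.2) ∧
    ∑' x : (Fin 2 → ℤ) × (Fin 2 → ℤ), a x.1 * b (x.2 - x.1) * c x.2
      ≤ (∑' k, b k) * rl2 a * rl2 c := by
  have := young_fst hb0 ha0 hc0 hb ha hc
  -- The involution (h, k) ↦ (k - h, k) exchanges the first two slots.
  let e : (Fin 2 → ℤ) × (Fin 2 → ℤ) ≃ (Fin 2 → ℤ) × (Fin 2 → ℤ) :=
    { toFun := fun x ↦ (x.2 - x.1, x.2)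
      invFun := fun x ↦ (x.2 - x.1, x.2)
      left_inv := fun x ↦ by simp
      right_inv := fun x ↦ by simp }
  rw [← e.summable_iff, ← e.tsum_eq] at this
  have he : ∀ x, a x.1 * b (x.2 - x.1) * c x.2
      = b (e x).1 * a ((e x).2 - (e x).1) * c (e x).2 := fun x ↦ by
    simp only [e, Equiv.coe_fn_mk, sub_sub_cancel]
    ring
  simp only [he]
  exact this

lemma young_trd {a b c : (Fin 2 → ℤ) → ℝ} (ha0 : ∀ k, 0 ≤ a k) (hb0 : ∀ k, 0 ≤ b k)
    (hc0 : ∀ k, 0 ≤ c k) (ha : Summable fun k ↦ a k ^ 2) (hb : Summable fun k ↦ b k ^ 2)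
    (hc : Summable c) :
    (Summable fun x : (Fin 2 → ℤ) × (Fin 2 → ℤ) ↦ a x.1 * b (x.2 - x.1) * c x.2) ∧
    ∑' x : (Fin 2 → ℤ) × (Fin 2 → ℤ), a x.1 * b (x.2 - x.1) * c x.2
      ≤ (∑' k, c k) * rl2 b * rl2 a := by
  have := young_aux hc0 hb0 ha0 hc hb ha (fun h ↦ Equiv.subLeft h)
  rw [← (Equiv.prodComm _ _).summable_iff, ← (Equiv.prodComm _ _).tsum_eq] at this
  simp only [Function.comp_def, Equiv.prodComm_apply, Prod.fst_swap, Prod.snd_swap,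
    Equiv.subLeft_apply] at this
  have he : ∀ x : (Fin 2 → ℤ) × (Fin 2 → ℤ), a x.1 * b (x.2 - x.1) * c x.2
      = c x.2 * (b (x.2 - x.1) * a x.1) := fun x ↦ by ring
  simp only [he]
  rw [mul_assoc]
  exact this

/-! ### The trilinear form of the vorticity equation -/

/-- The kernel `(h ∧ j)/|h|²`. -/
def kern (h j : Fin 2 → ℤ) : ℝ := ((h 0 : ℝ) * j 1 - h 1 * j 0) / wavenumberSq h

/-- As h ∧ (k - h) = h ∧ k, the derivative can be moved onto the output wavenumber k; this is
incompressibility in Fourier variables. -/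
lemma abs_kern_le (h k : Fin 2 → ℤ) : |kern h (k - h)| ≤ (nrm h)⁻¹ * nrm k := by
  by_cases hh : h = 0
  · simp [hh, kern]
  have hp := nrm_pos hh
  rw [kern, ← nrm_sq, abs_div, abs_of_nonneg (sq_nonneg (nrm h)), div_le_iff₀ (by positivity)]
  have h1 : (nrm h)⁻¹ * nrm k * nrm h ^ 2 = nrm h * nrm k := by field_simp
  rw [h1]
  refine abs_le_of_sq_le_sq ?_ (mul_nonneg hp.le (nrm_nonneg k))
  rw [mul_pow, nrm_sq, nrm_sq, wavenumberSq_eq, wavenumberSq_eq]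
  simp only [Pi.sub_apply, Int.cast_sub]
  -- Lagrange's identity (h ∧ k)² + (h · k)² = |h|²|k|².
  nlinarith [sq_nonneg ((h 0 : ℝ) * k 0 + h 1 * k 1)]

/-- The terms of the trilinear form. -/
def triTerm (α β γ : (Fin 2 → ℤ) → ℂ) (x : (Fin 2 → ℤ) × (Fin 2 → ℤ)) : ℂ :=
  kern x.1 (x.2 - x.1) * α x.1 * β (x.2 - x.1) * conj (γ x.2)

/-- The trilinear form. -/
def tri (α β γ : (Fin 2 → ℤ) → ℂ) : ℂ := ∑' x, triTerm α β γ x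

/-- The nonlinearity of the vorticity equation. -/
def nonlin (α β : (Fin 2 → ℤ) → ℂ) (k : Fin 2 → ℤ) : ℂ :=
  ∑' h, (kern h (k - h) : ℂ) * α h * β (k - h)

lemma norm_triTerm_le (α β γ : (Fin 2 → ℤ) → ℂ) (x : (Fin 2 → ℤ) × (Fin 2 → ℤ)) :
    ‖triTerm α β γ x‖ ≤ ‖igrad α x.1‖ * ‖β (x.2 - x.1)‖ * ‖grad γ x.2‖ := by
  rw [triTerm, norm_mul, norm_mul, norm_mul, Complex.norm_real, Real.norm_eq_abs, RCLike.norm_conj,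
    norm_igrad, norm_grad]
  calc _ ≤ (nrm x.1)⁻¹ * nrm x.2 * ‖α x.1‖ * ‖β (x.2 - x.1)‖ * ‖γ x.2‖ := by
        gcongr; exact abs_kern_le _ _
    _ = _ := by ring

lemma tri_bound_of {α β γ : (Fin 2 → ℤ) → ℂ} {C : ℝ}
    (h : (Summable fun x : (Fin 2 → ℤ) × (Fin 2 → ℤ) ↦
      ‖igrad α x.1‖ * ‖β (x.2 - x.1)‖ * ‖grad γ x.2‖) ∧
      ∑' x : (Fin 2 → ℤ) × (Fin 2 → ℤ), ‖igrad α x.1‖ * ‖β (x.2 - x.1)‖ * ‖grad γ x.2‖ ≤ C) :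
    ‖tri α β γ‖ ≤ C := by
  have hs : Summable fun x ↦ ‖triTerm α β γ x‖ :=
    Summable.of_nonneg_of_le (fun _ ↦ norm_nonneg _) (norm_triTerm_le α β γ) h.1
  refine (norm_tsum_le_tsum_norm hs).trans (le_trans ?_ h.2)
  exact hs.tsum_le_tsum (norm_triTerm_le α β γ) h.1

lemma summable_majorant {α β γ : (Fin 2 → ℤ) → ℂ} (hα : H1 α) (hβ : Sq β) (hγ : Sq (grad γ)) :
    (Summable fun x : (Fin 2 → ℤ) × (Fin 2 → ℤ) ↦
      ‖igrad α x.1‖ * ‖β (x.2 - x.1)‖ * ‖grad γ x.2‖) ∧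
      ∑' x : (Fin 2 → ℤ) × (Fin 2 → ℤ), ‖igrad α x.1‖ * ‖β (x.2 - x.1)‖ * ‖grad γ x.2‖
        ≤ agmonConst * l2 (grad α) * l2 β * l2 (grad γ) := by
  have h := young_fst (a := fun k ↦ ‖igrad α k‖) (b := fun k ↦ ‖β k‖) (c := fun k ↦ ‖grad γ k‖)
    (fun _ ↦ norm_nonneg _) (fun _ ↦ norm_nonneg _) (fun _ ↦ norm_nonneg _)
    hα.summable_igrad.1 hβ hγ
  refine ⟨h.1, h.2.trans ?_⟩
  have := hα.summable_igrad.2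
  change _ * l2 β * l2 (grad γ) ≤ _
  have := l2_nonneg β
  have := l2_nonneg (grad γ)
  gcongr

lemma summable_norm_triTerm {α β γ : (Fin 2 → ℤ) → ℂ} (hα : H1 α) (hβ : Sq β)
    (hγ : Sq (grad γ)) : Summable fun x ↦ ‖triTerm α β γ x‖ :=
  Summable.of_nonneg_of_le (fun _ ↦ norm_nonneg _) (norm_triTerm_le α β γ)
    (summable_majorant hα hβ hγ).1

lemma summable_triTerm {α β γ : (Fin 2 → ℤ) → ℂ} (hα : H1 α) (hβ : Sq β)
    (hγ : Sq (grad γ)) : Summable (triTerm α β γ) :=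
  (summable_norm_triTerm hα hβ hγ).of_norm

/-- This bound and the next two put the low-mode factor in ℓ¹. In the first slot the multiplier
|k|⁻¹ reduces the cost to a logarithm; in the other slots the cost is K, and those bounds are meant
for a high-mode first argument, where `igrad` gains K⁻¹. -/
lemma norm_tri_low_fst_le {α β γ : (Fin 2 → ℤ) → ℂ} (hα : H1 α) (hβ : Sq β)
    (hγ : Sq (grad γ)) {K : ℝ} (hK : 0 < K) :
    ‖tri (low K α) β γ‖ ≤ 4 * √(logK K) * l2 (low K α) * l2 β * l2 (grad γ) := by
  have h1 := tsum_igrad_low_le hα.zero hα.sq hK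
  have h := young_fst (a := fun k ↦ ‖igrad (low K α) k‖) (b := fun k ↦ ‖β k‖)
    (c := fun k ↦ ‖grad γ k‖)
    (fun _ ↦ norm_nonneg _) (fun _ ↦ norm_nonneg _) (fun _ ↦ norm_nonneg _) h1.1 hβ hγ
  refine tri_bound_of ⟨h.1, h.2.trans ?_⟩
  change _ * l2 β * l2 (grad γ) ≤ _
  have := l2_nonneg β
  have := l2_nonneg (grad γ)
  have := h1.2
  gcongr

lemma norm_tri_low_snd_le {α β γ : (Fin 2 → ℤ) → ℂ} (hα : Sq α) (hβ : H1 β)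
    (hγ : Sq (grad γ)) {K : ℝ} (hK : 0 < K) :
    ‖tri α (low K β) γ‖ ≤ 3 * K * l2 (igrad α) * l2 (low K β) * l2 (grad γ) := by
  have h1 := tsum_low_le hβ.zero hβ.sq hK
  have h := young_snd (a := fun k ↦ ‖igrad α k‖) (b := fun k ↦ ‖low K β k‖)
    (c := fun k ↦ ‖grad γ k‖)
    (fun _ ↦ norm_nonneg _) (fun _ ↦ norm_nonneg _) (fun _ ↦ norm_nonneg _) hα.igrad h1.1 hγ
  refine tri_bound_of ⟨h.1, h.2.trans ?_⟩
  change _ * l2 (igrad α) * l2 (grad γ) ≤ _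
  have := l2_nonneg (igrad α)
  have := l2_nonneg (grad γ)
  calc _ ≤ 3 * K * l2 (low K β) * l2 (igrad α) * l2 (grad γ) := by
        have := h1.2
        gcongr
    _ = _ := by ring

lemma norm_tri_low_trd_le {α β γ : (Fin 2 → ℤ) → ℂ} (hα : Sq α) (hβ : Sq β)
    (hγ : H1 γ) {K : ℝ} (hK : 0 < K) :
    ‖tri α β (low K γ)‖ ≤ 3 * K * l2 (igrad α) * l2 β * l2 (grad (low K γ)) := by
  have h1 := tsum_low_le (α := grad γ) (by simp [grad]) hγ.sq_grad hK
  rw [← grad_low] at h1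
  have h := young_trd (a := fun k ↦ ‖igrad α k‖) (b := fun k ↦ ‖β k‖)
    (c := fun k ↦ ‖grad (low K γ) k‖)
    (fun _ ↦ norm_nonneg _) (fun _ ↦ norm_nonneg _) (fun _ ↦ norm_nonneg _) hα.igrad hβ h1.1
  refine tri_bound_of ⟨h.1, h.2.trans ?_⟩
  change _ * l2 β * l2 (igrad α) ≤ _
  have := l2_nonneg (igrad α)
  have := l2_nonneg β
  calc _ ≤ 3 * K * l2 (grad (low K γ)) * l2 β * l2 (igrad α) := by
        have := h1.2
        gcongr
    _ = _ := by ring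

lemma tri_add_fst {α α' β γ : (Fin 2 → ℤ) → ℂ} (hα : H1 α) (hα' : H1 α') (hβ : Sq β)
    (hγ : Sq (grad γ)) : tri (α + α') β γ = tri α β γ + tri α' β γ := by
  rw [tri, tri, tri, ← (summable_triTerm hα hβ hγ).tsum_add (summable_triTerm hα' hβ hγ)]
  congr 1; funext x; simp only [triTerm, Pi.add_apply]; ring

lemma tri_add_snd {α β β' γ : (Fin 2 → ℤ) → ℂ} (hα : H1 α) (hβ : Sq β) (hβ' : Sq β')
    (hγ : Sq (grad γ)) : tri α (β + β') γ = tri α β γ + tri α β' γ := by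
  rw [tri, tri, tri, ← (summable_triTerm hα hβ hγ).tsum_add (summable_triTerm hα hβ' hγ)]
  congr 1; funext x; simp only [triTerm, Pi.add_apply]; ring

lemma tri_add_trd {α β γ γ' : (Fin 2 → ℤ) → ℂ} (hα : H1 α) (hβ : Sq β)
    (hγ : Sq (grad γ)) (hγ' : Sq (grad γ')) : tri α β (γ + γ') = tri α β γ + tri α β γ' := by
  rw [tri, tri, tri, ← (summable_triTerm hα hβ hγ).tsum_add (summable_triTerm hα hβ hγ')]
  congr 1; funext x; simp only [triTerm, Pi.add_apply, map_add]; ring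

/-- The symmetry of the Fourier coefficients of real functions. -/
def IsReal (α : (Fin 2 → ℤ) → ℂ) : Prop := ∀ k, α (-k) = conj (α k)

/-- Conservation of enstrophy. The reindexing e changes the sign of the kernel and exchanges the two
copies of β, so the form equals minus its conjugate. Reindexing and conjugation commute with `tsum`
unconditionally, hence no summability is required. -/
lemma re_tri_self {α β : (Fin 2 → ℤ) → ℂ} (hα : IsReal α) : (tri α β β).re = 0 := by
  let e : (Fin 2 → ℤ) × (Fin 2 → ℤ) ≃ (Fin 2 → ℤ) × (Fin 2 → ℤ) :=
    { toFun := fun x ↦ (-x.1, x.2 - x.1)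
      invFun := fun x ↦ (-x.1, x.2 - x.1)
      left_inv := fun x ↦ by simp
      right_inv := fun x ↦ by simp }
  have h : tri α β β = - conj (tri α β β) := by
    conv_lhs => rw [tri, ← e.tsum_eq]
    rw [tri, Complex.conj_tsum, ← tsum_neg]
    congr 1; funext x
    have h1 : kern (-x.1) x.2 = - kern x.1 (x.2 - x.1) := by
      simp only [kern, wavenumberSq_eq, Pi.neg_apply, Pi.sub_apply]
      push_cast
      ring
    simp only [triTerm, e, Equiv.coe_fn_mk, hα x.1, map_mul, Complex.conj_conj,
      Complex.conj_ofReal, sub_neg_eq_add, sub_add_cancel, h1]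
    push_cast
    ring
  have := congrArg Complex.re h
  simp only [Complex.neg_re, Complex.conj_re] at this
  linarith

/-- Fubini for the absolutely convergent double sum, with the output wavenumber taken outside. -/
lemma summable_nonlin_mul {α β γ : (Fin 2 → ℤ) → ℂ} (hα : H1 α) (hβ : Sq β)
    (hγ : Sq (grad γ)) :
    (Summable fun k ↦ ‖nonlin α β k‖ * ‖γ k‖) ∧
      ∑' k, ‖nonlin α β k‖ * ‖γ k‖ ≤ agmonConst * l2 (grad α) * l2 β * l2 (grad γ) ∧
      ∑' k, nonlin α β k * conj (γ k) = tri α β γ := by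
  have hm := summable_majorant hα hβ hγ
  have hs := summable_norm_triTerm hα hβ hγ
  have hs2 : Summable fun x : (Fin 2 → ℤ) × (Fin 2 → ℤ) ↦ ‖triTerm α β γ x.swap‖ :=
    hs.prod_symm
  have hle : ∀ k, ‖nonlin α β k‖ * ‖γ k‖ ≤ ∑' h, ‖triTerm α β γ (h, k)‖ := by
    intro k
    have h1 : ‖nonlin α β k‖ * ‖γ k‖ = ‖∑' h, triTerm α β γ (h, k)‖ := by
      simp only [triTerm]
      rw [tsum_mul_right, norm_mul, RCLike.norm_conj, nonlin]
    rw [h1]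
    exact norm_tsum_le_tsum_norm (hs2.prod_factor k)
  have hs3 : Summable fun k ↦ ∑' h, ‖triTerm α β γ (h, k)‖ := hs2.prod
  have hs4 := Summable.of_nonneg_of_le (fun k ↦ by positivity) hle hs3
  refine ⟨hs4, ?_, ?_⟩
  · refine (hs4.tsum_le_tsum hle hs3).trans ?_
    have h5 : ∑' k, ∑' h, ‖triTerm α β γ (h, k)‖ = ∑' x, ‖triTerm α β γ x‖ := by
      have := hs2.tsum_prod
      rw [← (Equiv.prodComm _ _).tsum_eq (fun x ↦ ‖triTerm α β γ x‖)]
      exact this.symm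
    rw [h5]
    exact (hs.tsum_le_tsum (norm_triTerm_le α β γ) hm.1).trans hm.2
  · have hs6 : Summable fun x : (Fin 2 → ℤ) × (Fin 2 → ℤ) ↦ triTerm α β γ x.swap :=
      hs2.of_norm
    have := hs6.tsum_prod
    rw [tri, ← (Equiv.prodComm _ _).tsum_eq (fun x ↦ triTerm α β γ x)]
    refine Eq.trans ?_ this.symm
    congr 1; funext k
    simp only [triTerm, Prod.swap]
    rw [tsum_mul_right, nonlin]

/-! ### Functionals with an integrable rate of change -/

/-- `Y` is, on `[0, ∞)`, a primitive of the locally integrable function `D`. -/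
structure HasRate (Y D : ℝ → ℝ) : Prop where
  intervalIntegrable : ∀ T, 0 ≤ T → IntervalIntegrable D volume 0 T
  eq : ∀ t, 0 ≤ t → Y t = Y 0 + ∫ s in (0 : ℝ)..t, D s

lemma HasRate.intervalIntegrable' {Y D : ℝ → ℝ} (h : HasRate Y D) {s t : ℝ} (hs : 0 ≤ s)
    (ht : 0 ≤ t) : IntervalIntegrable D volume s t :=
  (h.intervalIntegrable s hs).symm.trans (h.intervalIntegrable t ht)

lemma HasRate.sub_eq {Y D : ℝ → ℝ} (h : HasRate Y D) {s t : ℝ} (hs : 0 ≤ s) (ht : 0 ≤ t) :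
    Y t - Y s = ∫ τ in s..t, D τ := by
  rw [h.eq t ht, h.eq s hs, ← intervalIntegral.integral_interval_sub_left
    (h.intervalIntegrable t ht) (h.intervalIntegrable s hs)]
  ring

lemma HasRate.continuousOn {Y D : ℝ → ℝ} (h : HasRate Y D) {a b : ℝ} (ha : 0 ≤ a) (hab : a ≤ b) :
    ContinuousOn Y (Icc a b) := by
  have h1 := intervalIntegral.continuousOn_primitive_interval'
    (h.intervalIntegrable' ha (ha.trans hab)) (left_mem_uIcc (a := a) (b := b))
  rw [uIcc_of_le hab] at h1
  refine (h1.const_add (Y a)).congr fun t ht ↦ ?_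
  simp only
  rw [← h.sub_eq ha (ha.trans ht.1)]
  ring

lemma HasRate.add {Y D Y' D' : ℝ → ℝ} (h : HasRate Y D) (h' : HasRate Y' D') :
    HasRate (fun t ↦ Y t + Y' t) (fun t ↦ D t + D' t) where
  intervalIntegrable T hT := (h.intervalIntegrable T hT).add (h'.intervalIntegrable T hT)
  eq t ht := by
    rw [h.eq t ht, h'.eq t ht, intervalIntegral.integral_add (h.intervalIntegrable t ht)
      (h'.intervalIntegrable t ht)]
    ring

lemma HasRate.const_mul {Y D : ℝ → ℝ} (h : HasRate Y D) (c : ℝ) :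
    HasRate (fun t ↦ c * Y t) (fun t ↦ c * D t) where
  intervalIntegrable T hT := (h.intervalIntegrable T hT).const_mul c
  eq t ht := by
    rw [h.eq t ht, intervalIntegral.integral_const_mul]
    ring

/-- Grönwall's inequality when the rate is controlled only almost everywhere. The majorant b - aY is
continuous, so integrating it bounds the lower right derivative of Y at every point, which is all
that the Grönwall lemma asks for. -/
theorem HasRate.le_exp {Y D : ℝ → ℝ} (h : HasRate Y D) {t₀ t₁ a b : ℝ} (ht₀ : 0 ≤ t₀)
    (ha : 0 < a) (hb : 0 ≤ b)
    (hD : ∀ᵐ s, s ∈ Ioc t₀ t₁ → D s ≤ b - a * Y s) {t : ℝ} (ht : t ∈ Icc t₀ t₁) :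
    Y t ≤ Real.exp (-(a * (t - t₀))) * Y t₀ + b / a := by
  have h01 : t₀ ≤ t₁ := ht.1.trans ht.2
  have hc := h.continuousOn ht₀ h01
  have hR : ContinuousOn (fun s ↦ b - a * Y s) (Icc t₀ t₁) :=
    continuousOn_const.sub (continuousOn_const.mul hc)
  have key : Y t ≤ gronwallBound (Y t₀) (-a) b (t - t₀) := by
    refine le_gronwallBound_of_liminf_deriv_right_le (f' := fun s ↦ b - a * Y s) hc ?_ le_rfl
      (fun x _ ↦ by linarith) t ht
    intro x hx r hr
    have hx0 : 0 ≤ x := ht₀.trans hx.1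
    have hint : IntervalIntegrable (fun s ↦ b - a * Y s) volume x t₁ := by
      apply ContinuousOn.intervalIntegrable
      rw [uIcc_of_le hx.2.le]
      exact hR.mono (Icc_subset_Icc_left hx.1)
    have hcx : ContinuousWithinAt (fun s ↦ b - a * Y s) (Ici x) x := by
      have := (hR x ⟨hx.1, hx.2.le⟩).mono (Icc_subset_Icc_left hx.1)
      exact this.mono_of_mem_nhdsWithin (Icc_mem_nhdsGE hx.2)
    have hder : HasDerivWithinAt (fun z ↦ ∫ s in x..z, (b - a * Y s)) (b - a * Y x) (Ici x) x := by
      refine intervalIntegral.integral_hasDerivWithinAt_right (a := x) (b := x) (by simp)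
        (t := Ioi x) ?_ (hcx.mono Ioi_subset_Ici_self)
      refine ⟨Icc x t₁, mem_of_superset (Icc_mem_nhdsGE hx.2) le_rfl |> nhdsWithin_mono x Ioi_subset_Ici_self, ?_⟩
      exact (hR.mono (Icc_subset_Icc_left hx.1)).aestronglyMeasurable measurableSet_Icc
    have hfreq := hder.liminf_right_slope_le hr
    have hev : ∀ᶠ z in 𝓝[>] x, z ∈ Ioc x t₁ := Ioc_mem_nhdsGT hx.2
    refine (hfreq.and_eventually hev).mono fun z hz ↦ ?_
    obtain ⟨hz1, hz2⟩ := hz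
    have hle : Y z - Y x ≤ ∫ s in x..z, (b - a * Y s) := by
      rw [h.sub_eq hx0 (hx0.trans hz2.1.le)]
      refine intervalIntegral.integral_mono_ae_restrict hz2.1.le
        (h.intervalIntegrable' hx0 (hx0.trans hz2.1.le))
        (hint.mono_set (uIcc_subset_uIcc_left (by
          rw [uIcc_of_le hx.2.le]; exact ⟨hz2.1.le, hz2.2⟩))) ?_
      rw [Measure.restrict_congr_set Ioc_ae_eq_Icc.symm]
      rw [EventuallyLE, ae_restrict_iff' measurableSet_Ioc]
      filter_upwards [hD] with s hs hs'
      exact hs ⟨hx.1.trans_lt hs'.1, hs'.2.trans hz2.2⟩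
    rw [slope_def_field, intervalIntegral.integral_same, sub_zero] at hz1
    refine lt_of_le_of_lt ?_ hz1
    rw [div_eq_inv_mul]
    exact mul_le_mul_of_nonneg_left hle (inv_nonneg.mpr (sub_nonneg.mpr hz2.1.le))
  rw [gronwallBound_of_K_ne_0 (neg_ne_zero.mpr ha.ne')] at key
  have he : Real.exp (-a * (t - t₀)) = Real.exp (-(a * (t - t₀))) := by ring_nf
  simp only [he] at key
  have h2 : b / -a * (Real.exp (-(a * (t - t₀))) - 1) ≤ b / a := by
    rw [div_neg, neg_mul, ← mul_neg, neg_sub]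
    refine mul_le_of_le_one_right (by positivity) ?_
    linarith [Real.exp_pos (-(a * (t - t₀)))]
  linarith [mul_comm (Y t₀) (Real.exp (-(a * (t - t₀))))]

theorem HasRate.eventually_le {Y D : ℝ → ℝ} (h : HasRate Y D) {t₀ a b : ℝ} (ht₀ : 0 ≤ t₀)
    (ha : 0 < a) (hb : 0 ≤ b) (hD : ∀ᵐ s, t₀ < s → D s ≤ b - a * Y s) {η : ℝ} (hη : 0 < η) :
    ∀ᶠ t in atTop, Y t ≤ b / a + η := by
  have h1 : Tendsto (fun t ↦ Real.exp (-(a * (t - t₀))) * Y t₀) atTop (𝓝 (0 * Y t₀)) := by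
    refine Tendsto.mul_const _ (Real.tendsto_exp_neg_atTop_nhds_zero.comp ?_)
    exact (tendsto_atTop_add_const_right _ (-t₀) tendsto_id).const_mul_atTop ha
  rw [zero_mul] at h1
  filter_upwards [h1.eventually (gt_mem_nhds hη), eventually_ge_atTop t₀] with t h2 h3
  have := h.le_exp ht₀ ha hb (t₁ := t) (by
    filter_upwards [hD] with s hs hs'
    exact hs hs'.1) ⟨h3, le_rfl⟩
  linarith

/-! ### The energy identity -/

/-- Integration by parts of an absolutely continuous function against itself. The real and imaginary
parts of a single Fourier mode are treated in this way. -/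
lemma sq_sub_sq_eq_integral {x X : ℝ → ℝ} {T : ℝ} (hT : 0 ≤ T)
    (hX : IntervalIntegrable X volume 0 T)
    (hx : ∀ t ∈ Icc 0 T, x t = x 0 + ∫ s in (0 : ℝ)..t, X s) :
    x T ^ 2 = x 0 ^ 2 + ∫ s in (0 : ℝ)..T, 2 * (x s * X s) := by
  have hmem : (0 : ℝ) ∈ uIcc 0 T := left_mem_uIcc
  have hac := (hX.absolutelyContinuousOnInterval_intervalIntegral hmem)
  have hac' : AbsolutelyContinuousOnInterval (fun t ↦ x 0 + ∫ s in (0 : ℝ)..t, X s) 0 T := by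
    refine AbsolutelyContinuousOnInterval.add ?_ hac
    exact (LipschitzWith.const (x 0)).lipschitzOnWith.absolutelyContinuousOnInterval
  have h := hac'.integral_deriv_mul_eq_sub hac'
  rw [intervalIntegral.integral_same, add_zero, ← hx T ⟨hT, le_rfl⟩] at h
  have h2 : ∫ s in (0 : ℝ)..T, 2 * (x s * X s) = x T * x T - x 0 * x 0 := by
    rw [← h]
    refine intervalIntegral.integral_congr_ae ?_
    filter_upwards [hX.ae_hasDerivAt_integral] with s hs hs'
    have hs1 : s ∈ uIcc 0 T := uIoc_subset_uIcc hs'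
    have hd := ((hs hs1 0 hmem).const_add (x 0)).deriv
    rw [uIcc_of_le hT] at hs1
    rw [hd, ← hx s hs1]
    ring
  rw [h2]; ring

lemma normSq_eq_integral {z Z : ℝ → ℂ} {T : ℝ} (hT : 0 ≤ T)
    (hZ : IntervalIntegrable Z volume 0 T)
    (hz : ∀ t ∈ Icc 0 T, z t = z 0 + ∫ s in (0 : ℝ)..t, Z s) :
    ‖z T‖ ^ 2 = ‖z 0‖ ^ 2 + ∫ s in (0 : ℝ)..T, 2 * (Z s * conj (z s)).re := by
  have hsub : ∀ t ∈ Icc 0 T, IntervalIntegrable Z volume 0 t := fun t ht ↦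
    hZ.mono_set (uIcc_subset_uIcc_left (by rw [uIcc_of_le hT]; exact ht))
  have hre : ∀ t ∈ Icc 0 T, ∫ s in (0 : ℝ)..t, (Z s).re = (∫ s in (0 : ℝ)..t, Z s).re :=
    fun t ht ↦ by
      have := Complex.reCLM.intervalIntegral_comp_comm (hsub t ht)
      simpa using this
  have him : ∀ t ∈ Icc 0 T, ∫ s in (0 : ℝ)..t, (Z s).im = (∫ s in (0 : ℝ)..t, Z s).im :=
    fun t ht ↦ by
      have := Complex.imCLM.intervalIntegral_comp_comm (hsub t ht)
      simpa using this
  have hZr : IntervalIntegrable (fun s ↦ (Z s).re) volume 0 T := by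
    rw [intervalIntegrable_iff] at hZ ⊢; exact hZ.re
  have hZi : IntervalIntegrable (fun s ↦ (Z s).im) volume 0 T := by
    rw [intervalIntegrable_iff] at hZ ⊢; exact hZ.im
  have h1 := sq_sub_sq_eq_integral (x := fun t ↦ (z t).re) hT hZr
    (fun t ht ↦ by rw [hre t ht, hz t ht, Complex.add_re, hz 0 ⟨le_rfl, hT⟩])
  have h2 := sq_sub_sq_eq_integral (x := fun t ↦ (z t).im) hT hZi
    (fun t ht ↦ by rw [him t ht, hz t ht, Complex.add_im, hz 0 ⟨le_rfl, hT⟩])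
  have hzc : ContinuousOn z (uIcc 0 T) := by
    have := intervalIntegral.continuousOn_primitive_interval' hZ (left_mem_uIcc (a := (0 : ℝ)))
    refine (this.const_add (z 0)).congr fun t ht ↦ ?_
    rw [uIcc_of_le hT] at ht
    exact hz t ht
  have hi1 : IntervalIntegrable (fun s ↦ 2 * ((z s).re * (Z s).re)) volume 0 T :=
    (hZr.continuousOn_mul (Complex.continuous_re.comp_continuousOn hzc)).const_mul 2
  have hi2 : IntervalIntegrable (fun s ↦ 2 * ((z s).im * (Z s).im)) volume 0 T :=
    (hZi.continuousOn_mul (Complex.continuous_im.comp_continuousOn hzc)).const_mul 2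
  have h3 : ∀ s, 2 * (Z s * conj (z s)).re = 2 * ((z s).re * (Z s).re) + 2 * ((z s).im * (Z s).im) :=
    fun s ↦ by simp only [Complex.mul_re, Complex.conj_re, Complex.conj_im]; ring
  simp only [h3]
  rw [intervalIntegral.integral_add hi1 hi2, Complex.sq_norm, Complex.sq_norm,
    Complex.normSq_apply, Complex.normSq_apply]
  linarith

lemma two_re_le (a b : ℂ) : ‖2 * (a * conj b).re‖ ≤ 2 * (‖b‖ * ‖a‖) := by
  rw [norm_mul, Real.norm_two, Real.norm_eq_abs]
  have := Complex.abs_re_le_norm (a * conj b)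
  rw [norm_mul, RCLike.norm_conj] at this
  linarith

/-- A sequence of Fourier coefficients, depending on time, with its time derivative, such that the
energy identity makes sense. -/
structure IsEvolution (z Z : ℝ → (Fin 2 → ℤ) → ℂ) : Prop where
  intervalIntegrable : ∀ k T, 0 ≤ T → IntervalIntegrable (fun s ↦ Z s k) volume 0 T
  eq : ∀ k t, 0 ≤ t → z t k = z 0 k + ∫ s in (0 : ℝ)..t, Z s k
  sq : ∀ t, 0 ≤ t → Sq (z t)
  finite : ∀ T, 0 ≤ T →
    ∫⁻ s in Ioc 0 T, ∑' k, ENNReal.ofReal (‖z s k‖ * ‖Z s k‖) < ∞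

lemma IsEvolution.continuousOn {z Z : ℝ → (Fin 2 → ℤ) → ℂ} (h : IsEvolution z Z)
    (k : Fin 2 → ℤ) {T : ℝ} (hT : 0 ≤ T) : ContinuousOn (fun t ↦ z t k) (Icc 0 T) := by
  have := intervalIntegral.continuousOn_primitive_interval' (h.intervalIntegrable k T hT)
    (left_mem_uIcc (a := (0 : ℝ)))
  rw [uIcc_of_le hT] at this
  exact (this.const_add (z 0 k)).congr fun t ht ↦ h.eq k t ht.1

/-- The condition `finite` permits summation over modes and integration in time to be exchanged, so
that the identities of the single modes add up. -/
lemma IsEvolution.hasSum {z Z : ℝ → (Fin 2 → ℤ) → ℂ} (h : IsEvolution z Z) {T : ℝ} (hT : 0 ≤ T) :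
    Integrable (fun s ↦ ∑' k, 2 * (Z s k * conj (z s k)).re) (volume.restrict (Ioc 0 T)) ∧
    HasSum (fun k ↦ ∫ s in Ioc 0 T, 2 * (Z s k * conj (z s k)).re)
      (∫ s in Ioc 0 T, ∑' k, 2 * (Z s k * conj (z s k)).re) := by
  have hzc : ∀ k, AEStronglyMeasurable (fun s ↦ z s k) (volume.restrict (Ioc 0 T)) := fun k ↦
    ((h.continuousOn k hT).mono Ioc_subset_Icc_self).aestronglyMeasurable measurableSet_Ioc
  have hZm : ∀ k, AEStronglyMeasurable (fun s ↦ Z s k) (volume.restrict (Ioc 0 T)) := fun k ↦ by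
    have := h.intervalIntegrable k T hT
    rw [intervalIntegrable_iff, uIoc_of_le hT] at this
    exact this.1
  have hfm : ∀ k, AEStronglyMeasurable (fun s ↦ 2 * (Z s k * conj (z s k)).re)
      (volume.restrict (Ioc 0 T)) := fun k ↦
    (Complex.continuous_re.comp_aestronglyMeasurable
      ((hZm k).mul (Complex.continuous_conj.comp_aestronglyMeasurable (hzc k)))).const_mul 2
  have hgm : ∀ k, AEMeasurable (fun s ↦ ENNReal.ofReal (‖z s k‖ * ‖Z s k‖))
      (volume.restrict (Ioc 0 T)) := fun k ↦
    ((hzc k).norm.aemeasurable.mul (hZm k).norm.aemeasurable).ennreal_ofReal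
  have hfin := h.finite T hT
  have hpt : ∀ s k, ‖2 * (Z s k * conj (z s k)).re‖ₑ
      ≤ 2 * ENNReal.ofReal (‖z s k‖ * ‖Z s k‖) := fun s k ↦ by
    rw [← ofReal_norm]
    refine (ENNReal.ofReal_le_ofReal (two_re_le _ _)).trans ?_
    rw [ENNReal.ofReal_mul zero_le_two, ENNReal.ofReal_ofNat]
  have hfin2 : ∑' k, ∫⁻ s in Ioc 0 T, ‖2 * (Z s k * conj (z s k)).re‖ₑ ≠ ∞ := by
    refine ne_top_of_le_ne_top (b := 2 * ∫⁻ s in Ioc 0 T,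
      ∑' k, ENNReal.ofReal (‖z s k‖ * ‖Z s k‖)) (ENNReal.mul_ne_top (by simp) hfin.ne) ?_
    rw [lintegral_tsum hgm, ← ENNReal.tsum_mul_left]
    refine ENNReal.tsum_le_tsum fun k ↦ ?_
    rw [← lintegral_const_mul'' _ (hgm k)]
    exact lintegral_mono fun s ↦ hpt s k
  have hint : ∀ k, Integrable (fun s ↦ 2 * (Z s k * conj (z s k)).re)
      (volume.restrict (Ioc 0 T)) := fun k ↦
    ⟨hfm k, lt_top_iff_ne_top.mpr (ENNReal.ne_top_of_tsum_ne_top hfin2 k)⟩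
  have hsum : Summable fun k ↦ ∫ s in Ioc 0 T, ‖2 * (Z s k * conj (z s k)).re‖ := by
    have := ENNReal.summable_toReal hfin2
    refine this.congr fun k ↦ ?_
    rw [integral_norm_eq_lintegral_enorm (hfm k)]
  refine ⟨?_, hasSum_integral_of_summable_integral_norm hint hsum⟩
  have hae : ∀ᵐ s ∂(volume.restrict (Ioc 0 T)),
      ∑' k, ENNReal.ofReal (‖z s k‖ * ‖Z s k‖) < ∞ :=
    ae_lt_top' (AEMeasurable.tsum hgm) hfin.ne
  refine ⟨?_, ?_⟩
  · refine aestronglyMeasurable_of_tendsto_ae (u := (atTop : Filter (Finset (Fin 2 → ℤ))))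
      (f := fun F s ↦ ∑ k ∈ F, 2 * (Z s k * conj (z s k)).re) (fun F ↦ ?_) ?_
    · exact Finset.aestronglyMeasurable_fun_sum F fun k _ ↦ hfm k
    · filter_upwards [hae] with s hs
      have h1 : Summable fun k ↦ 2 * (‖z s k‖ * ‖Z s k‖) := by
        refine Summable.mul_left 2 ?_
        refine (ENNReal.summable_toReal hs.ne).congr fun k ↦ ?_
        rw [ENNReal.toReal_ofReal (by positivity)]
      exact (Summable.of_norm_bounded h1 fun k ↦ two_re_le _ _).hasSum
  · refine lt_of_le_of_lt (b := ∫⁻ s in Ioc 0 T, 2 * ∑' k, ENNReal.ofReal (‖z s k‖ * ‖Z s k‖))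
      (lintegral_mono_ae ?_) ?_
    · filter_upwards [hae] with s hs
      have h0 : Summable fun k ↦ ‖z s k‖ * ‖Z s k‖ := by
        refine (ENNReal.summable_toReal hs.ne).congr fun k ↦ ?_
        rw [ENNReal.toReal_ofReal (by positivity)]
      rw [← ENNReal.ofReal_tsum_of_nonneg (fun k ↦ by positivity) h0, ← ENNReal.ofReal_ofNat 2,
        ← ENNReal.ofReal_mul zero_le_two, ← tsum_mul_left, ← ofReal_norm]
      exact ENNReal.ofReal_le_ofReal
        (tsum_of_norm_bounded (h0.mul_left 2).hasSum fun k ↦ two_re_le _ _)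
    · rw [lintegral_const_mul'' _ (AEMeasurable.tsum hgm)]
      exact ENNReal.mul_lt_top (by simp) hfin

theorem IsEvolution.hasRate {z Z : ℝ → (Fin 2 → ℤ) → ℂ} (h : IsEvolution z Z) :
    HasRate (fun t ↦ l2 (z t) ^ 2) (fun s ↦ ∑' k, 2 * (Z s k * conj (z s k)).re) where
  intervalIntegrable T hT := by
    rw [intervalIntegrable_iff, uIoc_of_le hT]
    exact (h.hasSum hT).1
  eq t ht := by
    have h1 := (h.hasSum ht).2
    simp only [l2_sq]
    rw [intervalIntegral.integral_of_le ht, ← h1.tsum_eq,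
      ← (h.sq 0 le_rfl : Summable _).tsum_add h1.summable]
    refine tsum_congr fun k ↦ ?_
    rw [← intervalIntegral.integral_of_le ht]
    exact normSq_eq_integral ht (h.intervalIntegrable k t ht) fun s hs ↦ h.eq k s hs.1

/-! ### The `ℓ²` pairing -/

/-- Absolute convergence of the `ℓ²` pairing. -/
def Pairs (a b : (Fin 2 → ℤ) → ℂ) : Prop := Summable fun k ↦ ‖a k‖ * ‖b k‖

/-- The `ℓ²` pairing. -/
def pair (a b : (Fin 2 → ℤ) → ℂ) : ℂ := ∑' k, a k * conj (b k)

/-- The multiplier `|k|²`. -/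
def lap (α : (Fin 2 → ℤ) → ℂ) (k : Fin 2 → ℤ) : ℂ := (wavenumberSq k : ℂ) * α k

lemma Pairs.summable {a b : (Fin 2 → ℤ) → ℂ} (h : Pairs a b) :
    Summable fun k ↦ a k * conj (b k) :=
  Summable.of_norm (by simp only [norm_mul, RCLike.norm_conj]; exact h)

lemma Pairs.norm_le {a b : (Fin 2 → ℤ) → ℂ} (h : Pairs a b) :
    ‖pair a b‖ ≤ ∑' k, ‖a k‖ * ‖b k‖ := by
  refine tsum_of_norm_bounded h.hasSum fun k ↦ ?_
  rw [norm_mul, RCLike.norm_conj]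

lemma Pairs.of_le {a a' b : (Fin 2 → ℤ) → ℂ} (h : Pairs a b) (hle : ∀ k, ‖a' k‖ ≤ ‖a k‖) :
    Pairs a' b :=
  Summable.of_nonneg_of_le (fun k ↦ by positivity)
    (fun k ↦ mul_le_mul_of_nonneg_right (hle k) (norm_nonneg _)) h

lemma Pairs.add {a a' b : (Fin 2 → ℤ) → ℂ} (h : Pairs a b) (h' : Pairs a' b) :
    Pairs (a + a') b :=
  Summable.of_nonneg_of_le (fun k ↦ by positivity)
    (fun k ↦ by
      rw [← add_mul]
      exact mul_le_mul_of_nonneg_right (norm_add_le _ _) (norm_nonneg _))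
    (Summable.add (f := fun k ↦ ‖a k‖ * ‖b k‖) (g := fun k ↦ ‖a' k‖ * ‖b k‖) h h')

lemma Pairs.smul {a b : (Fin 2 → ℤ) → ℂ} (h : Pairs a b) (c : ℂ) : Pairs (c • a) b :=
  ((h : Summable _).mul_left ‖c‖).congr fun k ↦ by simp [mul_assoc]

lemma Pairs.neg {a b : (Fin 2 → ℤ) → ℂ} (h : Pairs a b) : Pairs (-a) b :=
  h.of_le fun k ↦ by simp

lemma Pairs.sub {a a' b : (Fin 2 → ℤ) → ℂ} (h : Pairs a b) (h' : Pairs a' b) :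
    Pairs (a - a') b := by rw [sub_eq_add_neg]; exact h.add h'.neg

lemma pair_add {a a' b : (Fin 2 → ℤ) → ℂ} (h : Pairs a b) (h' : Pairs a' b) :
    pair (a + a') b = pair a b + pair a' b := by
  rw [pair, pair, pair, ← h.summable.tsum_add h'.summable]
  congr 1; funext k; simp only [Pi.add_apply]; ring

lemma pair_sub {a a' b : (Fin 2 → ℤ) → ℂ} (h : Pairs a b) (h' : Pairs a' b) :
    pair (a - a') b = pair a b - pair a' b := by
  rw [pair, pair, pair, ← h.summable.tsum_sub h'.summable]
  congr 1; funext k; simp only [Pi.sub_apply]; ring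

lemma pair_smul (a b : (Fin 2 → ℤ) → ℂ) (c : ℂ) : pair (c • a) b = c * pair a b := by
  rw [pair, pair, ← tsum_mul_left]
  congr 1; funext k; simp only [Pi.smul_apply, smul_eq_mul]; ring

lemma norm_low_le (K : ℝ) (a : (Fin 2 → ℤ) → ℂ) (k : Fin 2 → ℤ) : ‖low K a k‖ ≤ ‖a k‖ := by
  unfold low; split_ifs <;> simp

lemma norm_high_le (K : ℝ) (a : (Fin 2 → ℤ) → ℂ) (k : Fin 2 → ℤ) : ‖high K a k‖ ≤ ‖a k‖ := by
  unfold high; split_ifs <;> simp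

lemma pair_low (K : ℝ) (a b : (Fin 2 → ℤ) → ℂ) : pair (low K a) b = pair a (low K b) := by
  unfold pair; congr 1; funext k; simp only [low]; split_ifs <;> simp

lemma pair_high (K : ℝ) (a b : (Fin 2 → ℤ) → ℂ) : pair (high K a) b = pair a (high K b) := by
  unfold pair; congr 1; funext k; simp only [high]; split_ifs <;> simp

lemma low_low (K : ℝ) (a : (Fin 2 → ℤ) → ℂ) : low K (low K a) = low K a := by
  funext k; simp only [low]; split_ifs <;> simp

lemma high_high (K : ℝ) (a : (Fin 2 → ℤ) → ℂ) : high K (high K a) = high K a := by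
  funext k; simp only [high]; split_ifs <;> simp

lemma norm_mul_eq_igrad_mul_grad {f z : (Fin 2 → ℤ) → ℂ} (hz : z 0 = 0) (k : Fin 2 → ℤ) :
    ‖f k‖ * ‖z k‖ = ‖igrad f k‖ * ‖grad z k‖ := by
  by_cases hk : k = 0
  · subst hk; simp [hz, grad]
  · rw [norm_igrad, norm_grad]
    have := (nrm_pos hk).ne'
    field_simp

/-- Duality between |k|⁻¹ and |k|: f is the curl of a force, and `igrad` returns to the force
itself, so the force needs to be in L² only. -/
lemma pairs_force {f z : (Fin 2 → ℤ) → ℂ} (hf : Sq (igrad f)) (hz : H1 z) :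
    Pairs f z ∧ ‖pair f z‖ ≤ l2 (igrad f) * l2 (grad z) := by
  have h1 : Pairs f z := by
    unfold Pairs
    simp only [norm_mul_eq_igrad_mul_grad hz.zero]
    exact summable_norm_mul hf hz.sq_grad
  refine ⟨h1, h1.norm_le.trans ?_⟩
  simp only [norm_mul_eq_igrad_mul_grad hz.zero]
  exact tsum_norm_mul_le hf hz.sq_grad

lemma pairs_lap {α z : (Fin 2 → ℤ) → ℂ} (hα : H1 α) (hz : H1 z) : Pairs (lap α) z := by
  refine (summable_norm_mul hα.sq_grad hz.sq_grad).congr fun k ↦ ?_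
  rw [norm_grad, norm_grad, lap, norm_mul, Complex.norm_real,
    Real.norm_of_nonneg (wavenumberSq_nonneg k), ← nrm_sq]
  ring

lemma pair_lap_self (α : (Fin 2 → ℤ) → ℂ) : pair (lap α) α = ((l2 (grad α) ^ 2 : ℝ) : ℂ) := by
  rw [l2_sq, Complex.ofReal_tsum, pair]
  congr 1; funext k
  rw [norm_grad, lap, mul_assoc, Complex.mul_conj, Complex.normSq_eq_norm_sq, ← nrm_sq]
  push_cast; ring

lemma pairs_nonlin {α β γ : (Fin 2 → ℤ) → ℂ} (hα : H1 α) (hβ : Sq β) (hγ : H1 γ) :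
    Pairs (nonlin α β) γ := (summable_nonlin_mul hα hβ hγ.sq_grad).1

lemma pair_nonlin {α β γ : (Fin 2 → ℤ) → ℂ} (hα : H1 α) (hβ : Sq β) (hγ : H1 γ) :
    pair (nonlin α β) γ = tri α β γ := (summable_nonlin_mul hα hβ hγ.sq_grad).2.2

/-- The energy balance of ∂ₜz = f - νAz - n. The same form serves low, high and full modes; only the
pairing with n has to be estimated afterwards. -/
lemma rate_le {Z f n z : (Fin 2 → ℤ) → ℂ} {ν : ℝ} (hZ : Z = f - (ν : ℂ) • lap z - n)
    (hf : Sq (igrad f)) (hz : H1 z) (hn : Pairs n z) :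
    ∑' k, 2 * (Z k * conj (z k)).re
      ≤ 2 * (l2 (igrad f) * l2 (grad z)) - 2 * ν * l2 (grad z) ^ 2 - 2 * (pair n z).re := by
  have h1 := pairs_force hf hz
  have h2 := (pairs_lap hz hz).smul (ν : ℂ)
  have h3 : Pairs Z z := by rw [hZ]; exact (h1.1.sub h2).sub hn
  have h4 : ∑' k, 2 * (Z k * conj (z k)).re = 2 * (pair Z z).re := by
    rw [tsum_mul_left, pair, Complex.re_tsum h3.summable]
  have h5 : pair Z z = pair f z - (ν : ℂ) * ((l2 (grad z) ^ 2 : ℝ) : ℂ) - pair n z := by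
    rw [hZ, pair_sub (h1.1.sub h2) hn, pair_sub h1.1 h2, pair_smul, pair_lap_self]
  rw [h4, h5, ← Complex.ofReal_mul, Complex.sub_re, Complex.sub_re, Complex.ofReal_re]
  have := (Complex.re_le_norm _).trans h1.2
  linarith

/-! ### Bounds for the nonlinear terms -/

lemma one_le_sqrt_logK {K : ℝ} (hK : 0 < K) : 1 ≤ √(logK K) :=
  Real.one_le_sqrt.mpr (one_le_logK hK)

/-- Splitting w = Pw + Qw in the second slot, the part with two copies of Qw vanishes by
conservation of enstrophy. What remains has Pw in the second slot, with Pw (cost √L) or Qw (cost K,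
gain K⁻²) as velocity. The right side involves the low modes only to a controlled power, which suits
a bound on Pw that is already known. -/
lemma abs_re_tri_high_le {w : (Fin 2 → ℤ) → ℂ} (hw : H1 w) (hr : IsReal w) {K : ℝ} (hK : 0 < K) :
    |(tri w w (high K w)).re| ≤ 4 * √(logK K) * l2 (low K w) ^ 2 * l2 (grad (high K w))
      + 3 * K⁻¹ * l2 (low K w) * l2 (grad (high K w)) ^ 2 := by
  have hp := hw.low K
  have hq := hw.high K
  have h1 : tri w w (high K w) = tri (low K w) (low K w) (high K w)
      + tri (high K w) (low K w) (high K w) + tri w (high K w) (high K w) := by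
    rw [← tri_add_fst hp hq hp.sq hq.sq_grad, low_add_high,
      ← tri_add_snd hw hp.sq hq.sq hq.sq_grad, low_add_high]
  rw [h1, Complex.add_re, re_tri_self hr, add_zero]
  refine (Complex.abs_re_le_norm _).trans ((norm_add_le _ _).trans (add_le_add ?_ ?_))
  · refine (norm_tri_low_fst_le hw hp.sq hq.sq_grad hK).trans (le_of_eq (by ring))
  · refine (norm_tri_low_snd_le hq.sq hw hq.sq_grad hK).trans ?_
    have h2 := (l2_igrad_high_le hw.sq hK).trans
      (mul_le_mul_of_nonneg_left (l2_high_le_grad hw hK) (inv_nonneg.mpr hK.le))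
    have h3 := l2_nonneg (low K w)
    have h4 := l2_nonneg (grad (high K w))
    calc _ ≤ 3 * K * (K⁻¹ * (K⁻¹ * l2 (grad (high K w)))) * l2 (low K w)
          * l2 (grad (high K w)) := by gcongr
      _ = _ := by field_simp

/-- A low velocity costs 4√L; for a high velocity the factor 3K of the low test sequence is
cancelled by K⁻¹. Since √L ≥ 1, the sum is 7√L. -/
lemma norm_tri_low_le {w z : (Fin 2 → ℤ) → ℂ} (hw : H1 w) (hz : H1 z) {K : ℝ} (hK : 0 < K) :
    ‖tri w w (low K z)‖ ≤ 7 * √(logK K) * l2 w ^ 2 * l2 (grad (low K z)) := by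
  have hp := hw.low K
  have hq := hw.high K
  have hz' := hz.low K
  have h1 : tri w w (low K z) = tri (low K w) w (low K z) + tri (high K w) w (low K z) := by
    rw [← tri_add_fst hp hq hw.sq hz'.sq_grad, low_add_high]
  rw [h1]
  have h2 := norm_tri_low_fst_le hw hw.sq hz'.sq_grad hK
  have h3 := norm_tri_low_trd_le hq.sq hw.sq hz hK
  have h4 := l2_nonneg (grad (low K z))
  have h5 := l2_nonneg w
  have h6 := (l2_igrad_high_le hw.sq hK).trans
    (mul_le_mul_of_nonneg_left (l2_high_le hw.sq K) (inv_nonneg.mpr hK.le))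
  have h7 := l2_low_le hw.sq K
  have h8 := one_le_sqrt_logK hK
  calc _ ≤ 4 * √(logK K) * l2 w * l2 w * l2 (grad (low K z))
        + 3 * K * (K⁻¹ * l2 w) * l2 w * l2 (grad (low K z)) := by
        refine (norm_add_le _ _).trans (add_le_add (h2.trans ?_) (h3.trans ?_)) <;> gcongr
    _ = 4 * √(logK K) * l2 w ^ 2 * l2 (grad (low K z))
        + 3 * 1 * l2 w ^ 2 * l2 (grad (low K z)) := by field_simp
    _ ≤ 4 * √(logK K) * l2 w ^ 2 * l2 (grad (low K z))
        + 3 * √(logK K) * l2 w ^ 2 * l2 (grad (low K z)) := by gcongr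
    _ = _ := by ring

lemma l2_grad_low_le_grad {α : (Fin 2 → ℤ) → ℂ} (h : H1 α) (K : ℝ) :
    l2 (grad (low K α)) ≤ l2 (grad α) := by
  rw [grad_low]; exact l2_low_le h.sq_grad K

lemma l2_grad_high_le_grad {α : (Fin 2 → ℤ) → ℂ} (h : H1 α) (K : ℝ) :
    l2 (grad (high K α)) ≤ l2 (grad α) := by
  rw [grad_high]; exact l2_high_le h.sq_grad K

/-- Conservation of enstrophy removes Pw from the second slot, and |Qw| ≤ K⁻¹|∇w| for the remainder;
this is where the factor K⁻¹ is gained over `norm_tri_low_le`. -/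
lemma abs_re_tri_low_le {w : (Fin 2 → ℤ) → ℂ} (hw : H1 w) (hr : IsReal w) {K : ℝ} (hK : 0 < K) :
    |(tri w w (low K w)).re| ≤ 7 * √(logK K) * K⁻¹ * l2 w * l2 (grad w) ^ 2 := by
  have hp := hw.low K
  have hq := hw.high K
  have h1 : tri w w (low K w) = tri (low K w) (high K w) (low K w)
      + tri (high K w) (high K w) (low K w) + tri w (low K w) (low K w) := by
    rw [← tri_add_fst hp hq hq.sq hp.sq_grad, low_add_high, add_comm,
      ← tri_add_snd hw hp.sq hq.sq hp.sq_grad, low_add_high]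
  rw [h1, Complex.add_re, re_tri_self hr, add_zero]
  have h2 := norm_tri_low_fst_le hw hq.sq hp.sq_grad hK
  have h3 := norm_tri_low_trd_le hq.sq hq.sq hw hK
  have h4 := l2_nonneg (grad (low K w))
  have h4' := l2_nonneg (grad w)
  have h5 := l2_nonneg w
  have h5' := l2_nonneg (high K w)
  have h6 := (l2_igrad_high_le hw.sq hK).trans
    (mul_le_mul_of_nonneg_left (l2_high_le hw.sq K) (inv_nonneg.mpr hK.le))
  have h7 := l2_low_le hw.sq K
  have h8 := one_le_sqrt_logK hK
  have h9 := (l2_high_le_grad hw hK).trans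
    (mul_le_mul_of_nonneg_left (l2_grad_high_le_grad hw K) (inv_nonneg.mpr hK.le))
  have h10 := l2_grad_low_le_grad hw K
  have h11 := inv_pos.mpr hK
  refine (Complex.abs_re_le_norm _).trans ?_
  calc _ ≤ 4 * √(logK K) * l2 w * (K⁻¹ * l2 (grad w)) * l2 (grad w)
        + 3 * K * (K⁻¹ * l2 w) * (K⁻¹ * l2 (grad w)) * l2 (grad w) := by
        refine (norm_add_le _ _).trans (add_le_add (h2.trans ?_) (h3.trans ?_)) <;> gcongr
    _ = 4 * √(logK K) * K⁻¹ * l2 w * l2 (grad w) ^ 2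
        + 3 * 1 * K⁻¹ * l2 w * l2 (grad w) ^ 2 := by field_simp
    _ ≤ 4 * √(logK K) * K⁻¹ * l2 w * l2 (grad w) ^ 2
        + 3 * √(logK K) * K⁻¹ * l2 w * l2 (grad w) ^ 2 := by gcongr
    _ = _ := by ring

/-! ### Low and high parts, sums and differences. -/

lemma l2_sq_eq_low_add_high {w : (Fin 2 → ℤ) → ℂ} (hw : Sq w) (K : ℝ) :
    l2 w ^ 2 = l2 (low K w) ^ 2 + l2 (high K w) ^ 2 := by
  rw [l2_sq, l2_sq, l2_sq, ← (hw.low K : Summable _).tsum_add (hw.high K)]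
  congr 1; funext k; simp only [low, high]; split_ifs <;> simp

lemma l2_sq_add_l2_sq {a b : (Fin 2 → ℤ) → ℂ} (ha : Sq a) (hb : Sq b) :
    l2 a ^ 2 + l2 b ^ 2 = (l2 (a + b) ^ 2 + l2 (a - b) ^ 2) / 2 := by
  rw [l2_sq, l2_sq, l2_sq, l2_sq, ← (ha : Summable _).tsum_add hb,
    ← (ha.add hb : Summable _).tsum_add (ha.sub hb), ← tsum_div_const]
  congr 1; funext k
  have := parallelogram_law_with_norm ℝ (a k) (b k)
  simp only [Pi.add_apply, Pi.sub_apply]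
  linarith

lemma low_add (K : ℝ) (a b : (Fin 2 → ℤ) → ℂ) : low K (a + b) = low K a + low K b := by
  funext k; simp only [low, Pi.add_apply]; split_ifs <;> simp

lemma low_sub (K : ℝ) (a b : (Fin 2 → ℤ) → ℂ) : low K (a - b) = low K a - low K b := by
  funext k; simp only [low, Pi.sub_apply]; split_ifs <;> simp

lemma sum_l2_low_sq {a b : (Fin 2 → ℤ) → ℂ} (ha : Sq a) (hb : Sq b) (K : ℝ) :
    l2 (low K a) ^ 2 + l2 (low K b) ^ 2
      = (l2 (low K (a + b)) ^ 2 + l2 (low K (a - b)) ^ 2) / 2 := by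
  rw [l2_sq_add_l2_sq (ha.low K) (hb.low K), low_add, low_sub]

/-- The cancellation behind the energy balance of the intertwinement. -/
lemma re_tri_balance {u w : (Fin 2 → ℤ) → ℂ} (hu : H1 u) (hw : H1 w) (ru : IsReal u)
    (rw' : IsReal w) (K : ℝ) :
    2 * (tri u u (high K u)).re + 2 * (tri w w (high K w)).re
      + ((tri u u (low K (u + w))).re + (tri w w (low K (u + w))).re)
      = (tri w w (low K (u - w))).re - (tri u u (low K (u - w))).re := by
  -- P(u + w) equals 2Pu - P(u - w) and also 2Pw + P(u - w), while Re tri(u, u, Qu) = -Re tri(u, u,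
  -- Pu), and likewise for w. Only the terms tested against P(u - w) survive.
  have e1 : low K (u + w) + low K (u - w) = low K u + low K u := by
    rw [← low_add, ← low_add]; congr 1; abel
  have e2 : low K w + low K w + low K (u - w) = low K (u + w) := by
    rw [← low_add, ← low_add]; congr 1; abel
  have k1 := tri_add_trd hu hu.sq ((hu.low K).sq_grad) ((hu.high K).sq_grad)
  have k2 := tri_add_trd hw hw.sq ((hw.low K).sq_grad) ((hw.high K).sq_grad)
  rw [low_add_high] at k1 k2
  have k3 := tri_add_trd hu hu.sq (((hu.add hw).low K).sq_grad) (((hu.sub hw).low K).sq_grad)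
  rw [e1, tri_add_trd hu hu.sq ((hu.low K).sq_grad) ((hu.low K).sq_grad)] at k3
  have k4 := tri_add_trd hw hw.sq (((hw.low K).add (hw.low K)).sq_grad)
    (((hu.sub hw).low K).sq_grad)
  rw [e2, tri_add_trd hw hw.sq ((hw.low K).sq_grad) ((hw.low K).sq_grad)] at k4
  have c1 := congrArg Complex.re k1
  have c2 := congrArg Complex.re k2
  have c3 := congrArg Complex.re k3
  have c4 := congrArg Complex.re k4
  rw [re_tri_self ru] at c1
  rw [re_tri_self rw'] at c2
  simp only [Complex.add_re] at c1 c2 c3 c4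
  linarith

section

/-! ### The vorticity formulation of the intertwinement -/

/-- The right hand side of the vorticity equation. -/
def vortRHS (ν K : ℝ) (M : Matrix (Fin 2) (Fin 2) ℝ) (w γ : Fin 2 → ℝ → (Fin 2 → ℤ) → ℂ)
    (i : Fin 2) (s : ℝ) : (Fin 2 → ℤ) → ℂ :=
  γ i s - (ν : ℂ) • lap (w i s)
    - (nonlin (w i s) (w i s) - ∑ j, (M i j : ℂ) • low K (nonlin (w j s) (w j s)))

/-- The vorticity formulation of the intertwinement, in terms of Fourier coefficients. -/
structure IsVorticity (ν K : ℝ) (M : Matrix (Fin 2) (Fin 2) ℝ)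
    (w γ : Fin 2 → ℝ → (Fin 2 → ℤ) → ℂ) : Prop where
  ae_H1 : ∀ᵐ s, 0 < s → ∀ i, H1 (w i s)
  sq : ∀ i t, 0 ≤ t → Sq (w i t)
  isReal : ∀ i t, 0 ≤ t → IsReal (w i t)
  intervalIntegrable : ∀ i k T, 0 ≤ T →
    IntervalIntegrable (fun s ↦ vortRHS ν K M w γ i s k) volume 0 T
  eq : ∀ i k t, 0 ≤ t → w i t k = w i 0 k + ∫ s in (0 : ℝ)..t, vortRHS ν K M w γ i s k
  finite : ∀ i j T, 0 ≤ T →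
    ∫⁻ s in Ioc 0 T, ∑' k, ENNReal.ofReal (‖w i s k‖ * ‖vortRHS ν K M w γ j s k‖) < ∞

variable {ν K : ℝ} {M : Matrix (Fin 2) (Fin 2) ℝ} {w γ : Fin 2 → ℝ → (Fin 2 → ℤ) → ℂ}

/-- Here χ is the mask of a Fourier projection and c a choice of sum, difference or single
component; all functionals below are instances. The mixed products in `IsVorticity.finite` are there
for the sums and differences. -/
lemma IsVorticity.isEvolution_comb (h : IsVorticity ν K M w γ) (χ : (Fin 2 → ℤ) → ℂ)
    (hχ : ∀ k, ‖χ k‖ ≤ 1) (c : Fin 2 → ℂ) (hc : ∀ i, ‖c i‖ ≤ 1) :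
    IsEvolution (fun t k ↦ χ k * (c 0 * w 0 t k + c 1 * w 1 t k))
      (fun t k ↦ χ k * (c 0 * vortRHS ν K M w γ 0 t k + c 1 * vortRHS ν K M w γ 1 t k)) where
  intervalIntegrable k T hT := (((h.intervalIntegrable 0 k T hT).const_mul (c 0)).add
    ((h.intervalIntegrable 1 k T hT).const_mul (c 1))).const_mul (χ k)
  eq k t ht := by
    rw [intervalIntegral.integral_const_mul, intervalIntegral.integral_add
      ((h.intervalIntegrable 0 k t ht).const_mul (c 0))
      ((h.intervalIntegrable 1 k t ht).const_mul (c 1)), intervalIntegral.integral_const_mul,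
      intervalIntegral.integral_const_mul, h.eq 0 k t ht, h.eq 1 k t ht]
    ring
  sq t ht := by
    refine (((h.sq 0 t ht).smul (c 0)).add ((h.sq 1 t ht).smul (c 1))).of_le fun k ↦ ?_
    rw [norm_mul]
    exact mul_le_of_le_one_left (norm_nonneg _) (hχ k)
  finite T hT := by
    have h00 := h.finite 0 0 T hT
    have h01 := h.finite 0 1 T hT
    have h10 := h.finite 1 0 T hT
    have h11 := h.finite 1 1 T hT
    have hwm : ∀ i k, AEStronglyMeasurable (fun s ↦ w i s k) (volume.restrict (Ioc 0 T)) := by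
      intro i k
      have := intervalIntegral.continuousOn_primitive_interval' (h.intervalIntegrable i k T hT)
        (left_mem_uIcc (a := (0 : ℝ)))
      rw [uIcc_of_le hT] at this
      have h2 : ContinuousOn (fun s ↦ w i s k) (Icc 0 T) :=
        (this.const_add (w i 0 k)).congr fun t ht ↦ h.eq i k t ht.1
      exact (h2.mono Ioc_subset_Icc_self).aestronglyMeasurable measurableSet_Ioc
    have hFm : ∀ i k, AEStronglyMeasurable (fun s ↦ vortRHS ν K M w γ i s k)
        (volume.restrict (Ioc 0 T)) := fun i k ↦ by
      have := h.intervalIntegrable i k T hT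
      rw [intervalIntegrable_iff, uIoc_of_le hT] at this
      exact this.1
    have hm : ∀ i j, AEMeasurable (fun s ↦ ∑' k, ENNReal.ofReal
        (‖w i s k‖ * ‖vortRHS ν K M w γ j s k‖)) (volume.restrict (Ioc 0 T)) := fun i j ↦
      AEMeasurable.tsum fun k ↦
        ((hwm i k).norm.aemeasurable.mul (hFm j k).norm.aemeasurable).ennreal_ofReal
    refine lt_of_le_of_lt (lintegral_mono (g := fun s ↦
      (((∑' k, ENNReal.ofReal (‖w 0 s k‖ * ‖vortRHS ν K M w γ 0 s k‖))
      + ∑' k, ENNReal.ofReal (‖w 0 s k‖ * ‖vortRHS ν K M w γ 1 s k‖))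
      + ∑' k, ENNReal.ofReal (‖w 1 s k‖ * ‖vortRHS ν K M w γ 0 s k‖))
      + ∑' k, ENNReal.ofReal (‖w 1 s k‖ * ‖vortRHS ν K M w γ 1 s k‖)) fun s ↦ ?_) ?_
    · simp only
      rw [← ENNReal.tsum_add, ← ENNReal.tsum_add, ← ENNReal.tsum_add]
      refine ENNReal.tsum_le_tsum fun k ↦ ?_
      rw [← ENNReal.ofReal_add (by positivity) (by positivity),
        ← ENNReal.ofReal_add (by positivity) (by positivity),
        ← ENNReal.ofReal_add (by positivity) (by positivity)]
      refine ENNReal.ofReal_le_ofReal ?_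
      have key : ∀ a b : ℂ, ‖χ k * (c 0 * a + c 1 * b)‖ ≤ ‖a‖ + ‖b‖ := fun a b ↦ by
        rw [norm_mul]
        refine (mul_le_of_le_one_left (norm_nonneg _) (hχ k)).trans ((norm_add_le _ _).trans ?_)
        rw [norm_mul, norm_mul]
        exact add_le_add (mul_le_of_le_one_left (norm_nonneg _) (hc 0))
          (mul_le_of_le_one_left (norm_nonneg _) (hc 1))
      refine (mul_le_mul (key _ _) (key _ _) (norm_nonneg _) (by positivity)).trans
        (le_of_eq (by ring))
    · rw [lintegral_add_left' (((hm 0 0).fun_add (hm 0 1)).fun_add (hm 1 0)),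
        lintegral_add_left' ((hm 0 0).fun_add (hm 0 1)), lintegral_add_left' (hm 0 0)]
      exact ENNReal.add_lt_top.mpr ⟨ENNReal.add_lt_top.mpr
        ⟨ENNReal.add_lt_top.mpr ⟨h00, h01⟩, h10⟩, h11⟩

/-- The indicator of `|k| ≤ K`. -/
def lowMask (K : ℝ) (k : Fin 2 → ℤ) : ℂ := if nrm k ≤ K then 1 else 0

/-- The indicator of `|k| > K`. -/
def highMask (K : ℝ) (k : Fin 2 → ℤ) : ℂ := if nrm k ≤ K then 0 else 1

lemma norm_lowMask (K : ℝ) (k : Fin 2 → ℤ) : ‖lowMask K k‖ ≤ 1 := by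
  unfold lowMask; split_ifs <;> simp

lemma norm_highMask (K : ℝ) (k : Fin 2 → ℤ) : ‖highMask K k‖ ≤ 1 := by
  unfold highMask; split_ifs <;> simp

lemma IsVorticity.isEvolution_low_sub (h : IsVorticity ν K M w γ) :
    IsEvolution (fun t ↦ low K (w 0 t - w 1 t))
      (fun t ↦ low K (vortRHS ν K M w γ 0 t - vortRHS ν K M w γ 1 t)) := by
  convert h.isEvolution_comb (lowMask K) (norm_lowMask K) ![1, -1]
    (by intro i; fin_cases i <;> simp) using 3
  all_goals
    simp only [low, lowMask, Pi.sub_apply]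
    split_ifs <;> simp [sub_eq_add_neg]

lemma IsVorticity.isEvolution_low_add (h : IsVorticity ν K M w γ) :
    IsEvolution (fun t ↦ low K (w 0 t + w 1 t))
      (fun t ↦ low K (vortRHS ν K M w γ 0 t + vortRHS ν K M w γ 1 t)) := by
  convert h.isEvolution_comb (lowMask K) (norm_lowMask K) ![1, 1]
    (by intro i; fin_cases i <;> simp) using 3
  all_goals
    simp only [low, lowMask, Pi.add_apply]
    split_ifs <;> simp

lemma IsVorticity.isEvolution_high (h : IsVorticity ν K M w γ) (i : Fin 2) :
    IsEvolution (fun t ↦ high K (w i t)) (fun t ↦ high K (vortRHS ν K M w γ i t)) := by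
  convert h.isEvolution_comb (highMask K) (norm_highMask K) (Pi.single i 1)
    (by intro j; fin_cases i <;> fin_cases j <;> simp) using 3
  all_goals
    simp only [high, highMask]
    fin_cases i <;> split_ifs <;> simp

lemma IsVorticity.isEvolution (h : IsVorticity ν K M w γ) (i : Fin 2) :
    IsEvolution (w i) (vortRHS ν K M w γ i) := by
  convert h.isEvolution_comb 1 (by simp) (Pi.single i 1)
    (by intro j; fin_cases i <;> fin_cases j <;> simp) using 3
  all_goals
    fin_cases i <;> simp

/-! ### The individual balances -/

lemma vortRHS_apply (i : Fin 2) (s : ℝ) (k : Fin 2 → ℤ) :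
    vortRHS ν K M w γ i s k = γ i s k - ν * lap (w i s) k - (nonlin (w i s) (w i s) k
      - (M i 0 * low K (nonlin (w 0 s) (w 0 s)) k + M i 1 * low K (nonlin (w 1 s) (w 1 s)) k)) := by
  simp [vortRHS, Fin.sum_univ_two]

/-- Each low nonlinearity enters with coefficient ±(θ₁ + θ₂ - 1) = 0: the low modes of the
difference obey a linear heat equation. The trailing 0 fits the shape of `rate_le`. -/
lemma low_vortRHS_sub {θ₁ θ₂ : ℝ} (hθ : θ₁ + θ₂ = 1) (s : ℝ) :
    low K (vortRHS ν K (symMatrix θ₁ θ₂) w γ 0 s - vortRHS ν K (symMatrix θ₁ θ₂) w γ 1 s)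
      = low K (γ 0 s - γ 1 s) - (ν : ℂ) • lap (low K (w 0 s - w 1 s)) - 0 := by
  have h1 : (θ₁ : ℂ) = 1 - θ₂ := by rw [← Complex.ofReal_one, ← hθ]; push_cast; ring
  funext k
  simp only [low, vortRHS_apply, lap, symMatrix, Pi.sub_apply, Pi.smul_apply,
    smul_eq_mul, Pi.zero_apply, Matrix.of_apply, Matrix.cons_val', Matrix.cons_val_zero,
    Matrix.cons_val_one, Matrix.cons_val_fin_one]
  split_ifs
  · push_cast; rw [h1]; ring
  · simp

/-- Each low nonlinearity enters with coefficient -1 + θ₁ - θ₂ = -2θ₂. -/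
lemma low_vortRHS_add {θ₁ θ₂ : ℝ} (hθ : θ₁ + θ₂ = 1) (s : ℝ) :
    low K (vortRHS ν K (symMatrix θ₁ θ₂) w γ 0 s + vortRHS ν K (symMatrix θ₁ θ₂) w γ 1 s)
      = low K (γ 0 s + γ 1 s) - (ν : ℂ) • lap (low K (w 0 s + w 1 s))
        - ((2 * θ₂ : ℝ) : ℂ) • low K (nonlin (w 0 s) (w 0 s) + nonlin (w 1 s) (w 1 s)) := by
  have h1 : (θ₁ : ℂ) = 1 - θ₂ := by rw [← Complex.ofReal_one, ← hθ]; push_cast; ring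
  funext k
  simp only [low, vortRHS_apply, lap, symMatrix, Pi.sub_apply, Pi.add_apply, Pi.smul_apply,
    smul_eq_mul, Matrix.of_apply, Matrix.cons_val',
    Matrix.cons_val_zero, Matrix.cons_val_one, Matrix.cons_val_fin_one]
  split_ifs
  · push_cast; rw [h1]; ring
  · simp

lemma high_vortRHS (i : Fin 2) (s : ℝ) :
    high K (vortRHS ν K M w γ i s)
      = high K (γ i s) - (ν : ℂ) • lap (high K (w i s)) - high K (nonlin (w i s) (w i s)) := by
  funext k
  simp only [high, low, vortRHS_apply, lap, Pi.sub_apply, Pi.smul_apply, smul_eq_mul]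
  split_ifs <;> simp

lemma igrad_low (K : ℝ) (α : (Fin 2 → ℤ) → ℂ) : igrad (low K α) = low K (igrad α) := by
  funext k; simp only [igrad, low]; split_ifs <;> simp

lemma igrad_high (K : ℝ) (α : (Fin 2 → ℤ) → ℂ) : igrad (high K α) = high K (igrad α) := by
  funext k; simp only [igrad, high]; split_ifs <;> simp

lemma igrad_add (a b : (Fin 2 → ℤ) → ℂ) : igrad (a + b) = igrad a + igrad b := by
  funext k; simp [igrad, mul_add]

lemma igrad_sub (a b : (Fin 2 → ℤ) → ℂ) : igrad (a - b) = igrad a - igrad b := by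
  funext k; simp [igrad, mul_sub]

lemma l2_add_le {a b : (Fin 2 → ℤ) → ℂ} (ha : Sq a) (hb : Sq b) : l2 (a + b) ≤ l2 a + l2 b := by
  refine le_of_sq_le_sq ?_ (add_nonneg (l2_nonneg a) (l2_nonneg b))
  have h1 := summable_norm_mul ha hb
  have h2 := tsum_norm_mul_le ha hb
  have h3 : Summable fun k ↦ ‖a k‖ ^ 2 + ‖b k‖ ^ 2 + 2 * (‖a k‖ * ‖b k‖) :=
    (Summable.add ha hb).add (h1.mul_left 2)
  calc l2 (a + b) ^ 2 ≤ ∑' k, (‖a k‖ ^ 2 + ‖b k‖ ^ 2 + 2 * (‖a k‖ * ‖b k‖)) := by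
        rw [l2_sq]
        refine (ha.add hb : Summable _).tsum_le_tsum (fun k ↦ ?_) h3
        have := pow_le_pow_left₀ (norm_nonneg _) (norm_add_le (a k) (b k)) 2
        simp only [Pi.add_apply]
        nlinarith
    _ = l2 a ^ 2 + l2 b ^ 2 + 2 * ∑' k, ‖a k‖ * ‖b k‖ := by
        rw [Summable.tsum_add (Summable.add ha hb) (h1.mul_left 2), Summable.tsum_add ha hb,
          tsum_mul_left, l2_sq, l2_sq]
    _ ≤ _ := by nlinarith

/-- The energy dissipation rate of `z`. -/
def rate (z Z : (Fin 2 → ℤ) → ℂ) : ℝ := ∑' k, 2 * (Z k * conj (z k)).re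

lemma rate_low_sub_le {θ₁ θ₂ : ℝ} (hθ : θ₁ + θ₂ = 1) {s : ℝ} (hw : ∀ i, H1 (w i s))
    (hγ : ∀ i, Sq (igrad (γ i s))) :
    rate (low K (w 0 s - w 1 s))
      (low K (vortRHS ν K (symMatrix θ₁ θ₂) w γ 0 s - vortRHS ν K (symMatrix θ₁ θ₂) w γ 1 s))
    ≤ 2 * (l2 (igrad (γ 0 s - γ 1 s)) * l2 (grad (low K (w 0 s - w 1 s))))
      - 2 * ν * l2 (grad (low K (w 0 s - w 1 s))) ^ 2 := by
  have hg : Sq (igrad (γ 0 s - γ 1 s)) := by rw [igrad_sub]; exact (hγ 0).sub (hγ 1)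
  have hz := ((hw 0).sub (hw 1)).low K
  have h := rate_le (low_vortRHS_sub (ν := ν) hθ s) (by rw [igrad_low]; exact hg.low K) hz
    (n := 0) (by simp [Pairs, summable_zero])
  have h0 : pair 0 (low K (w 0 s - w 1 s)) = 0 := by simp [pair]
  rw [h0] at h
  have h2 : l2 (igrad (low K (γ 0 s - γ 1 s))) ≤ l2 (igrad (γ 0 s - γ 1 s)) := by
    rw [igrad_low]; exact l2_low_le hg K
  have h3 := mul_le_mul_of_nonneg_right h2 (l2_nonneg (grad (low K (w 0 s - w 1 s))))
  simp only [Complex.zero_re, mul_zero, sub_zero] at h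
  unfold rate
  linarith

lemma rate_low_add_le {θ₁ θ₂ : ℝ} (hθ : θ₁ + θ₂ = 1) {s : ℝ} (hw : ∀ i, H1 (w i s))
    (hγ : ∀ i, Sq (igrad (γ i s))) :
    rate (low K (w 0 s + w 1 s))
      (low K (vortRHS ν K (symMatrix θ₁ θ₂) w γ 0 s + vortRHS ν K (symMatrix θ₁ θ₂) w γ 1 s))
    ≤ 2 * ((l2 (igrad (γ 0 s)) + l2 (igrad (γ 1 s))) * l2 (grad (low K (w 0 s + w 1 s))))
      - 2 * ν * l2 (grad (low K (w 0 s + w 1 s))) ^ 2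
      - 4 * θ₂ * ((tri (w 0 s) (w 0 s) (low K (w 0 s + w 1 s))).re
        + (tri (w 1 s) (w 1 s) (low K (w 0 s + w 1 s))).re) := by
  have hg : Sq (igrad (γ 0 s + γ 1 s)) := by rw [igrad_add]; exact (hγ 0).add (hγ 1)
  have hz := ((hw 0).add (hw 1)).low K
  have hn0 := pairs_nonlin (hw 0) (hw 0).sq hz
  have hn1 := pairs_nonlin (hw 1) (hw 1).sq hz
  have hn : Pairs (((2 * θ₂ : ℝ) : ℂ) •
      low K (nonlin (w 0 s) (w 0 s) + nonlin (w 1 s) (w 1 s))) (low K (w 0 s + w 1 s)) :=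
    ((hn0.add hn1).of_le (norm_low_le K _)).smul _
  have h := rate_le (low_vortRHS_add (ν := ν) hθ s) (by rw [igrad_low]; exact hg.low K) hz hn
  rw [pair_smul, pair_low, low_low, pair_add hn0 hn1, pair_nonlin (hw 0) (hw 0).sq hz,
    pair_nonlin (hw 1) (hw 1).sq hz, Complex.re_ofReal_mul, Complex.add_re] at h
  have h2 : l2 (igrad (low K (γ 0 s + γ 1 s))) ≤ l2 (igrad (γ 0 s)) + l2 (igrad (γ 1 s)) := by
    rw [igrad_low]
    refine (l2_low_le hg K).trans ?_
    rw [igrad_add]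
    exact l2_add_le (hγ 0) (hγ 1)
  have h3 := mul_le_mul_of_nonneg_right h2 (l2_nonneg (grad (low K (w 0 s + w 1 s))))
  unfold rate
  linarith

lemma rate_high_le (i : Fin 2) {s : ℝ} (hw : ∀ i, H1 (w i s)) (hγ : ∀ i, Sq (igrad (γ i s))) :
    rate (high K (w i s)) (high K (vortRHS ν K M w γ i s))
    ≤ 2 * (l2 (igrad (γ i s)) * l2 (grad (high K (w i s))))
      - 2 * ν * l2 (grad (high K (w i s))) ^ 2
      - 2 * (tri (w i s) (w i s) (high K (w i s))).re := by
  have hz := (hw i).high K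
  have hn := pairs_nonlin (hw i) (hw i).sq hz
  have h := rate_le (high_vortRHS (ν := ν) (M := M) i s) (by rw [igrad_high]; exact (hγ i).high K) hz
    (hn.of_le (norm_high_le K _))
  rw [pair_high, high_high, pair_nonlin (hw i) (hw i).sq hz] at h
  have h2 : l2 (igrad (high K (γ i s))) ≤ l2 (igrad (γ i s)) := by
    rw [igrad_high]; exact l2_high_le (hγ i) K
  have h3 := mul_le_mul_of_nonneg_right h2 (l2_nonneg (grad (high K (w i s))))
  unfold rate
  linarith

/-- Tested against the whole of wᵢ, the Navier-Stokes nonlinearity drops out and only the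
intertwining terms are left. -/
lemma rate_vort_le (i : Fin 2) {s : ℝ} (hw : ∀ i, H1 (w i s)) (hr : ∀ i, IsReal (w i s))
    (hγ : ∀ i, Sq (igrad (γ i s))) :
    rate (w i s) (vortRHS ν K M w γ i s)
    ≤ 2 * (l2 (igrad (γ i s)) * l2 (grad (w i s))) - 2 * ν * l2 (grad (w i s)) ^ 2
      + 2 * ∑ j, M i j * (tri (w j s) (w j s) (low K (w i s))).re := by
  have hn : ∀ j, Pairs (nonlin (w j s) (w j s)) (w i s) := fun j ↦
    pairs_nonlin (hw j) (hw j).sq (hw i)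
  have hl : ∀ j, Pairs ((M i j : ℂ) • low K (nonlin (w j s) (w j s))) (w i s) := fun j ↦
    ((hn j).of_le (norm_low_le K _)).smul _
  have hsum : Pairs (∑ j, (M i j : ℂ) • low K (nonlin (w j s) (w j s))) (w i s) := by
    rw [Fin.sum_univ_two]; exact (hl 0).add (hl 1)
  have hp : ∀ j, pair ((M i j : ℂ) • low K (nonlin (w j s) (w j s))) (w i s)
      = M i j * tri (w j s) (w j s) (low K (w i s)) := fun j ↦ by
    rw [pair_smul, pair_low, pair_nonlin (hw j) (hw j).sq ((hw i).low K)]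
  have h := rate_le (z := w i s) (Z := vortRHS ν K M w γ i s) rfl (hγ i) (hw i)
    ((hn i).sub hsum)
  rw [pair_sub (hn i) hsum, pair_nonlin (hw i) (hw i).sq (hw i), Complex.sub_re,
    re_tri_self (hr i), Fin.sum_univ_two, pair_add (hl 0) (hl 1), hp, hp, Complex.add_re,
    Complex.re_ofReal_mul, Complex.re_ofReal_mul] at h
  rw [Fin.sum_univ_two]
  unfold rate
  linarith

end

/-! ### The case 0 ≤ θ₂ ≤ 1. -/

section

variable {ν K θ₁ θ₂ : ℝ} {w γ : Fin 2 → ℝ → (Fin 2 → ℤ) → ℂ}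

/-- A uniform bound, for almost every positive time, on the size of the forces. -/
def ForceBound (γ : Fin 2 → ℝ → (Fin 2 → ℤ) → ℂ) (Γ : Fin 2 → ℝ) : Prop :=
  ∀ᵐ s, 0 < s → ∀ i, Sq (igrad (γ i s)) ∧ l2 (igrad (γ i s)) ≤ Γ i

lemma exists_time_of_eventually {p : ℝ → Prop} (h : ∀ᶠ t in atTop, p t) (c : ℝ) :
    ∃ T, c ≤ T ∧ ∀ t, T ≤ t → p t := by
  obtain ⟨T, hT⟩ := eventually_atTop.mp h
  exact ⟨max c T, le_max_left _ _, fun t ht ↦ hT t ((le_max_right _ _).trans ht)⟩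

/-- A dissipative linear equation whose force tends to zero: half of the dissipation absorbs the
force and the other half yields exponential decay, by Poincaré's inequality. -/
theorem IsVorticity.eventually_low_sub_le (h : IsVorticity ν K (symMatrix θ₁ θ₂) w γ)
    (hθ : θ₁ + θ₂ = 1) (hν : 0 < ν) {Γ : Fin 2 → ℝ} (hγ : ForceBound γ Γ)
    (hs : ∀ η, 0 < η → ∃ T, 0 ≤ T ∧ ∀ᵐ s, T < s → l2 (igrad (γ 0 s - γ 1 s)) ≤ η)
    {η : ℝ} (hη : 0 < η) : ∀ᶠ t in atTop, l2 (low K (w 0 t - w 1 t)) ^ 2 ≤ η := by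
  obtain ⟨T, hT, hT'⟩ := hs (√(ν ^ 2 * (η / 2))) (by positivity)
  have hrate := h.isEvolution_low_sub.hasRate
  have := hrate.eventually_le hT hν (b := ν * (η / 2)) (by positivity) ?_ (half_pos hη)
  · filter_upwards [this] with t ht
    refine ht.trans (le_of_eq ?_)
    field_simp
    ring
  · filter_upwards [hT', hγ, h.ae_H1] with s h1 h2 h3 hsT
    have hs0 : 0 < s := lt_of_le_of_lt hT hsT
    have hw := h3 hs0
    have h4 := rate_low_sub_le (K := K) (ν := ν) (w := w) hθ hw fun i ↦ (h2 hs0 i).1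
    have h5 := h1 hsT
    have hz := ((hw 0).sub (hw 1)).low K
    have h6 := hz.l2_le_grad
    set G := l2 (grad (low K (w 0 s - w 1 s)))
    set g := l2 (igrad (γ 0 s - γ 1 s))
    have hg : g ^ 2 ≤ ν ^ 2 * (η / 2) := by
      calc g ^ 2 ≤ √(ν ^ 2 * (η / 2)) ^ 2 := pow_le_pow_left₀ (l2_nonneg _) h5 2
        _ = _ := Real.sq_sqrt (by positivity)
    have h7 : l2 (low K (w 0 s - w 1 s)) ^ 2 ≤ G ^ 2 := pow_le_pow_left₀ (l2_nonneg _) h6 2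
    have h8 : 2 * (g * G) ≤ ν * G ^ 2 + g ^ 2 / ν := by
      have : ν * G ^ 2 + g ^ 2 / ν - 2 * (g * G) = (ν * G - g) ^ 2 / ν := by field_simp; ring
      have h9 : 0 ≤ (ν * G - g) ^ 2 / ν := by positivity
      linarith
    have h9 : g ^ 2 / ν ≤ ν * (η / 2) := by
      rw [div_le_iff₀ hν]; linarith
    change rate _ _ ≤ _
    have h10 := mul_le_mul_of_nonneg_left h7 hν.le
    linarith

lemma young_le {ν a x : ℝ} (hν : 0 < ν) (c : ℝ) (hc : 0 < c) :
    2 * (a * x) ≤ c * ν * x ^ 2 + a ^ 2 / (c * ν) := by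
  have hcν : 0 < c * ν := mul_pos hc hν
  have : c * ν * x ^ 2 + a ^ 2 / (c * ν) - 2 * (a * x) = (c * ν * x - a) ^ 2 / (c * ν) := by
    field_simp; ring
  have h9 : 0 ≤ (c * ν * x - a) ^ 2 / (c * ν) := by positivity
  linarith

set_option maxHeartbeats 800000 in
-- The weight 4θ₂ on the high modes is forced by `re_tri_balance`: the cubic terms of the weighted
-- energy are then -4θ₂ times its left side, hence small once P(w₀ - w₁) is small. The weight may
-- degenerate, but every high-mode term carries the same factor.
theorem IsVorticity.eventually_low_add_le (h : IsVorticity ν K (symMatrix θ₁ θ₂) w γ)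
    (hθ : θ₁ + θ₂ = 1) (h0 : 0 ≤ θ₂) (h1 : θ₂ ≤ 1) (hν : 0 < ν) (hK : 0 < K) {Γ : Fin 2 → ℝ}
    (hγ : ForceBound γ Γ) (hδ : ∀ η, 0 < η → ∀ᶠ t in atTop, l2 (low K (w 0 t - w 1 t)) ^ 2 ≤ η)
    {η : ℝ} (hη : 0 < η) :
    ∀ᶠ t in atTop, l2 (low K (w 0 t + w 1 t)) ^ 2 ≤ 12 * (Γ 0 ^ 2 + Γ 1 ^ 2) / ν ^ 2 + η := by
  have hr := ((h.isEvolution_high 0).hasRate.add (h.isEvolution_high 1).hasRate).const_mul (4 * θ₂)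
    |>.add h.isEvolution_low_add.hasRate
  have hL := one_le_sqrt_logK hK
  obtain ⟨κ, hκ⟩ : ∃ κ, κ = 7 * √(logK K) * K := ⟨_, rfl⟩
  have hκ0 : 0 < κ := by rw [hκ]; positivity
  -- The first entry of the minimum makes the additive error at most η/2; the second makes the cubic
  -- terms, of coefficient κ times the low difference, at most an eighth of the dissipation.
  obtain ⟨T, hT, hT'⟩ := exists_time_of_eventually
    (hδ (min (η / 2) ((ν / (8 * κ)) ^ 2)) (by positivity)) 0
  have := hr.eventually_le hT hν
    (b := 12 * (Γ 0 ^ 2 + Γ 1 ^ 2) / ν + ν * (η / 2)) (by positivity) ?_ (half_pos hη)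
  · filter_upwards [this] with t ht
    have h3 : 0 ≤ 4 * θ₂ * (l2 (high K (w 0 t)) ^ 2 + l2 (high K (w 1 t)) ^ 2) := by positivity
    have h4 : (12 * (Γ 0 ^ 2 + Γ 1 ^ 2) / ν + ν * (η / 2)) / ν
        = 12 * (Γ 0 ^ 2 + Γ 1 ^ 2) / ν ^ 2 + η / 2 := by field_simp
    rw [h4] at ht
    linarith
  · filter_upwards [hγ, h.ae_H1] with s h2 h3 hsT
    have hs0 : 0 < s := lt_of_le_of_lt hT hsT
    have hw := h3 hs0
    have hre : ∀ i, IsReal (w i s) := fun i ↦ h.isReal i s hs0.le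
    have hg := h2 hs0
    have a0 := rate_high_le (K := K) (ν := ν) (w := w) (M := symMatrix θ₁ θ₂) 0 hw
      fun i ↦ (hg i).1
    have a1 := rate_high_le (K := K) (ν := ν) (w := w) (M := symMatrix θ₁ θ₂) 1 hw
      fun i ↦ (hg i).1
    have a2 := rate_low_add_le (K := K) (ν := ν) (w := w) hθ hw fun i ↦ (hg i).1
    have bal := re_tri_balance (hw 0) (hw 1) (hre 0) (hre 1) K
    have t0 := norm_tri_low_le (hw 0) ((hw 0).sub (hw 1)) hK
    have t1 := norm_tri_low_le (hw 1) ((hw 0).sub (hw 1)) hK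
    have t0' := (abs_le.mp ((Complex.abs_re_le_norm _).trans t0)).2
    have t1' := (abs_le.mp ((Complex.abs_re_le_norm _).trans t1)).1
    have hgl := l2_grad_low_le ((hw 0).sub (hw 1)).sq hK
    have hd := hT' s hsT.le
    have e0 := l2_sq_eq_low_add_high (hw 0).sq K
    have e1 := l2_sq_eq_low_add_high (hw 1).sq K
    have e2 := sum_l2_low_sq (hw 0).sq (hw 1).sq K
    have p0 := pow_le_pow_left₀ (l2_nonneg _) ((hw 0).high K).l2_le_grad 2
    have p1 := pow_le_pow_left₀ (l2_nonneg _) ((hw 1).high K).l2_le_grad 2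
    have p2 := pow_le_pow_left₀ (l2_nonneg _) (((hw 0).add (hw 1)).low K).l2_le_grad 2
    have g0 := (hg 0).2
    have g1 := (hg 1).2
    have g0' := pow_le_pow_left₀ (l2_nonneg _) g0 2
    have g1' := pow_le_pow_left₀ (l2_nonneg _) g1 2
    have n0 := l2_nonneg (igrad (γ 0 s))
    have n1 := l2_nonneg (igrad (γ 1 s))
    have nd := l2_nonneg (low K (w 0 s - w 1 s))
    change 4 * θ₂ * (rate _ _ + rate _ _) + rate _ _ ≤ _
    set r0 := rate (high K (w 0 s)) (high K (vortRHS ν K (symMatrix θ₁ θ₂) w γ 0 s))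
    set r1 := rate (high K (w 1 s)) (high K (vortRHS ν K (symMatrix θ₁ θ₂) w γ 1 s))
    set r2 := rate (low K (w 0 s + w 1 s))
      (low K (vortRHS ν K (symMatrix θ₁ θ₂) w γ 0 s + vortRHS ν K (symMatrix θ₁ θ₂) w γ 1 s))
    set G0 := l2 (grad (high K (w 0 s)))
    set G1 := l2 (grad (high K (w 1 s)))
    set S := l2 (grad (low K (w 0 s + w 1 s)))
    set b0 := l2 (igrad (γ 0 s))
    set b1 := l2 (igrad (γ 1 s))
    set d := l2 (low K (w 0 s - w 1 s))
    set x0 := (tri (w 0 s) (w 0 s) (high K (w 0 s))).re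
    set x1 := (tri (w 1 s) (w 1 s) (high K (w 1 s))).re
    set y0 := (tri (w 0 s) (w 0 s) (low K (w 0 s + w 1 s))).re
    set y1 := (tri (w 1 s) (w 1 s) (low K (w 0 s + w 1 s))).re
    set z0 := (tri (w 0 s) (w 0 s) (low K (w 0 s - w 1 s))).re
    set z1 := (tri (w 1 s) (w 1 s) (low K (w 0 s - w 1 s))).re
    set D := l2 (grad (low K (w 0 s - w 1 s)))
    have hD0 : 0 ≤ D := l2_nonneg _
    -- the smallness of the difference of the low modes
    have hκd : κ * d ≤ ν / 8 := by
      have h5 : d ^ 2 ≤ (ν / (8 * κ)) ^ 2 := hd.trans (min_le_right _ _)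
      have h6 := abs_le_of_sq_le_sq h5 (by positivity)
      rw [abs_of_nonneg nd] at h6
      calc κ * d ≤ κ * (ν / (8 * κ)) := by gcongr
        _ = ν / 8 := by field_simp
    have hX : l2 (w 0 s) ^ 2 + l2 (w 1 s) ^ 2 ≤ G0 ^ 2 + G1 ^ 2 + (S ^ 2 + d ^ 2) / 2 := by
      linarith only [e0, e1, e2, p0, p1, p2]
    have hnl : z0 ≤ ν / 8 * l2 (w 0 s) ^ 2 ∧ -(ν / 8 * l2 (w 1 s) ^ 2) ≤ z1 := by
      have hb : ∀ i, 7 * √(logK K) * l2 (w i s) ^ 2 * D ≤ ν / 8 * l2 (w i s) ^ 2 := fun i ↦ by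
        calc 7 * √(logK K) * l2 (w i s) ^ 2 * D
            ≤ 7 * √(logK K) * l2 (w i s) ^ 2 * (K * d) := by gcongr
          _ = κ * d * l2 (w i s) ^ 2 := by rw [hκ]; ring
          _ ≤ _ := by gcongr
      exact ⟨by linarith only [hb 0, t0'], by linarith only [hb 1, t1']⟩
    have hdη : d ^ 2 ≤ η / 2 := hd.trans (min_le_left _ _)
    have y00 := young_le (a := b0) (x := G0) hν (1 / 2) (by norm_num)
    have y11 := young_le (a := b1) (x := G1) hν (1 / 2) (by norm_num)
    have y22 := young_le (a := b0 + b1) (x := S) hν (1 / 2) (by norm_num)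
    have hsplit : ∀ a : ℝ, a / (1 / 2 * ν) = 2 * a / ν := fun a ↦ by field_simp
    rw [hsplit] at y00 y11 y22
    have q0 : 2 * b0 ^ 2 / ν ≤ 2 * Γ 0 ^ 2 / ν := by gcongr
    have q1 : 2 * b1 ^ 2 / ν ≤ 2 * Γ 1 ^ 2 / ν := by gcongr
    have q2 : 2 * (b0 + b1) ^ 2 / ν ≤ 2 * (2 * (Γ 0 ^ 2 + Γ 1 ^ 2)) / ν := by
      gcongr
      linarith only [g0', g1', sq_nonneg (b0 - b1), (by ring : (b0 + b1) ^ 2 + (b0 - b1) ^ 2 = 2 * b0 ^ 2 + 2 * b1 ^ 2)]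
    have hsum : 12 * (Γ 0 ^ 2 + Γ 1 ^ 2) / ν
        = 4 * (2 * Γ 0 ^ 2 / ν + 2 * Γ 1 ^ 2 / ν) + 2 * (2 * (Γ 0 ^ 2 + Γ 1 ^ 2)) / ν := by
      field_simp; ring
    have hΓ : 0 ≤ 2 * Γ 0 ^ 2 / ν + 2 * Γ 1 ^ 2 / ν := by positivity
    -- the balance of the weighted energy
    have hA : r0 + r1 ≤ (2 * Γ 0 ^ 2 / ν + 2 * Γ 1 ^ 2 / ν) - 3 / 2 * ν * (G0 ^ 2 + G1 ^ 2)
        - 2 * (x0 + x1) := by linarith only [a0, a1, y00, y11, q0, q1]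
    have hB : r2 ≤ 2 * (2 * (Γ 0 ^ 2 + Γ 1 ^ 2)) / ν - 3 / 2 * ν * S ^ 2 - 4 * θ₂ * (y0 + y1) := by
      linarith only [a2, y22, q2]
    have hC : -2 * (x0 + x1) - (y0 + y1) ≤ ν / 8 * (G0 ^ 2 + G1 ^ 2 + (S ^ 2 + d ^ 2) / 2) := by
      have := mul_le_mul_of_nonneg_left hX (show 0 ≤ ν / 8 by positivity)
      linarith only [this, hnl.1, hnl.2, bal]
    have hE : r0 + r1 - (y0 + y1) ≤ (2 * Γ 0 ^ 2 / ν + 2 * Γ 1 ^ 2 / ν) - ν * (G0 ^ 2 + G1 ^ 2)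
        + ν / 16 * (S ^ 2 + d ^ 2) := by
      have : 0 ≤ ν * (G0 ^ 2 + G1 ^ 2) := by positivity
      linarith only [this, hA, hC]
    have hF := mul_le_mul_of_nonneg_left hE (show 0 ≤ 4 * θ₂ by positivity)
    have hG : 4 * θ₂ * (2 * Γ 0 ^ 2 / ν + 2 * Γ 1 ^ 2 / ν)
        ≤ 4 * (2 * Γ 0 ^ 2 / ν + 2 * Γ 1 ^ 2 / ν) := by gcongr; linarith
    have hH : 4 * θ₂ * (ν / 16 * (S ^ 2 + d ^ 2)) ≤ 4 * (ν / 16 * (S ^ 2 + d ^ 2)) := by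
      gcongr; linarith
    have hI : 4 * θ₂ * (ν * (l2 (high K (w 0 s)) ^ 2 + l2 (high K (w 1 s)) ^ 2))
        ≤ 4 * θ₂ * (ν * (G0 ^ 2 + G1 ^ 2)) := by gcongr
    have hJ : ν * l2 (low K (w 0 s + w 1 s)) ^ 2 ≤ ν * S ^ 2 := by gcongr
    have hM : ν * d ^ 2 ≤ ν * (η / 2) := by gcongr
    have hN : 0 ≤ ν * S ^ 2 := by positivity
    have hN' : 0 ≤ ν * d ^ 2 := by positivity
    linarith only [hF, hB, hG, hH, hI, hJ, hM, hN, hN', hsum]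

/-- With the low modes bounded by P, the cubic term has a part quadratic in the high gradient,
absorbed because 12P ≤ νK, and a part linear in it, which acts like a force of size √L P². -/
theorem IsVorticity.eventually_high_le (h : IsVorticity ν K (symMatrix θ₁ θ₂) w γ)
    (hν : 0 < ν) (hK : 0 < K) {Γ : Fin 2 → ℝ} (hγ : ForceBound γ Γ) {P : ℝ}
    (hPK : 12 * P ≤ ν * K) (i : Fin 2) (hp : ∀ᶠ t in atTop, l2 (low K (w i t)) ≤ P)
    {η : ℝ} (hη : 0 < η) :
    ∀ᶠ t in atTop, l2 (high K (w i t)) ^ 2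
      ≤ 4 * Γ i ^ 2 / ν ^ 2 + 64 * logK K * P ^ 4 / (ν ^ 2 * K ^ 2) + η := by
  have hr := (h.isEvolution_high i).hasRate
  have hL := one_le_sqrt_logK hK
  have hL' := one_le_logK hK
  obtain ⟨T, hT, hT'⟩ := exists_time_of_eventually hp 0
  have hm1 : 1 ≤ max 1 (K ^ 2) := le_max_left _ _
  have hm2 : K ^ 2 ≤ max 1 (K ^ 2) := le_max_right _ _
  -- The decay rate on the high modes is at least νK², and at least ν when K < 1. The force is
  -- divided by the second rate, the cubic source by the first.
  have := hr.eventually_le hT (a := ν * max 1 (K ^ 2)) (by positivity)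
    (b := 4 * Γ i ^ 2 / ν + 64 * logK K * P ^ 4 / ν) (by positivity) ?_ hη
  · filter_upwards [this] with t ht
    refine ht.trans (add_le_add_left ?_ η)
    rw [add_div]
    have m1 : ν ^ 2 ≤ ν * (ν * max 1 (K ^ 2)) := by
      have := mul_le_mul_of_nonneg_left hm1 (sq_nonneg ν)
      linarith
    have m2 : ν ^ 2 * K ^ 2 ≤ ν * (ν * max 1 (K ^ 2)) := by
      have := mul_le_mul_of_nonneg_left hm2 (sq_nonneg ν)
      linarith
    rw [div_div, div_div]
    exact add_le_add (div_le_div_of_nonneg_left (by positivity) (by positivity) m1)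
      (div_le_div_of_nonneg_left (by positivity) (by positivity) m2)
  · filter_upwards [hγ, h.ae_H1] with s h2 h3 hsT
    have hs0 : 0 < s := lt_of_le_of_lt hT hsT
    have hw := h3 hs0
    have hg := h2 hs0
    have a0 := rate_high_le (K := K) (ν := ν) (w := w) (M := symMatrix θ₁ θ₂) i hw
      fun i ↦ (hg i).1
    have b0 := (abs_le.mp (abs_re_tri_high_le (hw i) (h.isReal i s hs0.le) hK)).1
    have hps := hT' s hsT.le
    have hp0 := l2_nonneg (low K (w i s))
    have g1 := (hg i).2
    have g0 := l2_nonneg (igrad (γ i s))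
    have hG0 := l2_nonneg (grad (high K (w i s)))
    have d1 := pow_le_pow_left₀ (l2_nonneg _) ((hw i).high K).l2_le_grad 2
    have d2 := pow_le_pow_left₀ (l2_nonneg _) (l2_high_le_grad (hw i) hK) 2
    change rate _ _ ≤ _
    set r := rate (high K (w i s)) (high K (vortRHS ν K (symMatrix θ₁ θ₂) w γ i s))
    set G := l2 (grad (high K (w i s)))
    set p := l2 (low K (w i s))
    set b := l2 (igrad (γ i s))
    set q := l2 (high K (w i s))
    have c1 : 4 * √(logK K) * p ^ 2 * G ≤ 4 * √(logK K) * P ^ 2 * G := by gcongr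
    -- The term enters the balance doubled, as ν/2; with the two Young terms of ν/4 each, half of
    -- the dissipation 2ν remains.
    have c2 : 3 * K⁻¹ * p * G ^ 2 ≤ ν / 4 * G ^ 2 := by
      have : 3 * K⁻¹ * p ≤ ν / 4 := by
        rw [mul_assoc, ← div_eq_inv_mul, mul_div_assoc', div_le_iff₀ hK]
        linarith
      gcongr
    have y1 := young_le (a := b) (x := G) hν (1 / 4) (by norm_num)
    have y2 := young_le (a := 4 * √(logK K) * P ^ 2) (x := G) hν (1 / 4) (by norm_num)
    have hsplit : ∀ a : ℝ, a / (1 / 4 * ν) = 4 * a / ν := fun a ↦ by field_simp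
    rw [hsplit] at y1 y2
    have e1 : 4 * b ^ 2 / ν ≤ 4 * Γ i ^ 2 / ν := by gcongr
    have e2 : 4 * (4 * √(logK K) * P ^ 2) ^ 2 / ν = 64 * logK K * P ^ 4 / ν := by
      rw [mul_pow, mul_pow, Real.sq_sqrt (by linarith)]; ring
    have hq : max 1 (K ^ 2) * q ^ 2 ≤ G ^ 2 := by
      rcases max_cases 1 (K ^ 2) with ⟨hm, _⟩ | ⟨hm, _⟩
      · rw [hm]; linarith
      · rw [hm]
        calc K ^ 2 * q ^ 2 ≤ K ^ 2 * (K⁻¹ * G) ^ 2 := by gcongr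
          _ = G ^ 2 := by field_simp
    have hq' := mul_le_mul_of_nonneg_left hq hν.le
    linarith

/-- The low modes are eventually of the size of the force, and the hypothesis on K then makes them
small relative to νK/√L, so the cubic source in the high-mode estimate is at most P². The constant
2000 is generous; the argument gives 26. -/
theorem IsVorticity.eventually_le_of_nonneg (h : IsVorticity ν K (symMatrix θ₁ θ₂) w γ)
    (hθ : θ₁ + θ₂ = 1) (h0 : 0 ≤ θ₂) (h1 : θ₂ ≤ 1) (hν : 0 < ν) (hK : 0 < K) {Γ : Fin 2 → ℝ}
    (hγ : ForceBound γ Γ)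
    (hs : ∀ η, 0 < η → ∃ T, 0 ≤ T ∧ ∀ᵐ s, T < s → l2 (igrad (γ 0 s - γ 1 s)) ≤ η)
    (hKΓ : 1000 * logK K * (Γ 0 ^ 2 + Γ 1 ^ 2) ≤ ν ^ 4 * K ^ 2) {η : ℝ} (hη : 0 < η) :
    ∀ᶠ t in atTop, l2 (w 0 t) ^ 2 + l2 (w 1 t) ^ 2
      ≤ 2000 * (Γ 0 ^ 2 + Γ 1 ^ 2) / ν ^ 2 + η := by
  have hδ := fun η (hη : 0 < η) ↦ h.eventually_low_sub_le hθ hν hγ hs hη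
  have hL := one_le_logK hK
  obtain ⟨g, hg⟩ : ∃ g, g = (Γ 0 ^ 2 + Γ 1 ^ 2) / ν ^ 2 := ⟨_, rfl⟩
  have hg0 : 0 ≤ g := by rw [hg]; positivity
  have hgν : Γ 0 ^ 2 + Γ 1 ^ 2 = ν ^ 2 * g := by rw [hg]; field_simp
  have hKg : 1000 * logK K * g ≤ ν ^ 2 * K ^ 2 := by
    rw [hgν] at hKΓ
    have : ν ^ 2 * (1000 * logK K * g) ≤ ν ^ 2 * (ν ^ 2 * K ^ 2) := by linarith
    exact le_of_mul_le_mul_left this (by positivity)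
  -- the size of the low modes
  obtain ⟨ζ, hζ⟩ : ∃ ζ, ζ = min (η / 400) (ν ^ 2 * K ^ 2 / (2000 * logK K)) := ⟨_, rfl⟩
  have hζ0 : 0 < ζ := by rw [hζ]; positivity
  have hζ1 : ζ ≤ η / 400 := by rw [hζ]; exact min_le_left _ _
  have hζ2 : 2000 * logK K * ζ ≤ ν ^ 2 * K ^ 2 := by
    have : ζ ≤ ν ^ 2 * K ^ 2 / (2000 * logK K) := by rw [hζ]; exact min_le_right _ _
    rw [le_div_iff₀ (by positivity)] at this
    linarith
  have hlow : ∀ᶠ t in atTop, l2 (low K (w 0 t)) ^ 2 + l2 (low K (w 1 t)) ^ 2 ≤ 6 * g + ζ := by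
    filter_upwards [h.eventually_low_add_le hθ h0 h1 hν hK hγ hδ hζ0, hδ ζ hζ0,
      eventually_ge_atTop 0] with t e1 e2 e3
    rw [sum_l2_low_sq (h.sq 0 t e3) (h.sq 1 t e3)]
    have : 12 * (Γ 0 ^ 2 + Γ 1 ^ 2) / ν ^ 2 = 12 * g := by rw [hg]; ring
    linarith
  obtain ⟨P, hP⟩ : ∃ P, P = √(6 * g + ζ) := ⟨_, rfl⟩
  have hP0 : 0 ≤ P := by rw [hP]; positivity
  have hP2 : P ^ 2 = 6 * g + ζ := by rw [hP, Real.sq_sqrt (by positivity)]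
  have hLP : 125 * (logK K * P ^ 2) ≤ ν ^ 2 * K ^ 2 := by
    rw [hP2]
    nlinarith [mul_nonneg (zero_le_one.trans hL) hζ0.le, mul_nonneg (zero_le_one.trans hL) hg0]
  have hPK : 12 * P ≤ ν * K := by
    have hLP' : P ^ 2 ≤ logK K * P ^ 2 := le_mul_of_one_le_left (sq_nonneg _) hL
    refine le_of_sq_le_sq ?_ (by positivity)
    have : 144 * P ^ 2 ≤ ν ^ 2 * K ^ 2 := by
      rw [hP2]
      nlinarith [mul_le_mul_of_nonneg_right hL hζ0.le, mul_le_mul_of_nonneg_right hL hg0]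
    nlinarith
  have hlow' : ∀ i, ∀ᶠ t in atTop, l2 (low K (w i t)) ≤ P := fun i ↦ by
    filter_upwards [hlow] with t ht
    rw [hP]
    refine Real.le_sqrt_of_sq_le (le_trans ?_ ht)
    fin_cases i
    · simpa using sq_nonneg (l2 (low K (w 1 t)))
    · simpa using sq_nonneg (l2 (low K (w 0 t)))
  have hhigh : ∀ i, ∀ᶠ t in atTop, l2 (high K (w i t)) ^ 2 ≤ 4 * g + P ^ 2 + ζ := fun i ↦ by
    filter_upwards [h.eventually_high_le hν hK hγ hPK i (hlow' i) hζ0] with t ht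
    have e1 : 4 * Γ i ^ 2 / ν ^ 2 ≤ 4 * g := by
      rw [hg, mul_div_assoc]
      gcongr
      fin_cases i
      · simpa using sq_nonneg (Γ 1)
      · simpa using sq_nonneg (Γ 0)
    have e2 : 64 * logK K * P ^ 4 / (ν ^ 2 * K ^ 2) ≤ P ^ 2 := by
      rw [div_le_iff₀ (by positivity)]
      nlinarith [mul_le_mul_of_nonneg_left hLP (sq_nonneg P),
        mul_nonneg (zero_le_one.trans hL) (sq_nonneg (P ^ 2))]
    linarith
  filter_upwards [hlow, hhigh 0, hhigh 1, eventually_ge_atTop 0] with t e1 e2 e3 e4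
  rw [l2_sq_eq_low_add_high (h.sq 0 t e4) K, l2_sq_eq_low_add_high (h.sq 1 t e4) K]
  have : 2000 * (Γ 0 ^ 2 + Γ 1 ^ 2) / ν ^ 2 = 2000 * g := by rw [hg]; ring
  rw [hP2] at e2 e3
  linarith

end

/-! ### The case θ₂ < 0. -/

section

variable {ν K θ₁ θ₂ : ℝ} {w γ : Fin 2 → ℝ → (Fin 2 → ℤ) → ℂ}

/-- A continuity argument: up to the first time at which Y reaches ρ the differential inequality
holds, and it keeps Y at or below Y 0 + b/a, which is less than ρ. -/
theorem HasRate.lt_of_bootstrap {Y D : ℝ → ℝ} (h : HasRate Y D) (hY : 0 ≤ Y 0) {a b ρ : ℝ}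
    (ha : 0 < a) (hb : 0 ≤ b) (hρ : Y 0 + b / a < ρ)
    (hD : ∀ᵐ s, 0 < s → Y s ≤ ρ → D s ≤ b - a * Y s) {t : ℝ} (ht : 0 ≤ t) : Y t < ρ := by
  by_contra hcon
  rw [not_lt] at hcon
  have hc := h.continuousOn le_rfl ht
  have hcpt : IsCompact (Icc 0 t ∩ Y ⁻¹' Ici ρ) :=
    isCompact_Icc.of_isClosed_subset (hc.preimage_isClosed_of_isClosed isClosed_Icc isClosed_Ici)
      inter_subset_left
  obtain ⟨τ, ⟨hτ, hτρ⟩, hmin⟩ := hcpt.exists_isLeast ⟨t, ⟨ht, le_rfl⟩, hcon⟩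
  have hbelow : ∀ s, 0 ≤ s → s < τ → Y s ≤ ρ := fun s hs hsτ ↦ by
    by_contra hc'
    exact absurd (hmin ⟨⟨hs, hsτ.le.trans hτ.2⟩, (not_le.mp hc').le⟩) (not_le.mpr hsτ)
  -- At τ itself the bound Y ≤ ρ is not available from minimality, but a single time is negligible.
  have hne : ∀ᵐ s : ℝ, s ≠ τ := by simp [ae_iff, measure_singleton]
  have hle := h.le_exp le_rfl ha hb (t₁ := τ) (by
    filter_upwards [hD, hne] with s hs hsτ hmem
    exact hs hmem.1 (hbelow s hmem.1.le (lt_of_le_of_ne hmem.2 hsτ))) ⟨hτ.1, le_rfl⟩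
  have hexp : Real.exp (-(a * (τ - 0))) * Y 0 ≤ Y 0 := by
    refine mul_le_of_le_one_left hY (Real.exp_le_one_iff.mpr ?_)
    have := mul_nonneg ha.le hτ.1
    linarith
  have : ρ ≤ Y τ := hτρ
  linarith

/-- While the solution stays in the ball of radius ρ, the smallness condition makes all cubic terms
at most half of the dissipation 2ν(|∇w₀|² + |∇w₁|²). This closes the bootstrap, and the same
inequality, now valid for all time, gives the final bound. -/
theorem IsVorticity.eventually_le_of_neg (h : IsVorticity ν K (symMatrix θ₁ θ₂) w γ)
    (hθ : θ₁ + θ₂ = 1) (h0 : θ₂ < 0) (hν : 0 < ν) (hK : 0 < K) {Γ : Fin 2 → ℝ}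
    (hγ : ForceBound γ Γ) {ρ : ℝ} (hρ0 : 0 < ρ)
    (hρ : l2 (w 0 0) ^ 2 + l2 (w 1 0) ^ 2 + 4 * (Γ 0 ^ 2 + Γ 1 ^ 2) / ν ^ 2 < ρ ^ 2)
    (hsmall : (14 * √(logK K) * K⁻¹ + 28 * (-θ₂) * √(logK K)) * ρ ≤ ν) {η : ℝ} (hη : 0 < η) :
    ∀ᶠ t in atTop, l2 (w 0 t) ^ 2 + l2 (w 1 t) ^ 2
      ≤ 4 * (Γ 0 ^ 2 + Γ 1 ^ 2) / ν ^ 2 + η := by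
  have hr := (h.isEvolution 0).hasRate.add (h.isEvolution 1).hasRate
  have hL := one_le_sqrt_logK hK
  have hba : 2 * (Γ 0 ^ 2 + Γ 1 ^ 2) / ν / (ν / 2) = 4 * (Γ 0 ^ 2 + Γ 1 ^ 2) / ν ^ 2 := by
    field_simp; ring
  have key : ∀ᵐ s, 0 < s → l2 (w 0 s) ^ 2 + l2 (w 1 s) ^ 2 ≤ ρ ^ 2 →
      (∑' k, 2 * (vortRHS ν K (symMatrix θ₁ θ₂) w γ 0 s k * conj (w 0 s k)).re
        + ∑' k, 2 * (vortRHS ν K (symMatrix θ₁ θ₂) w γ 1 s k * conj (w 1 s k)).re)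
      ≤ 2 * (Γ 0 ^ 2 + Γ 1 ^ 2) / ν - ν / 2 * (l2 (w 0 s) ^ 2 + l2 (w 1 s) ^ 2) := by
    filter_upwards [hγ, h.ae_H1] with s h2 h3 hs0 hX
    have hw := h3 hs0
    have hg := h2 hs0
    have hre : ∀ i, IsReal (w i s) := fun i ↦ h.isReal i s hs0.le
    have a0 := rate_vort_le (K := K) (ν := ν) (M := symMatrix θ₁ θ₂) 0 hw hre fun i ↦ (hg i).1
    have a1 := rate_vort_le (K := K) (ν := ν) (M := symMatrix θ₁ θ₂) 1 hw hre fun i ↦ (hg i).1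
    change rate _ _ + rate _ _ ≤ _
    generalize rate _ (vortRHS ν K (symMatrix θ₁ θ₂) w γ 0 s) = r0 at a0 ⊢
    generalize rate _ (vortRHS ν K (symMatrix θ₁ θ₂) w γ 1 s) = r1 at a1 ⊢
    simp only [symMatrix, Fin.sum_univ_two, Matrix.of_apply, Matrix.cons_val', Matrix.cons_val_zero,
      Matrix.cons_val_one, Matrix.cons_val_fin_one] at a0 a1
    have c0 := (abs_le.mp (abs_re_tri_low_le (hw 0) (hre 0) hK)).2
    have c1 := (abs_le.mp (abs_re_tri_low_le (hw 1) (hre 1) hK)).2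
    have l0 := pow_le_pow_left₀ (l2_nonneg _) (hw 0).l2_le_grad 2
    have l1 := pow_le_pow_left₀ (l2_nonneg _) (hw 1).l2_le_grad 2
    -- the size of the solution
    have hsz : ∀ i, l2 (w i s) ≤ ρ := fun i ↦ by
      refine le_of_sq_le_sq (le_trans ?_ hX) hρ0.le
      fin_cases i
      · simpa using sq_nonneg (l2 (w 1 s))
      · simpa using sq_nonneg (l2 (w 0 s))
    have hcross : ∀ i j, (tri (w j s) (w j s) (low K (w i s))).re
        ≤ 7 * √(logK K) * ρ * (l2 (grad (w j s)) * l2 (grad (w i s))) := fun i j ↦ by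
      refine (Complex.re_le_norm _).trans ((norm_tri_low_le (hw j) (hw i) hK).trans ?_)
      have e1 := hsz j
      have e2 := (hw j).l2_le_grad
      have e3 := l2_grad_low_le_grad (hw i) K
      have e4 := l2_nonneg (w j s)
      have e5 := l2_nonneg (grad (low K (w i s)))
      have e6 := l2_nonneg (grad (w j s))
      calc _ = 7 * √(logK K) * (l2 (w j s) * l2 (w j s)) * l2 (grad (low K (w i s))) := by ring
        _ ≤ 7 * √(logK K) * (ρ * l2 (grad (w j s))) * l2 (grad (w i s)) := by gcongr
        _ = _ := by ring
    have d0 : 7 * √(logK K) * K⁻¹ * l2 (w 0 s) * l2 (grad (w 0 s)) ^ 2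
        ≤ 7 * √(logK K) * K⁻¹ * ρ * l2 (grad (w 0 s)) ^ 2 := by
      have := hsz 0
      gcongr
    have d1 : 7 * √(logK K) * K⁻¹ * l2 (w 1 s) * l2 (grad (w 1 s)) ^ 2
        ≤ 7 * √(logK K) * K⁻¹ * ρ * l2 (grad (w 1 s)) ^ 2 := by
      have := hsz 1
      gcongr
    have x00 := hcross 0 0
    have x01 := hcross 0 1
    have x10 := hcross 1 0
    have x11 := hcross 1 1
    have g0 := pow_le_pow_left₀ (l2_nonneg _) (hg 0).2 2
    have g1 := pow_le_pow_left₀ (l2_nonneg _) (hg 1).2 2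
    have y0 := young_le (a := l2 (igrad (γ 0 s))) (x := l2 (grad (w 0 s))) hν (1 / 2) (by norm_num)
    have y1 := young_le (a := l2 (igrad (γ 1 s))) (x := l2 (grad (w 1 s))) hν (1 / 2) (by norm_num)
    have hsplit : ∀ a : ℝ, a / (1 / 2 * ν) = 2 * a / ν := fun a ↦ by field_simp
    rw [hsplit] at y0 y1
    have q0 : 2 * l2 (igrad (γ 0 s)) ^ 2 / ν ≤ 2 * Γ 0 ^ 2 / ν := by gcongr
    have q1 : 2 * l2 (igrad (γ 1 s)) ^ 2 / ν ≤ 2 * Γ 1 ^ 2 / ν := by gcongr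
    have hsum : 2 * (Γ 0 ^ 2 + Γ 1 ^ 2) / ν = 2 * Γ 0 ^ 2 / ν + 2 * Γ 1 ^ 2 / ν := by ring
    -- The matrix is the identity plus e times the matrix of ones: the identity part is handled with
    -- the gain K⁻¹, the other with the small factor e.
    obtain ⟨e, he⟩ : ∃ e, e = -θ₂ := ⟨_, rfl⟩
    have he0 : 0 < e := by linarith
    have hθ2 : θ₂ = -e := by linarith
    have hθ1 : θ₁ = 1 + e := by linarith
    rw [hθ1, hθ2] at a0 a1
    rw [← he] at hsmall
    obtain ⟨κ, hκ⟩ : ∃ κ, κ = 7 * √(logK K) * ρ := ⟨_, rfl⟩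
    rw [← hκ] at x00 x01 x10 x11
    have hκ0 : 0 ≤ κ := by rw [hκ]; positivity
    set G0 := l2 (grad (w 0 s))
    set G1 := l2 (grad (w 1 s))
    -- The 4 arises from the four cross terms, (G0 + G1)² ≤ 2(G0² + G1²), doubled by the energy
    -- balance.
    have hsm : (2 * K⁻¹ * κ + 4 * e * κ) * (G0 ^ 2 + G1 ^ 2) ≤ ν * (G0 ^ 2 + G1 ^ 2) := by
      refine mul_le_mul_of_nonneg_right ?_ (by positivity)
      rw [hκ]; linarith
    have m00 := mul_le_mul_of_nonneg_left x00 he0.le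
    have m01 := mul_le_mul_of_nonneg_left x01 he0.le
    have m10 := mul_le_mul_of_nonneg_left x10 he0.le
    have m11 := mul_le_mul_of_nonneg_left x11 he0.le
    have hpr : e * (κ * (2 * (G0 * G1))) ≤ e * (κ * (G0 ^ 2 + G1 ^ 2)) := by
      gcongr
      linarith [two_mul_le_add_sq G0 G1]
    have d0' : 7 * √(logK K) * K⁻¹ * ρ * G0 ^ 2 = K⁻¹ * κ * G0 ^ 2 := by rw [hκ]; ring
    have d1' : 7 * √(logK K) * K⁻¹ * ρ * G1 ^ 2 = K⁻¹ * κ * G1 ^ 2 := by rw [hκ]; ring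
    have n0 := mul_le_mul_of_nonneg_left l0 hν.le
    have n1 := mul_le_mul_of_nonneg_left l1 hν.le
    linarith only [a0, a1, c0, c1, d0, d1, d0', d1', m00, m01, m10, m11, hpr, hsm, y0, y1, q0, q1,
      hsum, n0, n1]
  have hbound : ∀ t, 0 ≤ t → l2 (w 0 t) ^ 2 + l2 (w 1 t) ^ 2 < ρ ^ 2 := fun t ht ↦
    hr.lt_of_bootstrap (by positivity) (half_pos hν) (b := 2 * (Γ 0 ^ 2 + Γ 1 ^ 2) / ν)
      (by positivity) (by rw [hba]; exact hρ) key ht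
  have := hr.eventually_le le_rfl (half_pos hν) (b := 2 * (Γ 0 ^ 2 + Γ 1 ^ 2) / ν)
    (by positivity) (by
      filter_upwards [key] with s hs hs0
      exact hs hs0 (hbound s hs0.le).le) hη
  rwa [hba] at this

end

/-! ### Fourier coefficients of vector fields -/

/-- The `l`-th component of a vector field, as a complex valued function. -/
def component (u : L2Field) (l : Fin 2) (x : Torus) : ℂ := ((u x l : ℝ) : ℂ)

lemma memLp_component (u : L2Field) (l : Fin 2) : MemLp (component u l) 2 volume := by
  refine (Lp.memLp u).of_le ?_ (ae_of_all _ fun x ↦ ?_)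
  · have hc : Continuous fun y : EuclideanSpace ℝ (Fin 2) ↦ ((y l : ℝ) : ℂ) := by fun_prop
    exact hc.comp_aestronglyMeasurable (Lp.aestronglyMeasurable u)
  · rw [component, Complex.norm_real]
    exact PiLp.norm_apply_le (u x) l

lemma memLp_mul_mode {f : Torus → ℂ} (hf : MemLp f 2 volume) (k : Fin 2 → ℤ) :
    MemLp (fun x ↦ f x * mode k x) 2 volume := by
  refine hf.of_le (hf.1.mul (modeC k).continuous.aestronglyMeasurable) (ae_of_all _ fun x ↦ ?_)
  rw [norm_mul, norm_mode, mul_one]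

lemma integrable_mul_conj_mode {f : Torus → ℂ} (hf : MemLp f 2 volume) (k : Fin 2 → ℤ) :
    Integrable (fun x ↦ f x * conj (mode k x)) := by
  have := (memLp_mul_mode hf (-k)).integrable (by norm_num)
  simpa only [mode_neg] using this

lemma coeff_congr_ae {f g : Torus → ℂ} (h : f =ᵐ[volume] g) (k : Fin 2 → ℤ) :
    coeff f k = coeff g k := by
  rw [coeff, coeff, integral_congr_ae]
  filter_upwards [h] with x hx
  rw [hx]

lemma coeff_add {f g : Torus → ℂ} (k : Fin 2 → ℤ)
    (hf : Integrable (fun x ↦ f x * conj (mode k x)))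
    (hg : Integrable (fun x ↦ g x * conj (mode k x))) :
    coeff (fun x ↦ f x + g x) k = coeff f k + coeff g k := by
  simp only [coeff, add_mul]
  rw [integral_add hf hg, mul_add]

lemma coeff_sub {f g : Torus → ℂ} (k : Fin 2 → ℤ)
    (hf : Integrable (fun x ↦ f x * conj (mode k x)))
    (hg : Integrable (fun x ↦ g x * conj (mode k x))) :
    coeff (fun x ↦ f x - g x) k = coeff f k - coeff g k := by
  simp only [coeff, sub_mul]
  rw [integral_sub hf hg, mul_sub]

lemma fieldCoeff_eq (u : L2Field) (k : Fin 2 → ℤ) (l : Fin 2) :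
    fieldCoeff u k l = coeff (component u l) k := rfl

lemma fieldCoeff_sub (u w : L2Field) (k : Fin 2 → ℤ) (l : Fin 2) :
    fieldCoeff (u - w) k l = fieldCoeff u k l - fieldCoeff w k l := by
  rw [fieldCoeff_eq, fieldCoeff_eq, fieldCoeff_eq,
    ← coeff_sub k (integrable_mul_conj_mode (memLp_component u l) k)
      (integrable_mul_conj_mode (memLp_component w l) k)]
  refine coeff_congr_ae ?_ k
  filter_upwards [Lp.coeFn_sub u w] with x hx
  simp only [component, hx, Pi.sub_apply, PiLp.sub_apply, Complex.ofReal_sub]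

lemma conj_two_pi : conj (((2 * Real.pi : ℝ) : ℂ)⁻¹ ^ 2) = ((2 * Real.pi : ℝ) : ℂ)⁻¹ ^ 2 := by
  rw [map_pow, map_inv₀, Complex.conj_ofReal]

lemma fieldCoeff_neg (u : L2Field) (k : Fin 2 → ℤ) (l : Fin 2) :
    fieldCoeff u (-k) l = conj (fieldCoeff u k l) := by
  rw [fieldCoeff_eq, fieldCoeff_eq, coeff, coeff, map_mul, ← integral_conj, conj_two_pi]
  simp [component, mode_neg]

lemma hasSum_sq_coeff {f : Torus → ℂ} (hf : MemLp f 2 volume) :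
    HasSum (fun k ↦ ‖coeff f k‖ ^ 2) (((2 * Real.pi) ^ 2)⁻¹ * ∫ x, ‖f x‖ ^ 2) := by
  have h := hasSum_conj_coeff_mul_coeff hf hf
  have h1 : ∀ z : ℂ, conj z * z = ((‖z‖ ^ 2 : ℝ) : ℂ) := fun z ↦ by
    rw [Complex.conj_mul']; push_cast; rfl
  simp only [h1] at h
  rw [integral_complex_ofReal] at h
  exact_mod_cast h

lemma hasSum_sq_fieldCoeff (u : L2Field) :
    HasSum (fun k ↦ ∑ l, ‖fieldCoeff u k l‖ ^ 2) (((2 * Real.pi) ^ 2)⁻¹ * ‖u‖ ^ 2) := by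
  have h := hasSum_sum (s := Finset.univ) fun l _ ↦ hasSum_sq_coeff (memLp_component u l)
  refine (congrArg (HasSum _) ?_).mpr h
  rw [← Finset.mul_sum, ← integral_finsetSum _ fun l _ ↦ (memLp_component u l).integrable_norm_pow
    (by norm_num)]
  congr 1
  have h2 : ‖u‖ ^ 2 = ∫ x, ‖u x‖ ^ 2 := by
    rw [← real_inner_self_eq_norm_sq, MeasureTheory.L2.inner_def]
    simp only [real_inner_self_eq_norm_sq]
  rw [h2]
  refine integral_congr_ae (ae_of_all _ fun x ↦ ?_)
  simp only [EuclideanSpace.norm_sq_eq, component, Complex.norm_real]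

lemma norm_fieldCoeff_le (u : L2Field) (k : Fin 2 → ℤ) (l : Fin 2) :
    ‖fieldCoeff u k l‖ ≤ ‖u‖ := by
  refine le_of_sq_le_sq ?_ (norm_nonneg _)
  have h := hasSum_sq_fieldCoeff u
  have h1 : ‖fieldCoeff u k l‖ ^ 2 ≤ ∑ l, ‖fieldCoeff u k l‖ ^ 2 :=
    Finset.single_le_sum (f := fun l ↦ ‖fieldCoeff u k l‖ ^ 2) (fun _ _ ↦ sq_nonneg _)
      (Finset.mem_univ l)
  have h2 := le_hasSum h k fun _ _ ↦ Finset.sum_nonneg fun _ _ ↦ sq_nonneg _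
  refine h1.trans (h2.trans (mul_le_of_le_one_left (sq_nonneg _) (inv_le_one_of_one_le₀ ?_)))
  nlinarith [Real.pi_gt_three]

lemma continuous_fieldCoeff (k : Fin 2 → ℤ) (l : Fin 2) :
    Continuous fun u ↦ fieldCoeff u k l := by
  refine (LipschitzWith.of_dist_le_mul (K := 1) fun u w ↦ ?_).continuous
  rw [dist_eq_norm, dist_eq_norm, ← fieldCoeff_sub, NNReal.coe_one, one_mul]
  exact norm_fieldCoeff_le _ _ _

/-- The Fourier coefficients of a product. -/
theorem hasSum_coeff_mul {f g : Torus → ℂ} (hf : MemLp f 2 volume) (hg : MemLp g 2 volume)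
    (k : Fin 2 → ℤ) :
    HasSum (fun h ↦ coeff f h * coeff g (k - h)) (coeff (fun x ↦ f x * g x) k) := by
  -- The product formula is Parseval's identity for f against the conjugate of g modulated by the
  -- mode k.
  have hF : MemLp (fun x ↦ conj (g x) * mode k x) 2 volume := memLp_mul_mode hg.star k
  have h := hasSum_conj_coeff_mul_coeff hF hf
  have hc : ∀ h, conj (coeff (fun x ↦ conj (g x) * mode k x) h) = coeff g (k - h) := fun h ↦ by
    rw [coeff, coeff, map_mul, ← integral_conj]
    congr 1
    · exact conj_two_pi
    · congr 1; funext x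
      rw [sub_eq_add_neg, mode_add, mode_neg]
      simp only [map_mul, Complex.conj_conj]
      ring
  simp only [hc] at h
  convert h using 1
  · funext h; ring
  · rw [coeff, inv_pow]
    congr 1
    congr 1; funext x
    simp only [map_mul, Complex.conj_conj]
    ring

/-! ### The vorticity -/

/-- The Fourier coefficients of the vorticity `∂₁u₂ - ∂₂u₁`. -/
def vort (u : L2Field) (k : Fin 2 → ℤ) : ℂ :=
  Complex.I * ((k 0 : ℂ) * fieldCoeff u k 1 - (k 1 : ℂ) * fieldCoeff u k 0)

/-- The Fourier multipliers of the Biot-Savart law. -/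
def biotSavart (k : Fin 2 → ℤ) : Fin 2 → ℂ :=
  ![Complex.I * k 1 / (wavenumberSq k : ℂ), -(Complex.I * k 0) / (wavenumberSq k : ℂ)]

lemma vort_zero (u : L2Field) : vort u 0 = 0 := by simp [vort]

lemma vort_sub (u w : L2Field) : vort (u - w) = vort u - vort w := by
  funext k
  simp only [vort, fieldCoeff_sub, Pi.sub_apply]
  ring

lemma isReal_vort (u : L2Field) : IsReal (vort u) := fun k ↦ by
  simp only [vort, fieldCoeff_neg, Pi.neg_apply, map_mul, map_sub, Complex.conj_I, Int.cast_neg,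
    map_intCast]
  ring

lemma continuous_vort (k : Fin 2 → ℤ) : Continuous fun u ↦ vort u k := by
  have h0 := continuous_fieldCoeff k 0
  have h1 := continuous_fieldCoeff k 1
  unfold vort
  fun_prop

lemma wavenumberSq_ne_zero {k : Fin 2 → ℤ} (hk : k ≠ 0) : (wavenumberSq k : ℂ) ≠ 0 := by
  have := pow_pos (nrm_pos hk) 2
  rw [nrm_sq] at this
  exact_mod_cast this.ne'

lemma wavenumberSq_cast (k : Fin 2 → ℤ) : (wavenumberSq k : ℂ) = (k 0 : ℂ) ^ 2 + (k 1 : ℂ) ^ 2 := by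
  rw [wavenumberSq_eq]; push_cast; rfl

/-- A vector that is orthogonal to `k` is determined by its curl. -/
lemma eq_biotSavart_mul {k : Fin 2 → ℤ} {a : Fin 2 → ℂ} (h0 : k = 0 → ∀ l, a l = 0)
    (h : ∑ l, (k l : ℂ) * a l = 0) (l : Fin 2) :
    a l = biotSavart k l * (Complex.I * ((k 0 : ℂ) * a 1 - (k 1 : ℂ) * a 0)) := by
  by_cases hk : k = 0
  · rw [h0 hk, h0 hk, h0 hk]; simp
  have hne := wavenumberSq_ne_zero hk
  rw [Fin.sum_univ_two] at h
  have h2 : ((k 0 : ℂ) ^ 2 + (k 1 : ℂ) ^ 2) ≠ 0 := by rwa [wavenumberSq_cast] at hne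
  fin_cases l
  · simp only [biotSavart, wavenumberSq_cast, Fin.zero_eta, Matrix.cons_val_zero]
    field_simp
    linear_combination (k 0 : ℂ) * h + (-(k 0 : ℂ) * k 1 * a 1 + k 1 ^ 2 * a 0) * Complex.I_sq
  · simp only [biotSavart, wavenumberSq_cast, Fin.mk_one, Matrix.cons_val_one,
      Matrix.cons_val_fin_one]
    field_simp
    linear_combination (k 1 : ℂ) * h + ((k 0 : ℂ) ^ 2 * a 1 - k 0 * k 1 * a 0) * Complex.I_sq

lemma curl_biotSavart {k : Fin 2 → ℤ} (hk : k ≠ 0) :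
    Complex.I * ((k 0 : ℂ) * biotSavart k 1 - (k 1 : ℂ) * biotSavart k 0) = 1 := by
  have hne := wavenumberSq_ne_zero hk
  simp only [biotSavart, Matrix.cons_val_zero, Matrix.cons_val_one, Matrix.cons_val_fin_one]
  field_simp
  rw [wavenumberSq_cast]
  linear_combination (-(k 0 : ℂ) ^ 2 - k 1 ^ 2) * Complex.I_sq

lemma fieldCoeff_eq_biotSavart {u : L2Field} (hu : u ∈ H) (k : Fin 2 → ℤ) (l : Fin 2) :
    fieldCoeff u k l = biotSavart k l * vort u k :=
  eq_biotSavart_mul (fun hk l ↦ hk ▸ hu.1 l) (hu.2 k) l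

lemma sum_sq_biotSavart (k : Fin 2 → ℤ) :
    ∑ l, ‖biotSavart k l‖ ^ 2 = (nrm k)⁻¹ ^ 2 := by
  by_cases hk : k = 0
  · simp [hk, biotSavart, Fin.sum_univ_two]
  have hp := nrm_pos hk
  have h0 : ‖(wavenumberSq k : ℂ)‖ = nrm k ^ 2 := by
    rw [Complex.norm_real, Real.norm_of_nonneg (wavenumberSq_nonneg k), nrm_sq]
  have h1 : ∀ n : ℤ, ‖(n : ℂ)‖ ^ 2 = (n : ℝ) ^ 2 := fun n ↦ by
    rw [Complex.norm_intCast, sq_abs]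
  have h2 : (k 1 : ℝ) ^ 2 + (k 0 : ℝ) ^ 2 = nrm k ^ 2 := by rw [nrm_sq, wavenumberSq_eq, add_comm]
  simp only [Fin.sum_univ_two, biotSavart, Matrix.cons_val_zero, Matrix.cons_val_one,
    Matrix.cons_val_fin_one, norm_div, norm_neg, norm_mul, Complex.norm_I, one_mul, h0, div_pow, h1]
  rw [← add_div, h2]
  field_simp

lemma sum_sq_fieldCoeff {u : L2Field} (hu : u ∈ H) (k : Fin 2 → ℤ) :
    ∑ l, ‖fieldCoeff u k l‖ ^ 2 = ‖igrad (vort u) k‖ ^ 2 := by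
  simp only [fieldCoeff_eq_biotSavart hu, norm_mul, mul_pow]
  rw [← Finset.sum_mul, sum_sq_biotSavart, norm_igrad, mul_pow]

/-- The factor 2π is the root of the total mass of the torus, since the coefficients are averages.
-/
lemma sq_igrad_vort {u : L2Field} (hu : u ∈ H) :
    Sq (igrad (vort u)) ∧ l2 (igrad (vort u)) = ‖u‖ / (2 * Real.pi) := by
  have h := hasSum_sq_fieldCoeff u
  simp only [sum_sq_fieldCoeff hu] at h
  refine ⟨h.summable, ?_⟩
  rw [l2, h.tsum_eq, ← inv_pow, ← mul_pow, Real.sqrt_sq (by positivity)]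
  ring

lemma norm_vort {u : L2Field} (k : Fin 2 → ℤ) :
    ‖vort u k‖ = nrm k * ‖igrad (vort u) k‖ := by
  by_cases hk : k = 0
  · simp [hk, vort_zero]
  · rw [norm_igrad, mul_inv_cancel_left₀ (nrm_pos hk).ne']

lemma isWeakPartial_weakPartial {u : L2Field} (hu : u ∈ V) (j : Fin 2) :
    IsWeakPartial j u (weakPartial j u) := by
  rw [weakPartial, dif_pos (hu.2 j)]
  exact (hu.2 j).choose_spec

/-- Differentiation multiplies the energy of each mode by |k|² in total, and for a divergence-free
field the velocity modes have |k|⁻¹ times the size of the vorticity modes. -/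
lemma sq_vort {u : L2Field} (hu : u ∈ V) :
    Sq (vort u) ∧ l2 (vort u) = normV u / (2 * Real.pi) := by
  have h := hasSum_sum (s := Finset.univ) fun j _ ↦ hasSum_sq_fieldCoeff (weakPartial j u)
  have h1 : ∀ k, ∑ j, ∑ l, ‖fieldCoeff (weakPartial j u) k l‖ ^ 2 = ‖vort u k‖ ^ 2 := fun k ↦ by
    have : ∀ j l, ‖fieldCoeff (weakPartial j u) k l‖ ^ 2
        = (k j : ℝ) ^ 2 * ‖fieldCoeff u k l‖ ^ 2 := fun j l ↦ by
      rw [isWeakPartial_weakPartial hu j k l, norm_mul, norm_mul, Complex.norm_I, one_mul,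
        Complex.norm_intCast, mul_pow, sq_abs]
    simp only [this]
    rw [← Finset.sum_mul_sum, sum_sq_fieldCoeff hu.1, norm_vort, mul_pow, nrm_sq, wavenumberSq]
  simp only [h1] at h
  refine ⟨h.summable, ?_⟩
  rw [l2, h.tsum_eq, ← Finset.mul_sum, Real.sqrt_mul (by positivity), ← inv_pow,
    Real.sqrt_sq (by positivity), normV]
  ring

lemma sub_mem_H {u w : L2Field} (hu : u ∈ H) (hw : w ∈ H) : u - w ∈ H := by
  refine ⟨fun l ↦ ?_, fun k ↦ ?_⟩
  · rw [fieldCoeff_sub, hu.1, hw.1, sub_zero]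
  · have h1 := hu.2 k
    have h2 := hw.2 k
    simp only [fieldCoeff_sub, mul_sub, Finset.sum_sub_distrib, h1, h2, sub_zero]

lemma sub_mem_V {u w : L2Field} (hu : u ∈ V) (hw : w ∈ V) : u - w ∈ V := by
  refine ⟨sub_mem_H hu.1 hw.1, fun j ↦ ?_⟩
  obtain ⟨f, hf⟩ := hu.2 j
  obtain ⟨f', hf'⟩ := hw.2 j
  refine ⟨f - f', fun k l ↦ ?_⟩
  rw [fieldCoeff_sub, fieldCoeff_sub, hf k l, hf' k l, mul_sub]

lemma stokesNormSq_eq {u : L2Field} (hu : u ∈ H) :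
    stokesNormSq u = ENNReal.ofReal ((2 * Real.pi) ^ 2) *
      ∑' k, ENNReal.ofReal (‖grad (vort u) k‖ ^ 2) := by
  rw [stokesNormSq]
  congr 2; funext k; congr 1
  simp only [norm_mul, mul_pow]
  rw [← Finset.mul_sum, sum_sq_fieldCoeff hu, norm_grad, norm_vort, Complex.norm_real,
    Real.norm_of_nonneg (wavenumberSq_nonneg k), ← nrm_sq]
  ring

/-! ### The nonlinearity in terms of the vorticity -/

lemma hasSum_advectionCoeff {u : L2Field} (hu : u ∈ V) (k : Fin 2 → ℤ) (l : Fin 2) :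
    HasSum (fun h ↦ ∑ j, fieldCoeff u h j *
      (Complex.I * ((k - h) j : ℂ) * fieldCoeff u (k - h) l)) (advectionCoeff u u k l) := by
  have h := hasSum_sum (s := Finset.univ) fun j _ ↦
    hasSum_coeff_mul (memLp_component u j) (memLp_component (weakPartial j u) l) k
  have h1 : ∑ j, coeff (fun x ↦ component u j x * component (weakPartial j u) l x) k
      = advectionCoeff u u k l := by
    have hi : ∀ j, Integrable (fun x ↦
        component u j x * component (weakPartial j u) l x * conj (mode k x)) := fun j ↦ by
      have := (memLp_component u j).integrable_mul
        (memLp_mul_mode (memLp_component (weakPartial j u) l) (-k))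
      refine this.congr (ae_of_all _ fun x ↦ ?_)
      simp only [Pi.mul_apply, mode_neg, mul_assoc]
    rw [Fin.sum_univ_two, ← coeff_add k (hi 0) (hi 1), advectionCoeff]
    congr 1; funext x
    simp [component, Fin.sum_univ_two]
  rw [h1] at h
  refine h.congr_fun fun h ↦ Finset.sum_congr rfl fun j _ ↦ ?_
  rw [← fieldCoeff_eq, ← fieldCoeff_eq, isWeakPartial_weakPartial hu j]

lemma kern_sub_eq_zero (h : Fin 2 → ℤ) : kern h (0 - h) = 0 := by
  simp [kern]; left; ring

lemma nonlin_zero (α β : (Fin 2 → ℤ) → ℂ) : nonlin α β 0 = 0 := by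
  simp only [nonlin, kern_sub_eq_zero]; simp

/-- Bounding |h|⁻¹ by 1 loses much, but then square summability suffices, so each coefficient is
controlled at every time and not only where the vorticity has a gradient. -/
lemma summable_nonlin {α β : (Fin 2 → ℤ) → ℂ} (hα : Sq α) (hβ : Sq β) (k : Fin 2 → ℤ) :
    (Summable fun h ↦ (kern h (k - h) : ℂ) * α h * β (k - h)) ∧
      ‖nonlin α β k‖ ≤ nrm k * (l2 α * l2 β) := by
  have hβ' : Sq fun h ↦ β (k - h) := (Equiv.subLeft k).summable_iff.mpr hβ
  have hl : l2 (fun h ↦ β (k - h)) = l2 β := by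
    rw [l2, l2]
    exact congrArg _ ((Equiv.subLeft k).tsum_eq fun h ↦ ‖β h‖ ^ 2)
  have hle : ∀ h, ‖(kern h (k - h) : ℂ) * α h * β (k - h)‖ ≤ nrm k * (‖α h‖ * ‖β (k - h)‖) := by
    intro h
    rw [norm_mul, norm_mul, Complex.norm_real, Real.norm_eq_abs, mul_assoc]
    refine mul_le_mul_of_nonneg_right ((abs_kern_le h k).trans ?_) (by positivity)
    by_cases hh : h = 0
    · simp [hh, nrm_nonneg]
    · exact mul_le_of_le_one_left (nrm_nonneg k) (inv_le_one_of_one_le₀ (one_le_nrm hh))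
  have hs := (summable_norm_mul hα hβ').mul_left (nrm k)
  have hs' := Summable.of_nonneg_of_le (fun _ ↦ norm_nonneg _) hle hs
  refine ⟨hs'.of_norm, (norm_tsum_le_tsum_norm hs').trans ((hs'.tsum_le_tsum hle hs).trans ?_)⟩
  rw [tsum_mul_left]
  refine mul_le_mul_of_nonneg_left ?_ (nrm_nonneg k)
  rw [← hl]
  exact tsum_norm_mul_le hα hβ'

/-- The curl of the advection term is the nonlinearity of the vorticity equation. -/
theorem curl_advectionCoeff {u : L2Field} (hu : u ∈ V) (k : Fin 2 → ℤ) :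
    Complex.I * ((k 0 : ℂ) * advectionCoeff u u k 1 - (k 1 : ℂ) * advectionCoeff u u k 0)
      = nonlin (vort u) (vort u) k := by
  set w := vort u
  have hw : Sq w := (sq_vort hu).1
  have h := (((hasSum_advectionCoeff hu k 1).mul_left (k 0 : ℂ)).sub
    ((hasSum_advectionCoeff hu k 0).mul_left (k 1 : ℂ))).mul_left Complex.I
  have hn := (summable_nonlin hw hw k).1
  -- the antisymmetric part of the sum
  let T : (Fin 2 → ℤ) → ℂ := fun h ↦ (((h 0 : ℂ) * (k - h) 1 - h 1 * (k - h) 0) *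
    (h 0 * (k - h) 0 + h 1 * (k - h) 1) / (wavenumberSq h * wavenumberSq (k - h))) *
      (w h * w (k - h))
  -- With j = k - h, the symbol of the curl is (h ∧ j)/|h|² times 1 + (h · j)/|j|². The first part
  -- is the transport of vorticity, the second is T.
  have hsplit : ∀ h, Complex.I *
      ((k 0 : ℂ) * ∑ j, fieldCoeff u h j * (Complex.I * ((k - h) j : ℂ) * fieldCoeff u (k - h) 1)
      - (k 1 : ℂ) * ∑ j, fieldCoeff u h j * (Complex.I * ((k - h) j : ℂ) * fieldCoeff u (k - h) 0))
      = (kern h (k - h) : ℂ) * w h * w (k - h) + T h := by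
    intro h
    by_cases hh : h = 0
    · have : w 0 = 0 := vort_zero u
      simp [hh, T, hu.1.1, this]
    by_cases hj : k - h = 0
    · have : w 0 = 0 := vort_zero u
      simp [hj, T, this, hu.1.1]
    have n1 := wavenumberSq_ne_zero hh
    have n2 := wavenumberSq_ne_zero hj
    have hk0 : (k 0 : ℂ) = h 0 + (k - h) 0 := by simp
    have hk1 : (k 1 : ℂ) = h 1 + (k - h) 1 := by simp
    have hkern : (kern h (k - h) : ℂ)
        = ((h 0 : ℂ) * (k - h) 1 - h 1 * (k - h) 0) / wavenumberSq h := by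
      rw [kern]; push_cast; rfl
    simp only [fieldCoeff_eq_biotSavart hu.1, Fin.sum_univ_two, hkern, hk0, hk1, T]
    generalize k - h = j at *
    change _ = _ / _ * w h * w j + _
    have e1 : vort u h = w h := rfl
    have e2 : vort u j = w j := rfl
    rw [e1, e2]
    generalize w h = a
    generalize w j = b
    have m2 := wavenumberSq_cast j
    simp only [biotSavart, Matrix.cons_val_zero, Matrix.cons_val_one, Matrix.cons_val_fin_one]
    field_simp
    rw [m2]
    have hI : Complex.I ^ 4 = 1 := Complex.I_pow_four
    ring_nf
    simp only [hI]
    ring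
  simp only [hsplit] at h
  have hT : Summable T := by
    have := h.summable.sub hn
    simpa using this
  -- The reflection h ↦ k - h exchanges h and j; it reverses h ∧ j and preserves everything else in
  -- T.
  have hanti : ∑' h, T h = -∑' h, T h := by
    conv_lhs => rw [← (Equiv.subLeft k).tsum_eq]
    rw [← tsum_neg]
    congr 1; funext h
    simp only [T, Equiv.subLeft_apply, sub_sub_cancel]
    ring
  have hT0 : ∑' h, T h = 0 := by
    have : (2 : ℂ) * ∑' h, T h = 0 := by linear_combination hanti
    simpa using this
  have := h.tsum_eq
  rw [hn.tsum_add hT, hT0, add_zero] at this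
  exact this.symm

lemma bilinearCoeff_eq {u : L2Field} (hu : u ∈ V) (k : Fin 2 → ℤ) (l : Fin 2) :
    bilinearCoeff u u k l = biotSavart k l * nonlin (vort u) (vort u) k := by
  by_cases hk : k = 0
  · simp [bilinearCoeff, lerayCoeff, hk, nonlin_zero]
  have hne := wavenumberSq_ne_zero hk
  rw [eq_biotSavart_mul (a := bilinearCoeff u u k) (fun h ↦ absurd h hk), ← curl_advectionCoeff hu]
  · simp only [bilinearCoeff, lerayCoeff, if_neg hk]
    ring
  · simp only [bilinearCoeff, lerayCoeff, if_neg hk, mul_sub, Finset.sum_sub_distrib]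
    have : ∑ l, (k l : ℂ) * ((∑ m, (k m : ℂ) * advectionCoeff u u k m) / (wavenumberSq k : ℂ)
        * (k l : ℂ)) = ∑ m, (k m : ℂ) * advectionCoeff u u k m := by
      rw [Fin.sum_univ_two (f := fun l ↦ (k l : ℂ) * ((∑ m, (k m : ℂ) * advectionCoeff u u k m)
        / (wavenumberSq k : ℂ) * (k l : ℂ)))]
      generalize ∑ m, (k m : ℂ) * advectionCoeff u u k m = S
      field_simp
      rw [wavenumberSq_cast]
    rw [this, sub_self]

section

/-! ### The size of the right hand side of the vorticity equation -/

section

variable {ν K : ℝ} {M : Matrix (Fin 2) (Fin 2) ℝ} {w γ : Fin 2 → ℝ → (Fin 2 → ℤ) → ℂ}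

/-- The bound is at most quadratic in the gradient G once B bounds the vorticities, hence integrable
in time for solutions in C([0, T]; V) ∩ L²(0, T; D(A)). -/
lemma tsum_norm_mul_vortRHS_le (hν : 0 ≤ ν) {s Γ B G : ℝ} (i j : Fin 2) (hw : ∀ i, H1 (w i s))
    (hγ : Sq (igrad (γ j s))) (hΓ : l2 (igrad (γ j s)) ≤ Γ) (hB : ∀ i, l2 (w i s) ≤ B)
    (hG : ∀ i, l2 (grad (w i s)) ≤ G) :
    (Summable fun k ↦ ‖w i s k‖ * ‖vortRHS ν K M w γ j s k‖) ∧
      ∑' k, ‖w i s k‖ * ‖vortRHS ν K M w γ j s k‖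
        ≤ Γ * G + (ν + agmonConst * B * (1 + |M j 0| + |M j 1|)) * G ^ 2 := by
  have hA : 0 ≤ agmonConst := Real.sqrt_nonneg _
  have hΓ0 := (l2_nonneg _).trans hΓ
  have hB0 := (l2_nonneg _).trans (hB 0)
  have hG0 := (l2_nonneg _).trans (hG 0)
  have hn : ∀ m, (Summable fun k ↦ ‖nonlin (w m s) (w m s) k‖ * ‖w i s k‖) ∧
      ∑' k, ‖nonlin (w m s) (w m s) k‖ * ‖w i s k‖ ≤ agmonConst * B * G ^ 2 := fun m ↦ by
    have h := summable_nonlin_mul (hw m) (hw m).sq (hw i).sq_grad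
    refine ⟨h.1, h.2.1.trans ?_⟩
    have h1 := hB m
    have h2 := hG m
    have h3 := hG i
    have h4 := l2_nonneg (w m s)
    have h5 := l2_nonneg (grad (w m s))
    have h6 := l2_nonneg (grad (w i s))
    calc _ ≤ agmonConst * G * B * G := by gcongr
      _ = _ := by ring
  have s1 := summable_norm_mul hγ (hw i).sq_grad
  have b1 : ∑' k, ‖igrad (γ j s) k‖ * ‖grad (w i s) k‖ ≤ Γ * G :=
    (tsum_norm_mul_le hγ (hw i).sq_grad).trans (mul_le_mul hΓ (hG i) (l2_nonneg _) hΓ0)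
  have s2 := summable_norm_mul (hw j).sq_grad (hw i).sq_grad
  have b2 : ∑' k, ‖grad (w j s) k‖ * ‖grad (w i s) k‖ ≤ G * G :=
    (tsum_norm_mul_le (hw j).sq_grad (hw i).sq_grad).trans
      (mul_le_mul (hG j) (hG i) (l2_nonneg _) hG0)
  have hsum := (((s1.hasSum.add (s2.hasSum.mul_left ν)).add (hn j).1.hasSum).add
    ((hn 0).1.hasSum.mul_left |M j 0|)).add ((hn 1).1.hasSum.mul_left |M j 1|)
  have hle : ∀ k, ‖w i s k‖ * ‖vortRHS ν K M w γ j s k‖ ≤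
      ‖igrad (γ j s) k‖ * ‖grad (w i s) k‖ + ν * (‖grad (w j s) k‖ * ‖grad (w i s) k‖)
      + ‖nonlin (w j s) (w j s) k‖ * ‖w i s k‖
      + |M j 0| * (‖nonlin (w 0 s) (w 0 s) k‖ * ‖w i s k‖)
      + |M j 1| * (‖nonlin (w 1 s) (w 1 s) k‖ * ‖w i s k‖) := fun k ↦ by
    have e1 := norm_mul_eq_igrad_mul_grad (f := γ j s) (hw i).zero k
    have e2 : ‖lap (w j s) k‖ * ‖w i s k‖ = ‖grad (w j s) k‖ * ‖grad (w i s) k‖ := by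
      rw [norm_grad, norm_grad, lap, norm_mul, Complex.norm_real,
        Real.norm_of_nonneg (wavenumberSq_nonneg k), ← nrm_sq]
      ring
    have e3 : ‖vortRHS ν K M w γ j s k‖ ≤ ‖γ j s k‖ + ν * ‖lap (w j s) k‖
        + (‖nonlin (w j s) (w j s) k‖ + (|M j 0| * ‖nonlin (w 0 s) (w 0 s) k‖
          + |M j 1| * ‖nonlin (w 1 s) (w 1 s) k‖)) := by
      rw [vortRHS_apply]
      refine (norm_sub_le _ _).trans (add_le_add ((norm_sub_le _ _).trans ?_)
        ((norm_sub_le _ _).trans (add_le_add le_rfl ((norm_add_le _ _).trans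
          (add_le_add ?_ ?_)))))
      · rw [norm_mul, Complex.norm_real, Real.norm_of_nonneg hν]
      · rw [norm_mul, Complex.norm_real, Real.norm_eq_abs]
        exact mul_le_mul_of_nonneg_left (norm_low_le _ _ _) (abs_nonneg _)
      · rw [norm_mul, Complex.norm_real, Real.norm_eq_abs]
        exact mul_le_mul_of_nonneg_left (norm_low_le _ _ _) (abs_nonneg _)
    rw [← e1, ← e2]
    calc _ ≤ ‖w i s k‖ * _ := mul_le_mul_of_nonneg_left e3 (norm_nonneg _)
      _ = _ := by ring
  have hs := Summable.of_nonneg_of_le (fun k ↦ by positivity) hle hsum.summable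
  refine ⟨hs, (hs.tsum_le_tsum hle hsum.summable).trans ?_⟩
  rw [hsum.tsum_eq]
  have f2 := mul_le_mul_of_nonneg_left b2 hν
  have f3 := mul_le_mul_of_nonneg_left (hn 0).2 (abs_nonneg (M j 0))
  have f4 := mul_le_mul_of_nonneg_left (hn 1).2 (abs_nonneg (M j 1))
  have f5 := (hn j).2
  linarith

end

/-! ### Forces -/

lemma IsForce.norm_le {g : ℝ → L2Field} (hg : IsForce g) :
    ∀ᵐ s : ℝ, 0 < s → g s ∈ H ∧
      ‖g s‖ ≤ (eLpNorm g ∞ (volume.restrict (Ioi (0 : ℝ)))).toReal := by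
  have h := (hg.2.and (ae_le_eLpNormEssSup (f := g) (μ := volume.restrict (Ioi (0 : ℝ)))))
  rw [ae_restrict_iff' measurableSet_Ioi] at h
  filter_upwards [h] with s hs hs0
  refine ⟨(hs hs0).1, ?_⟩
  have h1 := (hs hs0).2
  rw [← eLpNorm_exponent_top] at h1
  rw [← toReal_enorm]
  exact ENNReal.toReal_mono hg.1.2.ne h1

lemma forceBound_vort {g : Fin 2 → ℝ → L2Field} (hg : ∀ i, IsForce (g i)) :
    ForceBound (fun i s ↦ vort (g i s)) fun i ↦
      (eLpNorm (g i) ∞ (volume.restrict (Ioi (0 : ℝ)))).toReal / (2 * Real.pi) := by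
  have h := ae_all_iff.mpr fun i ↦ (hg i).norm_le
  filter_upwards [h] with s hs hs0 i
  obtain ⟨h1, h2⟩ := hs i hs0
  refine ⟨(sq_igrad_vort h1).1, ?_⟩
  rw [(sq_igrad_vort h1).2]
  gcongr

lemma IsSynchronous.vort {g : Fin 2 → ℝ → L2Field} (h : IsSynchronous g)
    (hg : ∀ i, IsForce (g i)) {η : ℝ} (hη : 0 < η) :
    ∃ T, 0 ≤ T ∧ ∀ᵐ s, T < s → l2 (igrad (vort (g 0 s) - vort (g 1 s))) ≤ η := by
  have hlt := h.eventually (gt_mem_nhds hη)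
  -- Membership in the infimum of the two filters separates a half-line of large times from a set of
  -- full measure.
  obtain ⟨A, hA, B, hB, hAB⟩ := mem_inf_iff.mp hlt
  obtain ⟨T, hT⟩ := mem_atTop_sets.mp hA
  refine ⟨max T 0, le_max_right _ _, ?_⟩
  filter_upwards [hB, (hg 0).norm_le, (hg 1).norm_le] with s hs h0 h1 hTs
  have hs0 : 0 < s := (le_max_right _ _).trans_lt hTs
  have hmem : s ∈ A ∩ B := ⟨hT s ((le_max_left _ _).trans hTs.le), hs⟩
  rw [← hAB] at hmem
  rw [← vort_sub, (sq_igrad_vort (sub_mem_H (h0 hs0).1 (h1 hs0).1)).2]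
  have : ‖g 0 s - g 1 s‖ < η := hmem
  refine le_trans (div_le_self (norm_nonneg _) ?_) this.le
  linarith [Real.pi_gt_three]

end

section

/-! ### Solutions in terms of the vorticity -/

variable {ν K : ℝ} {M : Matrix (Fin 2) (Fin 2) ℝ} {g v : Fin 2 → ℝ → L2Field}

lemma norm_le_l2 {α : (Fin 2 → ℤ) → ℂ} (h : Sq α) (k : Fin 2 → ℤ) : ‖α k‖ ≤ l2 α := by
  refine Real.le_sqrt_of_sq_le ?_
  exact (h : Summable _).le_tsum k fun _ _ ↦ sq_nonneg _

namespace IsDirectReplacementSolution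

lemma tendsto_l2_sub (hv : IsDirectReplacementSolution ν K M g v) (i : Fin 2) {t₀ : ℝ}
    (h0 : 0 ≤ t₀) :
    Tendsto (fun t ↦ l2 (vort (v i t) - vort (v i t₀))) (𝓝[Ici 0] t₀) (𝓝 0) := by
  have h := (hv.continuous_V i t₀ h0).div_const (2 * Real.pi)
  rw [zero_div] at h
  refine h.congr' ?_
  filter_upwards [self_mem_nhdsWithin] with t ht
  rw [← vort_sub, (sq_vort (sub_mem_V (hv.mem_V i t ht) (hv.mem_V i t₀ h0))).2]

lemma sq (hv : IsDirectReplacementSolution ν K M g v) (i : Fin 2) {t : ℝ} (ht : 0 ≤ t) :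
    Sq (vort (v i t)) := (sq_vort (hv.mem_V i t ht)).1

lemma continuousOn_vort (hv : IsDirectReplacementSolution ν K M g v) (i : Fin 2)
    (k : Fin 2 → ℤ) : ContinuousOn (fun t ↦ vort (v i t) k) (Ici 0) := by
  intro t₀ h0
  rw [ContinuousWithinAt, tendsto_iff_norm_sub_tendsto_zero]
  refine squeeze_zero' (Eventually.of_forall fun _ ↦ norm_nonneg _) ?_ (hv.tendsto_l2_sub i h0)
  filter_upwards [self_mem_nhdsWithin] with t ht
  exact norm_le_l2 ((hv.sq i ht).sub (hv.sq i h0)) k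

lemma continuousOn_l2 (hv : IsDirectReplacementSolution ν K M g v) (i : Fin 2) :
    ContinuousOn (fun t ↦ l2 (vort (v i t))) (Ici 0) := by
  intro t₀ h0
  rw [ContinuousWithinAt, tendsto_iff_norm_sub_tendsto_zero]
  refine squeeze_zero' (Eventually.of_forall fun _ ↦ norm_nonneg _) ?_ (hv.tendsto_l2_sub i h0)
  filter_upwards [self_mem_nhdsWithin] with t ht
  have ha := hv.sq i ht
  have hb := hv.sq i h0
  have h1 := l2_add_le (ha.sub hb) hb
  have h2 := l2_add_le (hb.sub ha) ha
  rw [sub_add_cancel] at h1 h2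
  have h3 : l2 (vort (v i t₀) - vort (v i t)) = l2 (vort (v i t) - vort (v i t₀)) := by
    simp only [l2, Pi.sub_apply, norm_sub_rev]
  rw [Real.norm_eq_abs, abs_le]
  constructor <;> linarith

lemma exists_l2_le (hv : IsDirectReplacementSolution ν K M g v) (T : ℝ) :
    ∃ B, ∀ i, ∀ t ∈ Icc 0 T, l2 (vort (v i t)) ≤ B := by
  have h : ∀ i, ∃ B, ∀ t ∈ Icc 0 T, l2 (vort (v i t)) ≤ B := fun i ↦ by
    obtain ⟨B, hB⟩ := isCompact_Icc.exists_bound_of_continuousOn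
      ((hv.continuousOn_l2 i).mono fun t (ht : t ∈ Icc 0 T) ↦ ht.1)
    exact ⟨B, fun t ht ↦ (le_abs_self _).trans (hB t ht)⟩
  choose B hB using h
  refine ⟨max (B 0) (B 1), fun i t ht ↦ (hB i t ht).trans ?_⟩
  fin_cases i
  · exact le_max_left _ _
  · exact le_max_right _ _

lemma aestronglyMeasurable_vort (hv : IsDirectReplacementSolution ν K M g v) (i : Fin 2)
    (k : Fin 2 → ℤ) (T : ℝ) :
    AEStronglyMeasurable (fun t ↦ vort (v i t) k) (volume.restrict (Ioc 0 T)) :=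
  ((hv.continuousOn_vort i k).mono fun _ ht ↦ ht.1.le).aestronglyMeasurable measurableSet_Ioc

lemma aestronglyMeasurable_nonlin (hv : IsDirectReplacementSolution ν K M g v) (i : Fin 2)
    (k : Fin 2 → ℤ) (T : ℝ) :
    AEStronglyMeasurable (fun t ↦ nonlin (vort (v i t)) (vort (v i t)) k)
      (volume.restrict (Ioc 0 T)) := by
  refine aestronglyMeasurable_of_tendsto_ae atTop (f := fun (S : Finset (Fin 2 → ℤ)) t ↦
    ∑ h ∈ S, (kern h (k - h) : ℂ) * vort (v i t) h * vort (v i t) (k - h)) (fun S ↦ ?_) ?_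
  · exact Finset.aestronglyMeasurable_fun_sum _ fun h _ ↦
      ((hv.aestronglyMeasurable_vort i h T).const_mul _).mul
        (hv.aestronglyMeasurable_vort i (k - h) T)
  · rw [ae_restrict_iff' measurableSet_Ioc]
    refine ae_of_all _ fun t ht ↦ ?_
    have hs := hv.sq i ht.1.le
    exact (summable_nonlin hs hs k).1.hasSum

lemma integrableOn_nonlin (hv : IsDirectReplacementSolution ν K M g v) (i : Fin 2)
    (k : Fin 2 → ℤ) (T : ℝ) :
    IntegrableOn (fun t ↦ nonlin (vort (v i t)) (vort (v i t)) k) (Ioc 0 T) := by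
  obtain ⟨B, hB⟩ := hv.exists_l2_le T
  refine IntegrableOn.of_bound measure_Ioc_lt_top (hv.aestronglyMeasurable_nonlin i k T)
    (nrm k * (B * B)) ?_
  rw [ae_restrict_iff' measurableSet_Ioc]
  refine ae_of_all _ fun t ht ↦ ?_
  have hs := hv.sq i ht.1.le
  refine (summable_nonlin hs hs k).2.trans (mul_le_mul_of_nonneg_left ?_ (nrm_nonneg k))
  have h1 := hB i t ⟨ht.1.le, ht.2⟩
  have h2 := l2_nonneg (vort (v i t))
  exact mul_le_mul h1 h1 h2 (h2.trans h1)

lemma integrableOn_low_nonlin (hv : IsDirectReplacementSolution ν K M g v) (i : Fin 2)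
    (k : Fin 2 → ℤ) (T : ℝ) :
    IntegrableOn (fun t ↦ low K (nonlin (vort (v i t)) (vort (v i t))) k) (Ioc 0 T) := by
  unfold low
  split_ifs
  · exact hv.integrableOn_nonlin i k T
  · exact integrableOn_zero

lemma intervalIntegrable_vortRHS (hv : IsDirectReplacementSolution ν K M g v)
    (hg : ∀ i, IsForce (g i)) (i : Fin 2) (k : Fin 2 → ℤ) {T : ℝ} (hT : 0 ≤ T) :
    IntervalIntegrable (fun s ↦ vortRHS ν K M (fun i t ↦ vort (v i t)) (fun i t ↦ vort (g i t))
      i s k) volume 0 T := by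
  rw [intervalIntegrable_iff_integrableOn_Ioc_of_le hT]
  simp only [vortRHS_apply]
  have hforce : IntegrableOn (fun s ↦ vort (g i s) k) (Ioc 0 T) := by
    refine IntegrableOn.of_bound measure_Ioc_lt_top
      (((continuous_vort k).comp_aestronglyMeasurable (hg i).1.1).mono_measure
        (Measure.restrict_mono (fun t ht ↦ ht.1) le_rfl))
      (nrm k * ((eLpNorm (g i) ∞ (volume.restrict (Ioi (0 : ℝ)))).toReal / (2 * Real.pi))) ?_
    rw [ae_restrict_iff' measurableSet_Ioc]
    filter_upwards [forceBound_vort hg] with s hs hs0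
    rw [norm_vort]
    exact mul_le_mul_of_nonneg_left ((norm_le_l2 (hs hs0.1 i).1 k).trans (hs hs0.1 i).2)
      (nrm_nonneg k)
  have hlap : IntegrableOn (fun s ↦ lap (vort (v i s)) k) (Ioc 0 T) :=
    ((((hv.continuousOn_vort i k).mono Icc_subset_Ici_self).integrableOn_Icc).mono_set
      Ioc_subset_Icc_self).const_mul _
  exact (hforce.sub (hlap.const_mul _)).sub ((hv.integrableOn_nonlin i k T).sub
    (((hv.integrableOn_low_nonlin 0 k T).const_mul _).add
      ((hv.integrableOn_low_nonlin 1 k T).const_mul _)))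

lemma lintegral_grad_lt_top (hv : IsDirectReplacementSolution ν K M g v) (i : Fin 2) {T : ℝ}
    (hT : 0 < T) :
    ∫⁻ t in Ioc 0 T, ∑' k, ENNReal.ofReal (‖grad (vort (v i t)) k‖ ^ 2) < ∞ := by
  have h := hv.integrable_domA i T hT
  have h1 : ∫⁻ t in Ioc 0 T, stokesNormSq (v i t) = ENNReal.ofReal ((2 * Real.pi) ^ 2) *
      ∫⁻ t in Ioc 0 T, ∑' k, ENNReal.ofReal (‖grad (vort (v i t)) k‖ ^ 2) := by
    rw [← lintegral_const_mul' _ _ ENNReal.ofReal_ne_top]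
    refine setLIntegral_congr_fun measurableSet_Ioc fun t ht ↦ ?_
    exact stokesNormSq_eq (hv.mem_V i t ht.1.le).1
  rw [h1] at h
  have hpi : ENNReal.ofReal ((2 * Real.pi) ^ 2) ≠ 0 := by
    rw [Ne, ENNReal.ofReal_eq_zero, not_le]; positivity
  by_contra hc
  rw [not_lt, top_le_iff] at hc
  rw [hc, ENNReal.mul_top hpi] at h
  exact lt_irrefl _ h

lemma aemeasurable_grad (hv : IsDirectReplacementSolution ν K M g v) (i : Fin 2) (T : ℝ) :
    AEMeasurable (fun t ↦ ∑' k, ENNReal.ofReal (‖grad (vort (v i t)) k‖ ^ 2))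
      (volume.restrict (Ioc 0 T)) :=
  AEMeasurable.tsum fun k ↦
    (((hv.aestronglyMeasurable_vort i k T).const_mul _).norm.aemeasurable.pow_const
      2).ennreal_ofReal

lemma ae_H1 (hv : IsDirectReplacementSolution ν K M g v) :
    ∀ᵐ s : ℝ, 0 < s → ∀ i, H1 (vort (v i s)) := by
  -- Finiteness almost everywhere is available on bounded intervals only; countably many of them
  -- exhaust the positive times.
  have h : ∀ i, ∀ n : ℕ, ∀ᵐ s : ℝ, s ∈ Ioc 0 ((n : ℝ) + 1) →
      ∑' k, ENNReal.ofReal (‖grad (vort (v i s)) k‖ ^ 2) < ∞ := fun i n ↦ by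
    rw [← ae_restrict_iff' measurableSet_Ioc]
    exact ae_lt_top' (hv.aemeasurable_grad i _) (hv.lintegral_grad_lt_top i (by positivity)).ne
  filter_upwards [ae_all_iff.mpr fun i ↦ ae_all_iff.mpr (h i)] with s hs hs0 i
  obtain ⟨n, hn⟩ := exists_nat_ge s
  have h1 := hs i n ⟨hs0, by linarith⟩
  refine ⟨vort_zero _, ?_⟩
  have h2 := ENNReal.summable_toReal h1.ne
  simp only [ENNReal.toReal_ofReal (sq_nonneg _)] at h2
  exact h2

lemma lintegral_vortRHS_lt_top (hv : IsDirectReplacementSolution ν K M g v)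
    (hg : ∀ i, IsForce (g i)) (hν : 0 ≤ ν) (i j : Fin 2) (T : ℝ) :
    ∫⁻ s in Ioc 0 T, ∑' k, ENNReal.ofReal (‖vort (v i s) k‖ * ‖vortRHS ν K M
      (fun i t ↦ vort (v i t)) (fun i t ↦ vort (g i t)) j s k‖) < ∞ := by
  rcases le_or_gt T 0 with hT | hT
  · simp [Ioc_eq_empty hT.not_gt]
  obtain ⟨B, hB⟩ := hv.exists_l2_le T
  obtain ⟨Γ, hΓ⟩ : ∃ Γ, Γ = (eLpNorm (g j) ∞ (volume.restrict (Ioi (0 : ℝ)))).toReal /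
    (2 * Real.pi) := ⟨_, rfl⟩
  have hB0 : 0 ≤ B := (l2_nonneg _).trans (hB 0 0 ⟨le_rfl, hT.le⟩)
  have hA : 0 ≤ agmonConst := Real.sqrt_nonneg _
  obtain ⟨C, hC⟩ : ∃ C, C = ν + agmonConst * B * (1 + |M j 0| + |M j 1|) + 1 := ⟨_, rfl⟩
  have hC0 : 0 ≤ C := by rw [hC]; positivity
  let D : Fin 2 → ℝ → ℝ≥0∞ := fun m s ↦ ∑' k, ENNReal.ofReal (‖grad (vort (v m s)) k‖ ^ 2)
  have hle : ∀ᵐ s ∂volume.restrict (Ioc 0 T), ∑' k, ENNReal.ofReal (‖vort (v i s) k‖ *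
      ‖vortRHS ν K M (fun i t ↦ vort (v i t)) (fun i t ↦ vort (g i t)) j s k‖)
      ≤ ENNReal.ofReal (Γ ^ 2) + ENNReal.ofReal C * (D 0 s + D 1 s) := by
    rw [ae_restrict_iff' measurableSet_Ioc]
    filter_upwards [hv.ae_H1, forceBound_vort hg] with s hs hγ hsT
    have hw := hs hsT.1
    have hD : ∀ m, D m s = ENNReal.ofReal (l2 (grad (vort (v m s))) ^ 2) := fun m ↦ by
      rw [l2_sq, ENNReal.ofReal_tsum_of_nonneg (fun _ ↦ sq_nonneg _) (hw m).sq_grad]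
    have hG : ∀ m, l2 (grad (vort (v m s))) ≤
        √(l2 (grad (vort (v 0 s))) ^ 2 + l2 (grad (vort (v 1 s))) ^ 2) := fun m ↦ by
      refine Real.le_sqrt_of_sq_le ?_
      fin_cases m
      · simpa using sq_nonneg (l2 (grad (vort (v 1 s))))
      · simpa using sq_nonneg (l2 (grad (vort (v 0 s))))
    have h := tsum_norm_mul_vortRHS_le (K := K) (M := M) hν (w := fun i t ↦ vort (v i t))
      (γ := fun i t ↦ vort (g i t)) i j hw (hγ hsT.1 j).1 ((hγ hsT.1 j).2.trans hΓ.ge)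
      (fun m ↦ hB m s ⟨hsT.1.le, hsT.2⟩) hG
    rw [← ENNReal.ofReal_tsum_of_nonneg (fun _ ↦ by positivity) h.1, hD, hD,
      ← ENNReal.ofReal_add (by positivity) (by positivity), ← ENNReal.ofReal_mul hC0,
      ← ENNReal.ofReal_add (by positivity) (by positivity)]
    refine ENNReal.ofReal_le_ofReal (h.2.trans ?_)
    set Q := l2 (grad (vort (v 0 s))) ^ 2 + l2 (grad (vort (v 1 s))) ^ 2 with hQ
    have hQ0 : 0 ≤ Q := by positivity
    have hsq := Real.sq_sqrt hQ0
    have hy : Γ * √Q ≤ Γ ^ 2 + √Q ^ 2 := by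
      nlinarith [sq_nonneg (Γ - √Q), sq_nonneg Γ, sq_nonneg √Q]
    rw [hsq] at hy ⊢
    rw [hC]
    linarith
  refine (lintegral_mono_ae hle).trans_lt ?_
  rw [lintegral_add_left measurable_const, lintegral_const_mul' _ _ ENNReal.ofReal_ne_top,
    lintegral_add_left' (hv.aemeasurable_grad 0 T)]
  refine ENNReal.add_lt_top.mpr ⟨?_, ENNReal.mul_lt_top ENNReal.ofReal_lt_top
    (ENNReal.add_lt_top.mpr ⟨hv.lintegral_grad_lt_top 0 hT, hv.lintegral_grad_lt_top 1 hT⟩)⟩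
  simp [ENNReal.mul_lt_top]

/-- For k ≠ 0 both components of the equation are Biot-Savart multiples of one scalar equation, and
taking the curl recovers it since the curl of the multipliers is 1. At k = 0 every term vanishes. -/
lemma vort_eq (hv : IsDirectReplacementSolution ν K M g v) (hg : ∀ i, IsForce (g i)) (i : Fin 2)
    (k : Fin 2 → ℤ) {t : ℝ} (ht : 0 ≤ t) :
    vort (v i t) k = vort (v i 0) k + ∫ s in (0 : ℝ)..t, vortRHS ν K M (fun i t ↦ vort (v i t))
      (fun i t ↦ vort (g i t)) i s k := by
  by_cases hk : k = 0
  · have h0 : ∀ s, vortRHS ν K M (fun i t ↦ vort (v i t)) (fun i t ↦ vort (g i t)) i s 0 = 0 :=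
      fun s ↦ by simp [vortRHS_apply, vort_zero, lap, nonlin_zero, low]
    simp [hk, vort_zero, h0]
  have hcongr : ∀ l, (∫ s in (0 : ℝ)..t, (fieldCoeff (g i s) k l
          - (ν : ℂ) * (wavenumberSq k : ℂ) * fieldCoeff (v i s) k l
          - bilinearCoeff (v i s) (v i s) k l
          + ∑ j, (M i j : ℂ) * lowModeCoeff K k (bilinearCoeff (v j s) (v j s) k l)))
      = biotSavart k l * ∫ s in (0 : ℝ)..t, vortRHS ν K M (fun i t ↦ vort (v i t))
          (fun i t ↦ vort (g i t)) i s k := fun l ↦ by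
    rw [← intervalIntegral.integral_const_mul]
    refine intervalIntegral.integral_congr_ae ?_
    filter_upwards [(hg i).norm_le] with s hs hst
    rw [uIoc_of_le ht] at hst
    have hmem := fun j ↦ hv.mem_V j s hst.1.le
    have hlow : ∀ j, lowModeCoeff K k (bilinearCoeff (v j s) (v j s) k l)
        = biotSavart k l * low K (nonlin (vort (v j s)) (vort (v j s))) k := fun j ↦ by
      rw [bilinearCoeff_eq (hmem j), lowModeCoeff, low, nrm]
      split_ifs <;> simp
    rw [fieldCoeff_eq_biotSavart (hs hst.1).1, fieldCoeff_eq_biotSavart (hmem i).1,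
      bilinearCoeff_eq (hmem i), Fin.sum_univ_two, hlow, hlow, vortRHS_apply, lap]
    ring
  have h0 := hv.equation i t k 0 ht
  have h1 := hv.equation i t k 1 ht
  rw [hcongr] at h0 h1
  have hc := curl_biotSavart hk
  generalize ∫ s in (0 : ℝ)..t, vortRHS ν K M (fun i t ↦ vort (v i t))
    (fun i t ↦ vort (g i t)) i s k = S at *
  simp only [vort, h0, h1]
  linear_combination S * hc

/-- The vorticities of a solution of the intertwinement solve the vorticity equation. -/
theorem isVorticity (hv : IsDirectReplacementSolution ν K M g v) (hg : ∀ i, IsForce (g i))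
    (hν : 0 ≤ ν) :
    IsVorticity ν K M (fun i t ↦ vort (v i t)) (fun i t ↦ vort (g i t)) where
  ae_H1 := hv.ae_H1
  sq i _ ht := hv.sq i ht
  isReal i t _ := isReal_vort (v i t)
  intervalIntegrable i k _ hT := hv.intervalIntegrable_vortRHS hg i k hT
  eq i k _ ht := hv.vort_eq hg i k ht
  finite i j T _ := hv.lintegral_vortRHS_lt_top hg hν i j T

lemma pairNormV_sq (hv : IsDirectReplacementSolution ν K M g v) {t : ℝ} (ht : 0 ≤ t) :
    l2 (vort (v 0 t)) ^ 2 + l2 (vort (v 1 t)) ^ 2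
      = (pairNormV fun i ↦ v i t) ^ 2 / (2 * Real.pi) ^ 2 := by
  rw [(sq_vort (hv.mem_V 0 t ht)).2, (sq_vort (hv.mem_V 1 t ht)).2, pairNormV,
    Real.sq_sqrt (Finset.sum_nonneg fun _ _ ↦ sq_nonneg _), Fin.sum_univ_two, div_pow, div_pow,
    add_div]

end IsDirectReplacementSolution

end

section

/-! ### The asymptotic bound -/

variable {ν K θ₁ θ₂ m₀ : ℝ} {g v : Fin 2 → ℝ → L2Field}

/-- The bound on the curl of the `i`-th force. -/
def curlForce (g : Fin 2 → ℝ → L2Field) (i : Fin 2) : ℝ :=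
  (eLpNorm (g i) ∞ (volume.restrict (Ioi (0 : ℝ)))).toReal / (2 * Real.pi)

lemma forceSize_nonneg (ν : ℝ) (g : Fin 2 → ℝ → L2Field) : 0 ≤ forceSize ν g := Real.sqrt_nonneg _

lemma sum_curlForce_sq (hν : 0 < ν) :
    curlForce g 0 ^ 2 + curlForce g 1 ^ 2 = ν ^ 4 * forceSize ν g ^ 2 / (2 * Real.pi) ^ 2 := by
  rw [forceSize, Real.sq_sqrt (Finset.sum_nonneg fun _ _ ↦ sq_nonneg _), Fin.sum_univ_two,
    curlForce, curlForce]
  field_simp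

lemma one_le_two_pi_sq : (1 : ℝ) ≤ (2 * Real.pi) ^ 2 := by nlinarith [Real.pi_gt_three]

lemma le_sq_of_sqrt_mul_le {C : ℝ} (hC : 0 ≤ C) (hK : 0 < K)
    (h : C * √(logK K) * forceSize ν g ≤ K) :
    C ^ 2 * logK K * forceSize ν g ^ 2 ≤ K ^ 2 := by
  have h1 := pow_le_pow_left₀
    (mul_nonneg (mul_nonneg hC (Real.sqrt_nonneg _)) (forceSize_nonneg ν g)) h 2
  rwa [mul_pow, mul_pow, Real.sq_sqrt (zero_le_one.trans (one_le_logK hK))] at h1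

/-- The estimates below use the smallness condition only through √L and the first power of 1 + x. -/
lemma div_logK_mul_pow_le {c x : ℝ} (hc : 0 ≤ c) (hK : 0 < K) (hx : 0 ≤ x) :
    c / (logK K * (1 + x) ^ 4) ≤ c / (√(logK K) * (1 + x)) := by
  have hL := one_le_logK hK
  have h1 : √(logK K) ≤ logK K := by
    rw [Real.sqrt_le_left (by linarith)]
    nlinarith
  have h2 : 1 + x ≤ (1 + x) ^ 4 := le_self_pow₀ (by linarith) (by norm_num)
  have h3 := one_le_sqrt_logK hK
  gcongr

lemma IsDirectReplacementSolution.eventually_sum_l2_sq_le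
    (hv : IsDirectReplacementSolution ν K (symMatrix θ₁ θ₂) g v) (hν : 0 < ν) (hK : 0 < K)
    (hθ : θ₁ + θ₂ = 1) (hg : ∀ i, IsForce (g i)) (hs : IsSynchronous g)
    (hm : pairNormV (fun i ↦ v i 0) ≤ ν * m₀) (hF : 100 * √(logK K) * forceSize ν g ≤ K)
    (hm₀ : θ₁ ≤ 1 ∨ 100 * √(logK K) * m₀ ≤ K)
    (hmin : min |1 - θ₁| |θ₁ - θ₂| ≤ 1 / 1000 / (logK K * (1 + m₀ + forceSize ν g) ^ 4))
    {η : ℝ} (hη : 0 < η) :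
    ∀ᶠ t in atTop, l2 (vort (v 0 t)) ^ 2 + l2 (vort (v 1 t)) ^ 2
      ≤ 2000 * (curlForce g 0 ^ 2 + curlForce g 1 ^ 2) / ν ^ 2 + η := by
  have hvort := hv.isVorticity hg hν.le
  have hFB : ForceBound (fun i s ↦ vort (g i s)) (curlForce g) := forceBound_vort hg
  have hF0 := forceSize_nonneg ν g
  have hP0 : 0 ≤ pairNormV fun i ↦ v i 0 := Real.sqrt_nonneg _
  have hm0 : 0 ≤ m₀ := nonneg_of_mul_nonneg_right (hP0.trans hm) hν
  have hL := one_le_sqrt_logK hK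
  have hLpos : 0 < √(logK K) := by linarith
  set F := forceSize ν g
  rw [add_assoc] at hmin
  have hmin' := hmin.trans (div_logK_mul_pow_le (by norm_num) hK (add_nonneg hm0 hF0))
  have hden : 1 ≤ √(logK K) * (1 + (m₀ + F)) := one_le_mul_of_one_le_of_one_le hL (by linarith)
  have hsm : min |1 - θ₁| |θ₁ - θ₂| ≤ 1 / 1000 :=
    hmin'.trans (div_le_self (by norm_num) hden)
  have hpi := one_le_two_pi_sq
  have hsum := sum_curlForce_sq (g := g) hν
  rcases le_or_gt θ₁ 1 with h1 | h1
  · have h2 : θ₂ ≤ 1 := by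
      -- Either alternative of the minimum puts θ₂ close to 0 or to 1/2, in particular below 1.
      rcases min_le_iff.mp hsm with h | h <;> linarith [(abs_le.mp h).1, (abs_le.mp h).2]
    refine hvort.eventually_le_of_nonneg hθ (by linarith) h2 hν hK hFB
      (fun η hη ↦ hs.vort hg hη) ?_ hη
    rw [hsum]
    have h3 := le_sq_of_sqrt_mul_le (by norm_num) hK hF
    have h4 : ν ^ 4 * F ^ 2 / (2 * Real.pi) ^ 2 ≤ ν ^ 4 * F ^ 2 := div_le_self (by positivity) hpi
    have h5 : 0 ≤ logK K := zero_le_one.trans (one_le_logK hK)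
    calc 1000 * logK K * (ν ^ 4 * F ^ 2 / (2 * Real.pi) ^ 2)
        ≤ 100 ^ 2 * logK K * (ν ^ 4 * F ^ 2) := by gcongr; norm_num
      _ = ν ^ 4 * (100 ^ 2 * logK K * F ^ 2) := by ring
      _ ≤ _ := by gcongr
  · have hmK : 100 * √(logK K) * m₀ ≤ K := hm₀.resolve_left (not_le.mpr h1)
    have he : -θ₂ ≤ 1 / 1000 / (√(logK K) * (1 + (m₀ + F))) := by
      rcases min_le_iff.mp hmin' with h | h
      · linarith [(abs_le.mp h).1]
      -- For θ₁ > 1 one has θ₁ - θ₂ = 2θ₁ - 1 > 1, so only the alternative with |1 - θ₁| can occur.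
      · exfalso
        have := h.trans (div_le_self (by norm_num) hden)
        linarith [(abs_le.mp this).2]
    -- The positive margin δ makes the initial inequality strict even if m₀ and the force vanish.
    -- Both caps preserve the smallness: 1 fits into the factor 1 + m₀ + F, and the other obeys the
    -- same bound by K as m₀ and F.
    obtain ⟨δ, hδ⟩ : ∃ δ, δ = min 1 (K / (100 * √(logK K))) := ⟨_, rfl⟩
    have hδ0 : 0 < δ := hδ ▸ lt_min one_pos (by positivity)
    have hδ1 : δ ≤ 1 := hδ ▸ min_le_left _ _
    have hδK : 100 * √(logK K) * δ ≤ K := by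
      have : δ ≤ K / (100 * √(logK K)) := hδ ▸ min_le_right _ _
      rwa [le_div_iff₀ (by positivity), mul_comm] at this
    have key := hvort.eventually_le_of_neg hθ (by linarith) hν hK hFB (ρ := ν * (m₀ + F + δ))
      (by positivity) ?_ ?_ hη
    · filter_upwards [key] with t ht
      refine ht.trans (add_le_add ?_ le_rfl)
      gcongr
      norm_num
    · have h2 : (pairNormV fun i ↦ v i 0) ^ 2 ≤ (ν * m₀) ^ 2 := pow_le_pow_left₀ hP0 hm 2
      have hpi' : (4 : ℝ) ≤ (2 * Real.pi) ^ 2 := by nlinarith [Real.pi_gt_three]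
      rw [hv.pairNormV_sq le_rfl, hsum]
      have h3 : (pairNormV fun i ↦ v i 0) ^ 2 / (2 * Real.pi) ^ 2 ≤ (ν * m₀) ^ 2 :=
        (div_le_self (sq_nonneg _) hpi).trans h2
      have h4 : 4 * (ν ^ 4 * F ^ 2 / (2 * Real.pi) ^ 2) / ν ^ 2 ≤ ν ^ 2 * F ^ 2 := by
        rw [div_le_iff₀ (by positivity), mul_div_assoc', div_le_iff₀ (by positivity)]
        have : 4 * (ν ^ 4 * F ^ 2) ≤ (2 * Real.pi) ^ 2 * (ν ^ 4 * F ^ 2) := by gcongr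
        linarith
      have h5 : (ν * (m₀ + F + δ)) ^ 2 = (ν * m₀) ^ 2 + ν ^ 2 * F ^ 2
          + ν ^ 2 * (2 * m₀ * F + 2 * m₀ * δ + 2 * F * δ + δ ^ 2) := by ring
      have h6 : 0 < ν ^ 2 * (2 * m₀ * F + 2 * m₀ * δ + 2 * F * δ + δ ^ 2) := by positivity
      linarith
    · have h2 : 14 * √(logK K) * K⁻¹ * (m₀ + F + δ) ≤ 14 * 3 / 100 := by
        have : 14 * √(logK K) * K⁻¹ * (m₀ + F + δ)
            = 14 / 100 * (100 * √(logK K) * m₀ + 100 * √(logK K) * F + 100 * √(logK K) * δ) / K := by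
          field_simp
        rw [this, div_le_iff₀ hK]
        linarith
      have h3 : 28 * (-θ₂) * √(logK K) * (m₀ + F + δ) ≤ 28 / 1000 := by
        rw [le_div_iff₀ (by positivity)] at he
        have h4 : -θ₂ * √(logK K) * (m₀ + F + δ) ≤ -θ₂ * √(logK K) * (1 + (m₀ + F)) := by
          have : 0 ≤ -θ₂ := by linarith
          have : m₀ + F + δ ≤ 1 + (m₀ + F) := by linarith
          exact mul_le_mul_of_nonneg_left this (by positivity)
        linarith
      calc _ = ν * (14 * √(logK K) * K⁻¹ * (m₀ + F + δ)
            + 28 * (-θ₂) * √(logK K) * (m₀ + F + δ)) := by ring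
        _ ≤ ν * 1 := by gcongr; linarith
        _ = ν := mul_one ν

lemma IsDirectReplacementSolution.eventually_pairNormV_le
    (hv : IsDirectReplacementSolution ν K (symMatrix θ₁ θ₂) g v) (hν : 0 < ν) (hK : 0 < K)
    (hθ : θ₁ + θ₂ = 1) (hg : ∀ i, IsForce (g i)) (hs : IsSynchronous g)
    (hm : pairNormV (fun i ↦ v i 0) ≤ ν * m₀) (hF : 100 * √(logK K) * forceSize ν g ≤ K)
    (hm₀ : θ₁ ≤ 1 ∨ 100 * √(logK K) * m₀ ≤ K)
    (hmin : min |1 - θ₁| |θ₁ - θ₂| ≤ 1 / 1000 / (logK K * (1 + m₀ + forceSize ν g) ^ 4))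
    {η : ℝ} (hη : 0 < η) :
    ∀ᶠ t in atTop, pairNormV (fun i ↦ v i t) ≤ 50 * ν * forceSize ν g + η := by
  have hF0 := forceSize_nonneg ν g
  -- The factors (2π)² of force and solution cancel, so this margin becomes η² for the squared norm;
  -- then 2000 ≤ 50² leads to the constant 50.
  have h := hv.eventually_sum_l2_sq_le hν hK hθ hg hs hm hF hm₀ hmin
    (η := η ^ 2 / (2 * Real.pi) ^ 2) (by positivity)
  filter_upwards [h, eventually_ge_atTop 0] with t ht ht0
  have h1 : 2000 * (ν ^ 4 * forceSize ν g ^ 2 / (2 * Real.pi) ^ 2) / ν ^ 2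
      = 2000 * ν ^ 2 * forceSize ν g ^ 2 / (2 * Real.pi) ^ 2 := by field_simp
  rw [hv.pairNormV_sq ht0, sum_curlForce_sq hν, h1, ← add_div,
    div_le_div_iff_of_pos_right (by positivity)] at ht
  refine le_of_sq_le_sq (ht.trans ?_) (by positivity)
  have h2 : 0 ≤ ν * forceSize ν g * η := by positivity
  nlinarith [sq_nonneg (ν * forceSize ν g)]

end

end NSE

end

theorem mainTheorem8 :
    ∃ C₁ C₂ C₃ : ℝ, 0 < C₁ ∧ 0 < C₂ ∧ 0 < C₃ ∧
      ∀ (ν K θ₁ θ₂ m₀ : ℝ) (g v : Fin 2 → ℝ → NSE.L2Field),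
        0 < ν → 0 < K → θ₁ + θ₂ = 1 →
        (∀ i, NSE.IsForce (g i)) → NSE.IsSynchronous g →
        NSE.IsDirectReplacementSolution ν K (NSE.symMatrix θ₁ θ₂) g v →
        NSE.pairNormV (fun i => v i 0) ≤ ν * m₀ →
        C₁ * √(Real.log (Real.exp 1 + K)) * NSE.forceSize ν g ≤ K →
        (θ₁ ≤ 1 ∨ C₁ * √(Real.log (Real.exp 1 + K)) * m₀ ≤ K) →
        min |1 - θ₁| |θ₁ - θ₂| ≤
          C₂ / (Real.log (Real.exp 1 + K) * (1 + m₀ + NSE.forceSize ν g) ^ 4) →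
        Filter.limsup (fun t : ℝ => ((NSE.pairNormV (fun i => v i t) : ℝ) : EReal)) Filter.atTop
          ≤ ((C₃ * ν * NSE.forceSize ν g : ℝ) : EReal) := by
  refine ⟨100, 1 / 1000, 50, by norm_num, by norm_num, by norm_num, ?_⟩
  intro ν K θ₁ θ₂ m₀ g v hν hK hθ hg hs hv hm hF hm₀ hmin
  -- It suffices to bound the limsup by each real z above the target, the excess serving as η.
  refine EReal.le_of_forall_lt_iff_le.mp fun z hz ↦ ?_
  rw [EReal.coe_lt_coe_iff] at hz
  refine Filter.limsup_le_of_le ?_ ?_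
  · exact Filter.isCobounded_le_of_bot
  · filter_upwards [hv.eventually_pairNormV_le hν hK hθ hg hs hm hF hm₀ hmin (sub_pos.mpr hz)]
      with t ht
    rw [EReal.coe_le_coe_iff]
    linarith
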